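/- Let $\hbar,m,\sigma_0>0$ and $\beta\in(\mathbb R\setminus\{0\})\cup\{\infty\}$. Let $\mathsf H_\beta$ be the operator in $L^2(\mathbb R)$ which acts as $-\frac{\hbar^2}{2m}\frac{d^2}{dx^2}$ on $\mathbb R\setminus\{0\}$, with domain consisting of all $\psi\in H^2(\mathbb R\setminus\{0\})$ such that $\psi'(0^+)=\psi'(0^-)=:\psi'(0)$ and $\psi(0^+)-\psi(0^-)=\frac{2m\beta}{\hbar^2}\psi'(0)$ (for $\beta=\infty$: $\psi'(0^+)=\psi'(0^-)=0$). For every such $\hbar,m,\beta$ there is exactly one strongly continuous unitary group $e^{-i\frac t\hbar \mathsf H_\beta}$, $t\in\mathbb R$, whose generator is $-\frac i\hbar\mathsf H_\beta$. For $\xi=(q,p)\in\mathbb R^2$, $x\in\mathbb R$ and $\sigma\in\mathbb C$ with $\operatorname{Re}\sigma=\sigma_0$ put $$\psi^\hbar_{\sigma,\xi}(x)=\phi^\hbar_{\sigma,x}(\xi)=\frac{1}{(2\pi\hbar)^{1/4}\sqrt\sigma}\exp\Big(-\frac{(x-q)^2}{4\hbar\sigma_0\sigma}+\frac i\hbar p(x-q)\Big),$$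 and for $t\in\mathbb R$ put $\sigma_t=\sigma_0+\frac{it}{2m\sigma_0}$, $A_t=\frac{p^2t}{2m}$. Let $B(p)=-\frac{2\beta}{\hbar^3}p^2$ (with $\frac1{B(p)}=0$ if $\beta=\infty$) and, for $f:\mathbb R^2\to\mathbb C$, let $$(e^{itL_B}f)(q,p)=f\Big(q+\frac{pt}m,p\Big)-\frac{\theta(-tqp)\,\theta\big(\frac{|pt|}m-|q|\big)}{1-\operatorname{sgn}(t)\frac{2i|p|}{mB(p)}}\Big(f\Big(q+\frac{pt}m,p\Big)-f\Big(-q-\frac{pt}m,-p\Big)\Big),$$ where $\theta$ is the Heaviside function. For $qp\neq0$ put $t_{coll}(\xi)=-\frac{mq}p$ and $$\underline h=\max\Big\{\frac{\hbar\sigma_0^2}{q^2},\ \frac{\hbar}{\sigma_0^2p^2},\ \frac{\hbar}{(m|\beta p|)^{1/3}}\Big\}$$ (the last entry being $0$ if $\beta=\infty$). Then for every $0<\lambda<\frac12$ there exist constants $0<h_*<1$ and $C_*,c_0>0$, depending only on $\lambda$, such that for all $\hbar,m,\sigma_0>0$, all $\beta\in(\mathbb R\setminus\{0\})\cup\{\infty\}$,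 all $\xi=(q,p)\in\mathbb R^2$ with $qp\ne0$ and $\underline h<h_*$, and all $t\in\mathbb R$ with $$|t-t_{coll}(\xi)|\ \ge\ c_0\,|t_{coll}(\xi)|\,\sqrt{\big(\tfrac72-\lambda\big)\,\underline h\,|\ln\underline h|},$$ one has $$\Big\|e^{-i\frac t\hbar\mathsf H_\beta}\psi^\hbar_{\sigma_0,\xi}-e^{\frac i\hbar A_t}\big(e^{itL_B}\phi^\hbar_{\sigma_t,(\cdot)}\big)(\xi)\Big\|_{L^2(\mathbb R)}\ \le\ C_*\,\underline h^{\frac72-\lambda}.$$ -/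

import Mathlib

open MeasureTheory Complex OnePoint

noncomputable section

namespace DeltaPrime

/-- The Hilbert space `L²(ℝ)` of complex-valued functions, with Lebesgue measure. -/
abbrev L2 : Type := Lp ℂ 2 (volume : Measure ℝ)

/-! ### The quantum Hamiltonian and its unitary group -/

/-- `ψ ∈ H²(ℝ ∖ {0})`, with boundary values `ψ(0⁺) = up`, `ψ(0⁻) = um`, `ψ'(0⁺) = vp`,
`ψ'(0⁻) = vm`, and `w ∈ L²(ℝ)` is the second derivative of `ψ` on `ℝ ∖ {0}`.
Here `u` is the representative of `ψ`, absolutely continuous together with its derivative `v` on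
each of the two half-lines. -/
def HasSecondDeriv (ψ w : L2) (up um vp vm : ℂ) : Prop :=
  ∃ u v : ℝ → ℂ, (ψ : ℝ → ℂ) =ᵐ[volume] u ∧ MemLp v 2 volume ∧
    (∀ x : ℝ, 0 < x → u x = up + ∫ y in (0 : ℝ)..x, v y) ∧
    (∀ x : ℝ, x < 0 → u x = um + ∫ y in (0 : ℝ)..x, v y) ∧
    (∀ x : ℝ, 0 < x → v x = vp + ∫ y in (0 : ℝ)..x, w y) ∧
    (∀ x : ℝ, x < 0 → v x = vm + ∫ y in (0 : ℝ)..x, w y)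

/-- The boundary conditions at the origin for the coupling `β ∈ ℝ ∪ {∞}`: for real `β`,
`ψ'(0⁺) = ψ'(0⁻) = ψ'(0)` and `ψ(0⁺) - ψ(0⁻) = (2mβ/ħ²) ψ'(0)`; for `β = ∞`,
`ψ'(0⁺) = ψ'(0⁻) = 0`. -/
def BoundaryCondition (ħ m : ℝ) (β : OnePoint ℝ) (up um vp vm : ℂ) : Prop :=
  vp = vm ∧ β.elim (vp = 0) (fun b => up - um = ((2 * m * b / ħ ^ 2 : ℝ) : ℂ) * vp)

/-- The operator `H_β`, given by its graph: `Hamiltonian ħ m β ψ χ` says that `ψ` lies in the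
domain of `H_β` and `H_β ψ = χ`. On `ℝ ∖ {0}` the operator acts as `-(ħ²/2m) d²/dx²`; for real `β`,
the term `β ψ'(0) δ₀'` cancels the singular part at `0` of the distributional second derivative. -/
def Hamiltonian (ħ m : ℝ) (β : OnePoint ℝ) (ψ χ : L2) : Prop :=
  ∃ (w : L2) (up um vp vm : ℂ), HasSecondDeriv ψ w up um vp vm ∧
    BoundaryCondition ħ m β up um vp vm ∧ χ = ((-(ħ ^ 2 / (2 * m)) : ℝ) : ℂ) • w

/-- `U` is the strongly continuous one-parameter unitary group `t ↦ exp(-i (t/ħ) H)`, where the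
operator `H` is given by its graph: `H` (including its domain) is exactly the generator of `U`. -/
structure IsUnitaryGroupOf (ħ : ℝ) (H : L2 → L2 → Prop) (U : ℝ → L2 ≃ₗᵢ[ℂ] L2) : Prop where
  map_zero : ∀ ψ, U 0 ψ = ψ
  map_add : ∀ s t ψ, U (s + t) ψ = U s (U t ψ)
  continuous : ∀ ψ, Continuous fun t => U t ψ
  generator : ∀ ψ χ, H ψ χ ↔ HasDerivAt (fun t => U t ψ) (-(I / (ħ : ℂ)) • χ) 0

/-! ### Coherent states -/

/-- The Gaussian wave packet `ψ^ħ_{σ,ξ}(x)`, `ξ = (q, p)`. -/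
def coherent (ħ σ₀ : ℝ) (σ : ℂ) (ξ : ℝ × ℝ) (x : ℝ) : ℂ :=
  1 / ((((2 * Real.pi * ħ) ^ (1 / 4 : ℝ) : ℝ) : ℂ) * σ ^ (1 / 2 : ℂ)) *
    cexp (-(1 / (4 * ħ * σ₀ * σ)) * ((x - ξ.1 : ℝ) : ℂ) ^ 2 + I / ħ * ξ.2 * ((x - ξ.1 : ℝ) : ℂ))

theorem memLp_coherent {ħ σ₀ : ℝ} (hħ : 0 < ħ) (hσ₀ : 0 < σ₀) (ξ : ℝ × ℝ) :
    MemLp (coherent ħ σ₀ σ₀ ξ) 2 volume := by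
  have hc : Continuous (coherent ħ σ₀ σ₀ ξ) := by
    unfold coherent; fun_prop
  rw [memLp_two_iff_integrable_sq_norm hc.aestronglyMeasurable]
  have hb : 0 < 1 / (2 * ħ * σ₀ * σ₀) := by positivity
  have h := ((integrable_exp_neg_mul_sq hb).comp_sub_right ξ.1).const_mul
    (‖1 / ((((2 * Real.pi * ħ) ^ (1 / 4 : ℝ) : ℝ) : ℂ) * (σ₀ : ℂ) ^ (1 / 2 : ℂ))‖ ^ 2)
  refine h.congr (Filter.Eventually.of_forall fun x => ?_)
  have e : (-(1 / (4 * ħ * σ₀ * (σ₀ : ℂ))) * ((x - ξ.1 : ℝ) : ℂ) ^ 2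
      + I / ħ * ξ.2 * ((x - ξ.1 : ℝ) : ℂ))
      = ((-(1 / (4 * ħ * σ₀ * σ₀)) * (x - ξ.1) ^ 2 : ℝ) : ℂ)
        + ((1 / ħ * ξ.2 * (x - ξ.1) : ℝ) : ℂ) * I := by
    push_cast; ring
  simp only [coherent]
  rw [norm_mul, mul_pow, e, Complex.norm_exp, Complex.add_re, Complex.ofReal_re,
    Complex.re_ofReal_mul, Complex.I_re, mul_zero, add_zero, ← Real.exp_nat_mul]
  congr 2
  push_cast
  field_simp
  ring

/-- The coherent state `ψ^ħ_{σ₀,ξ}` as an element of `L²(ℝ)`. -/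
def coherentVec {ħ σ₀ : ℝ} (hħ : 0 < ħ) (hσ₀ : 0 < σ₀) (ξ : ℝ × ℝ) : L2 :=
  (memLp_coherent hħ hσ₀ ξ).toLp (coherent ħ σ₀ σ₀ ξ)

/-- `σ_t = σ₀ + i t / (2 m σ₀)`. -/
def sigmaAt (m σ₀ t : ℝ) : ℂ := σ₀ + I * t / (2 * m * σ₀)

/-! ### The classical evolution on phase space -/

/-- The Heaviside function. -/
def heaviside (x : ℝ) : ℂ := if 0 < x then 1 else 0

/-- The free classical group: `(e^{itL₀} f)(q, p) = f(q + (p/m) t, p)`. -/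
def freeFlow (m t : ℝ) (f : ℝ × ℝ → ℂ) (ξ : ℝ × ℝ) : ℂ := f (ξ.1 + ξ.2 / m * t, ξ.2)

/-- `f_odd(ξ) = f(ξ) - f(-ξ)`. -/
def oddPart (f : ℝ × ℝ → ℂ) (ξ : ℝ × ℝ) : ℂ := f ξ - f (-ξ)

/-- The coefficient `1 / (1 - sgn(t) 2i|p| / (m B(p)))`, where `B(p) = b p²` for real `b` and
`B(p) = ∞`, `1/∞ = 0`, for `b = ∞`. -/
def reflectionCoeff (m : ℝ) (b : OnePoint ℝ) (t p : ℝ) : ℂ :=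
  b.elim 1 (fun b => 1 / (1 - (Real.sign t : ℂ) * (2 * I * |p| / (m * (b * p ^ 2)))))

/-- The classical group `e^{itL_B}`, `B(p) = b p²`, acting on functions on phase space. -/
def classicalGroup (m : ℝ) (b : OnePoint ℝ) (t : ℝ) (f : ℝ × ℝ → ℂ) (ξ : ℝ × ℝ) : ℂ :=
  freeFlow m t f ξ -
    heaviside (-(t * ξ.1 * ξ.2)) * heaviside (|ξ.2 * t| / m - |ξ.1|) *
      reflectionCoeff m b t ξ.2 * freeFlow m t (oddPart f) ξ

/-- The semiclassical approximation `x ↦ e^{(i/ħ)A_t} (e^{itL_B} φ^ħ_{σ_t,x})(ξ)`, where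
`A_t = p² t / (2m)`, `φ^ħ_{σ,x}(ξ) = ψ^ħ_{σ,ξ}(x)` and `B(p) = -(2β/ħ³) p²`. -/
def classicalApprox (ħ m σ₀ : ℝ) (β : OnePoint ℝ) (t : ℝ) (ξ : ℝ × ℝ) (x : ℝ) : ℂ :=
  cexp (I / ħ * ((ξ.2 ^ 2 * t / (2 * m) : ℝ) : ℂ)) *
    classicalGroup m (β.map fun b => -(2 * b / ħ ^ 3)) t
      (fun ζ => coherent ħ σ₀ (sigmaAt m σ₀ t) ζ x) ξ

/-- The collision time `-mq/p`. -/
def collisionTime (m : ℝ) (ξ : ℝ × ℝ) : ℝ := -(m * ξ.1 / ξ.2)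

/-- The maximum of `ħσ₀²/q²`, `ħ/(σ₀²p²)` and `ħ/(m|βp|)^{1/3}`; the last one is `0` for
`β = ∞`. -/
def smallParam (ħ m σ₀ : ℝ) (β : OnePoint ℝ) (ξ : ℝ × ℝ) : ℝ :=
  max (max (ħ * σ₀ ^ 2 / ξ.1 ^ 2) (ħ / (σ₀ ^ 2 * ξ.2 ^ 2)))
    (β.elim 0 (fun b => ħ / (m * |b * ξ.2|) ^ (1 / 3 : ℝ)))

end DeltaPrime

end

open DeltaPrime

/-!
The unitary group is `e^{-i(t/ħ)H}` in the continuous functional calculus of the resolvent of `H_β`;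
the equation `(H_β + iν) ψ = η` is solved by the free resolvent plus a multiple of
`sgn(x) e^{-κ|x|}` that restores the boundary condition.

For the estimate, let `scatter f` be the superposition with amplitude `f k` of the scattering states
`e^{2πikx} + (1 - T(k)) e^{-2πikx}` for `0 < x`, `T(k) e^{2πikx}` for `x < 0`. The map `scatter`
turns multiplication by `(2πħk)²/(2m)` into `H_β`, so it intertwines the free evolution with the
group of `H_β`. A Gaussian packet stays Gaussian under the free evolution and its momentum is
concentrated near `p`, so `T` may be replaced by its value at `p` up to `O(h^{7/2})`: near `p` the
error is `|p ∂ₚT| ≲ h³` times the relative momentum width `√h`, and far from `p` it is controlled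
by the seventh moment of the packet. Once `T` is constant, the scattered packet is the free packet
as long as the latter is to the right of the origin; after that it is the sum of the transmitted
packet and the mirror image of the reflected one. This holds up to Gaussian tails, which are below
`h^N` when the packet is far from the origin. For `q < 0` the whole picture is reflected.
-/

noncomputable section

namespace DeltaPrime

open Filter Topology FourierTransform

/-! ### Stone's theorem for operators given by their graph -/

section Stone

variable {E : Type*} [NormedAddCommGroup E] [InnerProductSpace ℂ E]

/-- `H` is the graph of a self-adjoint operator: a symmetric operator such that `H + iμ` is onto
for all real `μ ≠ 0`. Since `E` is complex, symmetry is encoded as reality of the quadratic form. -/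
structure IsSelfAdjointGraph (H : E → E → Prop) : Prop where
  add : ∀ {ψ χ ψ' χ'}, H ψ χ → H ψ' χ' → H (ψ + ψ') (χ + χ')
  smul : ∀ (c : ℂ) {ψ χ}, H ψ χ → H (c • ψ) (c • χ)
  im_inner : ∀ {ψ χ}, H ψ χ → (inner ℂ ψ χ).im = 0
  eq_zero : ∀ {χ}, H 0 χ → χ = 0
  surj : ∀ μ : ℝ, μ ≠ 0 → ∀ f, ∃ ψ χ, H ψ χ ∧ χ + (I * μ) • ψ = f

theorem norm_add_I_smul_sq {ψ χ : E} (h : (inner ℂ ψ χ).im = 0) (μ : ℝ) :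
    ‖χ + (I * μ) • ψ‖ ^ 2 = ‖χ‖ ^ 2 + μ ^ 2 * ‖ψ‖ ^ 2 := by
  have h' : (inner ℂ χ ψ).im = 0 := by rw [← inner_conj_symm, conj_im, h, neg_zero]
  rw [norm_add_sq (𝕜 := ℂ), inner_smul_right, norm_smul, norm_mul, norm_I, one_mul, norm_real,
    mul_pow, Real.norm_eq_abs, sq_abs]
  simp [h']

theorem abs_mul_norm_le_norm_add_I_smul {ψ χ : E} (h : (inner ℂ ψ χ).im = 0) (μ : ℝ) :
    |μ| * ‖ψ‖ ≤ ‖χ + (I * μ) • ψ‖ := by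
  refine le_of_sq_le_sq ?_ (norm_nonneg _)
  rw [norm_add_I_smul_sq h, mul_pow, sq_abs]
  exact le_add_of_nonneg_left (sq_nonneg _)

theorem norm_cexp_neg_I_mul_sub_one_add_le (x : ℝ) :
    ‖cexp (-(I * x)) - 1 + I * x‖ ≤ 3 * x ^ 2 := by
  have hn : ‖-(I * (x : ℂ))‖ = |x| := by simp
  rcases le_total |x| 1 with h | h
  · have := norm_exp_sub_one_sub_id_le (x := -(I * (x : ℂ))) (by rwa [hn])
    rw [hn, sub_neg_eq_add, sq_abs] at this
    nlinarith [sq_nonneg x]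
  · have hexp : ‖cexp (-(I * x))‖ = 1 := by simp [norm_exp]
    calc ‖cexp (-(I * x)) - 1 + I * x‖ ≤ ‖cexp (-(I * x))‖ + ‖(1 : ℂ)‖ + ‖I * (x : ℂ)‖ :=
          (norm_add_le _ _).trans (add_le_add_left (norm_sub_le _ _) _)
      _ = 2 + |x| := by rw [hexp]; simp; norm_num
      _ ≤ 3 * x ^ 2 := by rw [← sq_abs]; nlinarith

/-- If `z = (x + i)⁻¹` with `x` real, then this is `e^{-itx} (x + i)⁻¹`; unlike `e^{-itx}` itself,
it is a continuous function of `z` up to `z = 0`, that is, `x = ∞`. -/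
def resolventPhase (t : ℝ) (z : ℂ) : ℂ := z * cexp (-(I * (t * z⁻¹.re : ℝ)))

theorem norm_resolventPhase (t : ℝ) (z : ℂ) : ‖resolventPhase t z‖ = ‖z‖ := by
  simp [resolventPhase, norm_exp]

theorem resolventPhase_zero_left (z : ℂ) : resolventPhase 0 z = z := by simp [resolventPhase]

theorem resolventPhase_mul_resolventPhase (s t : ℝ) (z : ℂ) :
    resolventPhase s z * resolventPhase t z = resolventPhase (s + t) z * z := by
  have h : cexp (-(I * (s * z⁻¹.re : ℝ))) * cexp (-(I * (t * z⁻¹.re : ℝ)))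
      = cexp (-(I * ((s + t) * z⁻¹.re : ℝ))) := by
    rw [← Complex.exp_add]
    push_cast
    ring_nf
  rw [resolventPhase, resolventPhase, resolventPhase, ← h]
  ring

@[fun_prop]
theorem continuous_resolventPhase (t : ℝ) : Continuous (resolventPhase t) := by
  refine continuous_iff_continuousAt.2 fun z => ?_
  rcases eq_or_ne z 0 with rfl | hz
  · have h0 : resolventPhase t 0 = 0 := by simp [resolventPhase]
    rw [ContinuousAt, h0, tendsto_zero_iff_norm_tendsto_zero]
    simp only [norm_resolventPhase]
    exact tendsto_norm_zero
  · have hre : ContinuousAt (fun w : ℂ => w⁻¹.re) z :=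
      continuous_re.continuousAt.comp (continuousAt_inv₀ hz)
    have hcast := continuous_ofReal.continuousAt.comp (hre.const_mul t)
    exact continuousAt_id.mul (continuous_exp.continuousAt.comp (hcast.const_mul I).neg)

theorem norm_mul_abs_inv_re_le_one (z : ℂ) : ‖z‖ * |z⁻¹.re| ≤ 1 :=
  calc ‖z‖ * |z⁻¹.re| ≤ ‖z‖ * ‖z⁻¹‖ := by gcongr; exact abs_re_le_norm _
    _ ≤ 1 := by rw [norm_inv]; exact mul_inv_le_one

theorem norm_resolventPhase_sub_le (s t : ℝ) (z : ℂ) :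
    ‖resolventPhase t z - resolventPhase s z‖ ≤ |t - s| := by
  set x := z⁻¹.re with hx
  have h : resolventPhase t z - resolventPhase s z
      = z * cexp (-(I * (s * x : ℝ))) * (cexp (I * ((-((t - s) * x) : ℝ) : ℂ)) - 1) := by
    rw [resolventPhase, resolventPhase, ← hx, mul_sub, mul_assoc, ← Complex.exp_add]
    push_cast
    ring_nf
  calc _ ≤ ‖z‖ * ‖-((t - s) * x)‖ := by
        rw [h, norm_mul, ← resolventPhase, norm_resolventPhase]
        gcongr
        exact Real.norm_exp_I_mul_ofReal_sub_one_le
    _ = |t - s| * (‖z‖ * |x|) := by rw [norm_neg, Real.norm_eq_abs, abs_mul]; ring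
    _ ≤ |t - s| := mul_le_of_le_one_right (abs_nonneg _) (norm_mul_abs_inv_re_le_one z)

theorem norm_resolventPhase_mul_sub_le {z : ℂ} (hz : z - star z = -2 * I * (star z * z)) (t : ℝ) :
    ‖resolventPhase t z * z - z * z + t * (I * (1 - I * z) * z)‖ ≤ 3 * t ^ 2 := by
  set x := z⁻¹.re with hx
  have hxz : z * z * x = (1 - I * z) * z := by
    rcases eq_or_ne z 0 with rfl | h0
    · simp
    have h0' : star z ≠ 0 := star_ne_zero.2 h0
    rw [hx, re_eq_add_conj, map_inv₀, starRingEnd_apply]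
    field_simp
    linear_combination hz
  have h : resolventPhase t z * z - z * z + t * (I * (1 - I * z) * z)
      = z * z * (cexp (-(I * (t * x : ℝ))) - 1 + I * (t * x : ℝ)) := by
    rw [resolventPhase, mul_assoc I, ← hxz]
    push_cast
    ring
  calc _ ≤ ‖z‖ * ‖z‖ * (3 * (t * x) ^ 2) := by
        rw [h, norm_mul, norm_mul]
        gcongr
        exact norm_cexp_neg_I_mul_sub_one_add_le _
    _ = 3 * t ^ 2 * (‖z‖ * |x|) ^ 2 := by rw [mul_pow, mul_pow, sq_abs]; ring
    _ ≤ 3 * t ^ 2 := mul_le_of_le_one_right (by positivity)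
        (pow_le_one₀ (by positivity) (norm_mul_abs_inv_re_le_one z))

theorem isLittleO_of_dense {F : ℝ → E →L[ℂ] E} {C : ℝ} (hC : ∀ t, ‖F t‖ ≤ C * |t|) {s : Set E}
    (hs : Dense s) (h : ∀ g ∈ s, (fun t => F t g) =o[𝓝 0] fun t : ℝ => t) (f : E) :
    (fun t => F t f) =o[𝓝 0] fun t : ℝ => t := by
  have hC0 : 0 ≤ C := by simpa using (norm_nonneg _).trans (hC 1)
  refine Asymptotics.isLittleO_iff.2 fun ε hε => ?_
  obtain ⟨g, hfg, hg⟩ := Metric.dense_iff.1 hs f (ε / (2 * (C + 1))) (by positivity)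
  rw [mem_ball_iff_norm', lt_div_iff₀ (by positivity)] at hfg
  filter_upwards [Asymptotics.isLittleO_iff.1 (h g hg) (half_pos hε)] with t ht
  calc ‖F t f‖ = ‖F t (f - g) + F t g‖ := by rw [map_sub, sub_add_cancel]
    _ ≤ C * |t| * ‖f - g‖ + ε / 2 * ‖t‖ :=
        (norm_add_le _ _).trans (add_le_add ((F t).le_of_opNorm_le (hC t) _) ht)
    _ ≤ ε / 2 * |t| + ε / 2 * |t| := by
        rw [Real.norm_eq_abs]
        have : C * ‖f - g‖ ≤ ε / 2 := by linarith [norm_nonneg (f - g)]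
        linarith [mul_le_mul_of_nonneg_right this (abs_nonneg t)]
    _ = ε * ‖t‖ := by rw [Real.norm_eq_abs]; ring

namespace IsSelfAdjointGraph

variable {H : E → E → Prop} (hH : IsSelfAdjointGraph H)

include hH

theorem sub {ψ χ ψ' χ' : E} (h : H ψ χ) (h' : H ψ' χ') : H (ψ - ψ') (χ - χ') := by
  simpa [sub_eq_add_neg] using hH.add h (hH.smul (-1) h')

theorem inner_symm {ψ χ ψ' χ' : E} (h : H ψ χ) (h' : H ψ' χ') :
    inner ℂ χ ψ' = inner ℂ ψ χ' := by
  -- polarization of the real quadratic form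
  have h1 := hH.im_inner (hH.add h h')
  have h2 := hH.im_inner (hH.add h (hH.smul I h'))
  have h3 := hH.im_inner h
  have h4 := hH.im_inner h'
  have e : inner ℂ ψ' χ = (starRingEnd ℂ) (inner ℂ χ ψ') := (inner_conj_symm _ _).symm
  simp only [inner_add_left, inner_add_right, inner_smul_left, inner_smul_right, e, add_im,
    add_re, mul_im, mul_re, conj_re, conj_im, I_re, I_im] at h1 h2
  apply Complex.ext <;> linarith

theorem eq_of_add_smul_eq {μ : ℝ} (hμ : μ ≠ 0) {ψ χ ψ' χ' : E} (h : H ψ χ) (h' : H ψ' χ')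
    (e : χ + (I * μ) • ψ = χ' + (I * μ) • ψ') : ψ = ψ' := by
  have hle := abs_mul_norm_le_norm_add_I_smul (hH.im_inner (hH.sub h h')) μ
  rw [smul_sub, sub_add_sub_comm, e, sub_self, norm_zero] at hle
  have : ‖ψ - ψ'‖ ≤ 0 := nonpos_of_mul_nonpos_right hle (abs_pos.2 hμ)
  exact sub_eq_zero.1 (norm_le_zero_iff.1 this)

theorem exists_resolvent {μ : ℝ} (hμ : μ ≠ 0) :
    ∃ R : E →L[ℂ] E, ∀ f, H (R f) (f - (I * μ) • R f) := by
  choose r s hrs hf using hH.surj μ hμ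
  let L : E →ₗ[ℂ] E :=
    { toFun := r
      map_add' f g := hH.eq_of_add_smul_eq hμ (hrs _) (hH.add (hrs f) (hrs g)) (by
        rw [hf, smul_add, add_add_add_comm, hf, hf])
      map_smul' c f := hH.eq_of_add_smul_eq hμ (hrs _) (hH.smul c (hrs f)) (by
        rw [hf, RingHom.id_apply, smul_comm, ← smul_add, hf]) }
  refine ⟨L.mkContinuous |μ|⁻¹ fun f => ?_, fun f => ?_⟩
  · have := abs_mul_norm_le_norm_add_I_smul (hH.im_inner (hrs f)) μ
    rw [hf] at this
    rwa [inv_mul_eq_div, le_div_iff₀ (abs_pos.2 hμ), mul_comm]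
  · change H (r f) (f - (I * μ) • r f)
    rw [sub_eq_iff_eq_add.2 (hf f).symm]
    exact hrs f

/-- The resolvent `(H + iμ)⁻¹`. -/
def resolvent {μ : ℝ} (hμ : μ ≠ 0) : E →L[ℂ] E := (hH.exists_resolvent hμ).choose

theorem graph_resolvent {μ : ℝ} (hμ : μ ≠ 0) (f : E) :
    H (hH.resolvent hμ f) (f - (I * μ) • hH.resolvent hμ f) :=
  (hH.exists_resolvent hμ).choose_spec f

theorem resolvent_apply_of_graph {μ : ℝ} (hμ : μ ≠ 0) {ψ χ : E} (h : H ψ χ) :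
    hH.resolvent hμ (χ + (I * μ) • ψ) = ψ :=
  hH.eq_of_add_smul_eq hμ (hH.graph_resolvent hμ _) h (sub_add_cancel _ _)

theorem inner_resolvent {μ : ℝ} (hμ : μ ≠ 0) (f g : E) :
    inner ℂ (hH.resolvent hμ f) g = inner ℂ f (hH.resolvent (neg_ne_zero.2 hμ) g) := by
  have h := hH.inner_symm (hH.graph_resolvent hμ f) (hH.graph_resolvent (neg_ne_zero.2 hμ) g)
  simp only [inner_sub_left, inner_sub_right, inner_smul_left, inner_smul_right, map_mul, conj_I,
    conj_ofReal, ofReal_neg] at h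
  linear_combination -h

theorem resolvent_identity {μ ν : ℝ} (hμ : μ ≠ 0) (hν : ν ≠ 0) :
    hH.resolvent hμ = hH.resolvent hν
      + (I * (ν - μ)) • (hH.resolvent hμ * hH.resolvent hν) := by
  ext f
  have h := hH.resolvent_apply_of_graph hμ (hH.graph_resolvent hν f)
  have e : f = f - (I * ν) • hH.resolvent hν f + (I * μ) • hH.resolvent hν f
      + (I * (ν - μ)) • hH.resolvent hν f := by
    rw [mul_sub, sub_smul]; abel
  conv_lhs => rw [e, map_add, h, _root_.map_smul]
  rfl

variable [CompleteSpace E]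

theorem dense_domain : Dense {ψ | ∃ χ, H ψ χ} := by
  let D : Submodule ℂ E :=
    { carrier := {ψ | ∃ χ, H ψ χ}
      add_mem' := fun ⟨_, ha⟩ ⟨_, hb⟩ => ⟨_, hH.add ha hb⟩
      zero_mem' := ⟨_, by simpa using hH.smul 0 (hH.graph_resolvent one_ne_zero 0)⟩
      smul_mem' := fun c _ ⟨_, ha⟩ => ⟨_, hH.smul c ha⟩ }
  change Dense (D : Set E)
  rw [Submodule.dense_iff_topologicalClosure_eq_top, Submodule.topologicalClosure_eq_top_iff,
    Submodule.eq_bot_iff]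
  intro g hg
  have hμ : (-1 : ℝ) ≠ 0 := neg_ne_zero.2 one_ne_zero
  have hz : hH.resolvent hμ g = 0 := ext_inner_left ℂ fun f => by
    rw [inner_zero_right, ← hH.inner_resolvent one_ne_zero]
    exact (Submodule.mem_orthogonal _ _).1 hg _ ⟨_, hH.graph_resolvent one_ne_zero f⟩
  have h := hH.graph_resolvent hμ g
  rw [hz, smul_zero, sub_zero] at h
  exact hH.eq_zero h

/-! The unitary group `e^{-itH}` is read off from `e^{-itH} R = (x ↦ e^{-itx} (x + i)⁻¹)(H)`, where
`R = (H + i)⁻¹`: the right-hand side is a continuous function of the bounded normal operator `R`,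
and the range of `R` is dense. -/

omit [CompleteSpace E] in
/-- The resolvent `(H + i)⁻¹`. -/
def resolventI : E →L[ℂ] E := hH.resolvent one_ne_zero

omit [CompleteSpace E] in
theorem resolventI_apply_of_graph {ψ χ : E} (h : H ψ χ) : hH.resolventI (χ + I • ψ) = ψ := by
  have h' := hH.resolvent_apply_of_graph one_ne_zero h
  rwa [ofReal_one, mul_one] at h'

theorem star_resolventI : star hH.resolventI = hH.resolvent (neg_ne_zero.2 one_ne_zero) := by
  refine ((ContinuousLinearMap.eq_adjoint_iff _ _).2 fun f g => ?_).symm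
  rw [← inner_conj_symm, resolventI, ← hH.inner_resolvent one_ne_zero, inner_conj_symm]

theorem resolventI_sub_star :
    hH.resolventI - star hH.resolventI = (-2 * I) • (star hH.resolventI * hH.resolventI) := by
  have h := hH.resolvent_identity (neg_ne_zero.2 one_ne_zero) one_ne_zero
  rw [ofReal_neg, ofReal_one] at h
  rw [star_resolventI, resolventI, sub_eq_iff_eq_add', ← sub_eq_iff_eq_add, sub_eq_add_neg,
    ← neg_smul]
  convert h.symm using 3
  ring

instance isStarNormal_resolventI : IsStarNormal hH.resolventI where
  star_comm_self := by
    have h := hH.resolventI_sub_star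
    rw [star_resolventI, resolventI] at h
    have h' := hH.resolvent_identity one_ne_zero (neg_ne_zero.2 one_ne_zero)
    rw [← sub_eq_iff_eq_add', h, ofReal_neg, ofReal_one, show I * (-1 - 1) = -2 * I by ring] at h'
    rw [star_resolventI]
    exact smul_right_injective _ (by simp) h'

theorem spectrum_resolventI {z : ℂ} (hz : z ∈ spectrum ℂ hH.resolventI) :
    z - star z = -2 * I * (star z * z) := by
  refine (cfc_eq_cfc_iff_eqOn (a := hH.resolventI) (f := fun z => z - star z)
    (g := fun z => -2 * I * (star z * z))).1 ?_ hz
  rw [cfc_sub .., cfc_const_mul .., cfc_mul .., cfc_star, cfc_id' .., resolventI_sub_star]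

theorem denseRange_resolventI : DenseRange hH.resolventI :=
  hH.dense_domain.mono fun _ h => h.elim fun _ h => ⟨_, hH.resolventI_apply_of_graph h⟩

/-- The operator `e^{-itH} (H + i)⁻¹`. -/
def groupResolventI (t : ℝ) : E →L[ℂ] E := cfc (resolventPhase t) hH.resolventI

theorem groupResolventI_zero : hH.groupResolventI 0 = hH.resolventI := by
  rw [groupResolventI, funext resolventPhase_zero_left, cfc_id' ..]

theorem groupResolventI_mul_groupResolventI (s t : ℝ) :
    hH.groupResolventI s * hH.groupResolventI t
      = hH.groupResolventI (s + t) * hH.resolventI := by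
  rw [groupResolventI, groupResolventI, ← cfc_mul .., groupResolventI]
  simp only [resolventPhase_mul_resolventPhase]
  rw [cfc_mul .., cfc_id' ..]

theorem norm_groupResolventI (t : ℝ) (g : E) : ‖hH.groupResolventI t g‖ = ‖hH.resolventI g‖ := by
  have h : star (hH.groupResolventI t) * hH.groupResolventI t
      = star hH.resolventI * hH.resolventI := by
    rw [groupResolventI, ← cfc_star, ← cfc_mul ..]
    have e (z : ℂ) : star (resolventPhase t z) * resolventPhase t z = star z * z := by
      simp only [← starRingEnd_apply, conj_mul', norm_resolventPhase]
    simp only [e]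
    rw [cfc_mul .., cfc_star, cfc_id' ..]
  rw [← sq_eq_sq₀ (norm_nonneg _) (norm_nonneg _),
    ContinuousLinearMap.apply_norm_sq_eq_inner_adjoint_left,
    ContinuousLinearMap.apply_norm_sq_eq_inner_adjoint_left]
  exact congrArg (fun A : E →L[ℂ] E => RCLike.re (inner ℂ (A g) g)) h

theorem norm_groupResolventI_sub_le (s t : ℝ) :
    ‖hH.groupResolventI t - hH.groupResolventI s‖ ≤ |t - s| := by
  rw [groupResolventI, groupResolventI, ← cfc_sub ..]
  exact norm_cfc_le (abs_nonneg _) fun z _ => norm_resolventPhase_sub_le s t z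

theorem norm_groupResolventI_mul_sub_le (t : ℝ) :
    ‖(hH.groupResolventI t - hH.resolventI + (t : ℂ) • (I • (1 - I • hH.resolventI)))
      * hH.resolventI‖ ≤ 3 * t ^ 2 := by
  have h : (hH.groupResolventI t - hH.resolventI + (t : ℂ) • (I • (1 - I • hH.resolventI)))
      * hH.resolventI = cfc (fun z => resolventPhase t z * z - z * z + t * (I * (1 - I * z) * z))
        hH.resolventI := by
    rw [cfc_add .., cfc_sub .., cfc_mul .., cfc_mul .., cfc_const_mul .., cfc_mul ..,
      cfc_const_mul .., cfc_sub .., cfc_const_one .., cfc_const_mul .., cfc_id' .., groupResolventI]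
    simp only [add_mul, sub_mul, smul_mul_assoc]
  rw [h]
  exact norm_cfc_le (by positivity) fun z hz =>
    norm_resolventPhase_mul_sub_le (hH.spectrum_resolventI hz) t

/-- The operator `e^{-itH}`, as a bounded operator. -/
def groupCLM (t : ℝ) : E →L[ℂ] E :=
  (hH.groupResolventI t).toLinearMap.extendOfNorm hH.resolventI.toLinearMap

theorem groupCLM_resolventI (t : ℝ) (g : E) :
    hH.groupCLM t (hH.resolventI g) = hH.groupResolventI t g :=
  LinearMap.extendOfNorm_eq hH.denseRange_resolventI
    ⟨1, fun g => by simpa using (hH.norm_groupResolventI t g).le⟩ g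

theorem groupCLM_zero : hH.groupCLM 0 = 1 :=
  DFunLike.coe_injective <| hH.denseRange_resolventI.equalizer (hH.groupCLM 0).continuous
    continuous_id <| funext fun g => by
      rw [Function.comp_apply, groupCLM_resolventI, groupResolventI_zero]
      rfl

theorem groupCLM_mul_groupCLM (s t : ℝ) :
    hH.groupCLM s * hH.groupCLM t = hH.groupCLM (s + t) := by
  have hcomm (g : E) : hH.groupResolventI t (hH.resolventI g)
      = hH.resolventI (hH.groupResolventI t g) := by
    have h := hH.groupResolventI_mul_groupResolventI 0 t
    rw [groupResolventI_zero, zero_add] at h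
    exact (congrArg (fun A : E →L[ℂ] E => A g) h).symm
  have hdense := hH.denseRange_resolventI.comp hH.denseRange_resolventI hH.resolventI.continuous
  refine DFunLike.coe_injective <| hdense.equalizer (hH.groupCLM s * hH.groupCLM t).continuous
    (hH.groupCLM (s + t)).continuous <| funext fun g => ?_
  simp only [Function.comp_apply, mul_apply_eq_comp, groupCLM_resolventI, hcomm]
  exact congrArg (fun A : E →L[ℂ] E => A g) (hH.groupResolventI_mul_groupResolventI s t)

theorem norm_groupCLM_apply_le (t : ℝ) (f : E) : ‖hH.groupCLM t f‖ ≤ ‖f‖ := by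
  rw [← one_mul ‖f‖]
  exact LinearMap.norm_extendOfNorm_apply_le hH.denseRange_resolventI 1
    (fun g => by simpa using (hH.norm_groupResolventI t g).le) f

theorem groupCLM_apply_groupCLM_apply (s t : ℝ) (f : E) :
    hH.groupCLM s (hH.groupCLM t f) = hH.groupCLM (s + t) f :=
  congrArg (fun A : E →L[ℂ] E => A f) (hH.groupCLM_mul_groupCLM s t)

theorem groupCLM_zero_apply (f : E) : hH.groupCLM 0 f = f :=
  congrArg (fun A : E →L[ℂ] E => A f) hH.groupCLM_zero

/-- The unitary group `e^{-itH}`. -/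
def unitaryGroup (t : ℝ) : E ≃ₗᵢ[ℂ] E where
  toLinearEquiv := LinearEquiv.ofLinearMap (hH.groupCLM t).toLinearMap
    (hH.groupCLM (-t)).toLinearMap
    (LinearMap.ext fun f => by simp [groupCLM_apply_groupCLM_apply, groupCLM_zero_apply])
    (LinearMap.ext fun f => by simp [groupCLM_apply_groupCLM_apply, groupCLM_zero_apply])
  norm_map' f := (hH.norm_groupCLM_apply_le t f).antisymm <| by
    have h := hH.norm_groupCLM_apply_le (-t) (hH.groupCLM t f)
    rwa [groupCLM_apply_groupCLM_apply, neg_add_cancel, groupCLM_zero_apply] at h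

theorem unitaryGroup_resolventI (t : ℝ) (g : E) :
    hH.unitaryGroup t (hH.resolventI g) = hH.groupResolventI t g :=
  hH.groupCLM_resolventI t g

theorem unitaryGroup_zero (f : E) : hH.unitaryGroup 0 f = f := hH.groupCLM_zero_apply f

theorem unitaryGroup_add (s t : ℝ) (f : E) :
    hH.unitaryGroup (s + t) f = hH.unitaryGroup s (hH.unitaryGroup t f) :=
  (hH.groupCLM_apply_groupCLM_apply s t f).symm

theorem continuous_unitaryGroup (f : E) : Continuous fun t => hH.unitaryGroup t f := by
  have hcont (g : E) : Continuous fun t => hH.unitaryGroup t (hH.resolventI g) := by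
    refine (LipschitzWith.of_dist_le_mul (K := ‖g‖₊) fun s t => ?_).continuous
    rw [dist_eq_norm, unitaryGroup_resolventI, unitaryGroup_resolventI, ← sub_apply, mul_comm,
      Real.dist_eq]
    exact ContinuousLinearMap.le_of_opNorm_le _ (hH.norm_groupResolventI_sub_le t s) g
  refine Metric.continuous_iff'.2 fun t ε hε => ?_
  obtain ⟨g, hg⟩ := hH.denseRange_resolventI.exists_dist_lt f (half_pos (half_pos hε))
  filter_upwards [Metric.continuous_iff'.1 (hcont g) t (ε / 2) (half_pos hε)] with s hs
  have h1 : dist (hH.unitaryGroup s f) (hH.unitaryGroup s (hH.resolventI g)) < ε / 2 / 2 := by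
    rwa [LinearIsometryEquiv.dist_map]
  have h2 : dist (hH.unitaryGroup t f) (hH.unitaryGroup t (hH.resolventI g)) < ε / 2 / 2 := by
    rwa [LinearIsometryEquiv.dist_map]
  rw [dist_comm] at h2
  linarith [dist_triangle4 (hH.unitaryGroup s f) (hH.unitaryGroup s (hH.resolventI g))
    (hH.unitaryGroup t (hH.resolventI g)) (hH.unitaryGroup t f)]

variable [NormedSpace ℝ E] [IsScalarTower ℝ ℂ E]

theorem hasDerivAt_unitaryGroup {ψ χ : E} (h : H ψ χ) :
    HasDerivAt (fun t => hH.unitaryGroup t ψ) (-I • χ) 0 := by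
  set A : E →L[ℂ] E := I • (1 - I • hH.resolventI) with hA
  let F : ℝ → E →L[ℂ] E := fun t => hH.groupResolventI t - hH.resolventI + (t : ℂ) • A
  have hF (t : ℝ) : ‖F t‖ ≤ (1 + ‖A‖) * |t| :=
    calc ‖F t‖ ≤ ‖hH.groupResolventI t - hH.groupResolventI 0‖ + ‖(t : ℂ) • A‖ := by
          rw [groupResolventI_zero]; exact norm_add_le _ _
      _ ≤ |t - 0| + |t| * ‖A‖ := by
          gcongr
          · exact hH.norm_groupResolventI_sub_le 0 t
          · rw [norm_smul, norm_real, Real.norm_eq_abs]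
      _ = (1 + ‖A‖) * |t| := by rw [sub_zero]; ring
  have hF' : ∀ g ∈ Set.range hH.resolventI, (fun t => F t g) =o[𝓝 0] fun t : ℝ => t := by
    rintro _ ⟨g, rfl⟩
    refine (Asymptotics.IsBigO.of_bound (3 * ‖g‖) (.of_forall fun t => ?_)).trans_isLittleO
      (Asymptotics.isLittleO_pow_id one_lt_two)
    rw [norm_pow, Real.norm_eq_abs, sq_abs, mul_right_comm]
    exact ContinuousLinearMap.le_of_opNorm_le _ (hH.norm_groupResolventI_mul_sub_le t) g
  have ho := isLittleO_of_dense hF hH.denseRange_resolventI hF' (χ + I • ψ)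
  have hAχ : A (χ + I • ψ) = I • χ := by
    simp [hA, sub_apply, hH.resolventI_apply_of_graph h]
  rw [hasDerivAt_iff_isLittleO]
  refine ho.congr (fun t => ?_) fun t => (sub_zero t).symm
  calc F t (χ + I • ψ) = hH.groupResolventI t (χ + I • ψ) - hH.resolventI (χ + I • ψ)
        + (t : ℂ) • A (χ + I • ψ) := rfl
    _ = hH.unitaryGroup t ψ - ψ + (t : ℂ) • I • χ := by
        rw [← unitaryGroup_resolventI, hH.resolventI_apply_of_graph h, hAχ]
    _ = _ := by
        rw [unitaryGroup_zero, sub_zero, neg_smul, smul_neg, sub_neg_eq_add,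
          ← algebraMap_smul ℂ t, coe_algebraMap]

theorem graph_iff_hasDerivAt_unitaryGroup {ψ χ : E} :
    H ψ χ ↔ HasDerivAt (fun t => hH.unitaryGroup t ψ) (-I • χ) 0 := by
  refine ⟨hH.hasDerivAt_unitaryGroup, fun h => ?_⟩
  -- For `φ = ψ - ψ'` with `χ' + iψ' = χ + iψ`, the derivative of `e^{-itH} φ` at `0` is `-φ`, so
  -- that of the constant `‖e^{-itH} φ‖²` is `-2‖φ‖²`.
  obtain ⟨ψ', χ', h', e⟩ := hH.surj 1 one_ne_zero (χ + I • ψ)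
  rw [ofReal_one, mul_one] at e
  have hχ : χ - χ' = -(I • (ψ - ψ')) := by
    rw [eq_sub_of_add_eq e, smul_sub]; abel
  have hd : HasDerivAt (fun t => hH.unitaryGroup t (ψ - ψ')) (-(ψ - ψ')) 0 := by
    simp only [map_sub]
    refine (h.sub (hH.hasDerivAt_unitaryGroup h')).congr_deriv ?_
    rw [← smul_sub, hχ, smul_neg, smul_smul, neg_mul, I_mul_I, neg_neg, one_smul]
  have hi := hd.inner ℂ hd
  simp only [unitaryGroup_zero, LinearIsometryEquiv.inner_map_map, inner_neg_left,
    inner_neg_right] at hi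
  have h0 : inner ℂ (ψ - ψ') (ψ - ψ') = 0 := by
    linear_combination (-1 / 2 : ℂ) * hi.unique (hasDerivAt_const (0 : ℝ) _)
  have hψ : ψ - ψ' = 0 := inner_self_eq_zero.1 h0
  rw [hψ, smul_zero, neg_zero] at hχ
  rwa [sub_eq_zero.1 hψ, sub_eq_zero.1 hχ]

end IsSelfAdjointGraph

end Stone

/-! ### Multiplication operators, parity and the Fourier transform on `L²` -/

section Multiplication

variable {α : Type*} [MeasurableSpace α] {μ : Measure α} {p : ENNReal} [Fact (1 ≤ p)]

/-- Multiplication by an essentially bounded function, as an operator on `Lᵖ`. -/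
def mulCLM {g : α → ℂ} (hg : MemLp g ⊤ μ) : Lp ℂ p μ →L[ℂ] Lp ℂ p μ :=
  (ContinuousLinearMap.mul ℂ ℂ).holderL μ ⊤ p p (hg.toLp g)

theorem coeFn_mulCLM {g : α → ℂ} (hg : MemLp g ⊤ μ) (f : Lp ℂ p μ) :
    mulCLM hg f =ᵐ[μ] fun x => g x * f x := by
  filter_upwards [(ContinuousLinearMap.mul ℂ ℂ).coeFn_holder (r := p) (hg.toLp g) f, hg.coeFn_toLp]
    with x hx hx'
  rw [← hx']
  exact hx

theorem memLp_top_indicator_one {s : Set α} (hs : MeasurableSet s) :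
    MemLp (s.indicator (1 : α → ℂ)) ⊤ μ :=
  (memLp_top_const 1).indicator hs

/-- Restriction of a function to a measurable set, as an operator on `Lᵖ`. -/
def indicatorCLM {s : Set α} (hs : MeasurableSet s) : Lp ℂ p μ →L[ℂ] Lp ℂ p μ :=
  mulCLM (memLp_top_indicator_one hs)

theorem coeFn_indicatorCLM {s : Set α} (hs : MeasurableSet s) (f : Lp ℂ p μ) :
    indicatorCLM hs f =ᵐ[μ] s.indicator f := by
  filter_upwards [coeFn_mulCLM (memLp_top_indicator_one hs) f] with x hx
  rw [indicatorCLM, hx, ← Set.indicator_mul_left]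
  simp only [Pi.one_apply, one_mul]

theorem norm_indicatorCLM_le {s : Set α} (hs : MeasurableSet s) (f : Lp ℂ p μ) :
    ‖indicatorCLM hs f‖ ≤ ‖f‖ := by
  refine Lp.norm_le_norm_of_ae_le ?_
  filter_upwards [coeFn_indicatorCLM hs f] with x hx
  rw [hx]
  exact norm_indicator_le_norm_self _ _

end Multiplication

/-- Restriction to the positive half-line. -/
def cutPos : L2 →L[ℂ] L2 := indicatorCLM (measurableSet_Ioi (a := 0))

/-- Restriction to the negative half-line. -/
def cutNeg : L2 →L[ℂ] L2 := indicatorCLM (measurableSet_Iio (a := 0))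

theorem coeFn_cutPos (f : L2) : cutPos f =ᵐ[volume] (Set.Ioi 0).indicator f :=
  coeFn_indicatorCLM _ f

theorem coeFn_cutNeg (f : L2) : cutNeg f =ᵐ[volume] (Set.Iio 0).indicator f :=
  coeFn_indicatorCLM _ f

theorem norm_cutNeg_le (f : L2) : ‖cutNeg f‖ ≤ ‖f‖ := norm_indicatorCLM_le _ f

theorem cutPos_add_cutNeg (f : L2) : cutPos f + cutNeg f = f := by
  apply Lp.ext
  filter_upwards [Lp.coeFn_add (cutPos f) (cutNeg f), coeFn_cutPos f, coeFn_cutNeg f,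
    Measure.ae_ne volume 0] with x hadd hpos hneg hx
  rw [hadd, Pi.add_apply, hpos, hneg]
  rcases lt_or_gt_of_ne hx with h | h <;> simp [h, h.le]

theorem ae_comp_neg {p : ℝ → Prop} (h : ∀ᵐ x : ℝ, p x) : ∀ᵐ x : ℝ, p (-x) :=
  (Measure.measurePreserving_neg (volume : Measure ℝ)).quasiMeasurePreserving.ae h

/-- The parity operator `ψ(x) ↦ ψ(-x)`. -/
def parity : L2 ≃ₗᵢ[ℂ] L2 where
  toLinearEquiv := LinearEquiv.ofInvolutive
    (Lp.compMeasurePreservingₗ ℂ Neg.neg (Measure.measurePreserving_neg volume)) fun f => by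
      apply Lp.ext
      have h (g : L2) := Lp.coeFn_compMeasurePreserving g (Measure.measurePreserving_neg volume)
      filter_upwards [h (Lp.compMeasurePreserving _ _ f), ae_comp_neg (h f)] with x h1 h2
      refine h1.trans ?_
      rw [Function.comp_apply, h2, Function.comp_apply, neg_neg]
  norm_map' f := Lp.norm_compMeasurePreserving f (Measure.measurePreserving_neg volume)

theorem coeFn_parity (f : L2) : parity f =ᵐ[volume] fun x => f (-x) :=
  Lp.coeFn_compMeasurePreserving f (Measure.measurePreserving_neg volume)

@[simp]
theorem parity_parity (f : L2) : parity (parity f) = f :=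
  parity.toLinearEquiv.left_inv f

theorem cutNeg_parity (f : L2) : cutNeg (parity f) = parity (cutPos f) := by
  apply Lp.ext
  filter_upwards [coeFn_cutNeg (parity f), coeFn_parity f, coeFn_parity (cutPos f),
    ae_comp_neg (coeFn_cutPos f)] with x h1 h2 h3 h4
  rw [h1, h3, h4]
  by_cases h : x < 0 <;> simp [h, h2]

theorem cutPos_parity (f : L2) : cutPos (parity f) = parity (cutNeg f) := by
  rw [← parity_parity (cutPos (parity f)), ← cutNeg_parity, parity_parity]

/-- The inverse Fourier transform on `L²(ℝ)`, with kernel `e^{2πikx}`. -/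
def fourierInvL2 : L2 ≃ₗᵢ[ℂ] L2 := (Lp.fourierTransformₗᵢ ℝ ℂ).symm

section FourierL2

variable {V : Type*} [NormedAddCommGroup V] [InnerProductSpace ℝ V] [FiniteDimensional ℝ V]
  [MeasurableSpace V] [BorelSpace V]

theorem integral_fourier_smul_eq_of_integrable {f g : V → ℂ} (hf : Integrable f)
    (hg : Integrable g) : ∫ x, 𝓕 f x • g x = ∫ x, f x • 𝓕 g x := by
  have h := VectorFourier.integral_fourierIntegral_smul_eq_flip (L := innerₗ V)
    Real.continuous_fourierChar continuous_inner hf hg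
  rwa [flip_innerₗ] at h

theorem integral_fourierInv_smul_eq_of_integrable {f g : V → ℂ} (hf : Integrable f)
    (hg : Integrable g) : ∫ x, 𝓕⁻ f x • g x = ∫ x, f x • 𝓕⁻ g x := by
  have h := integral_fourier_smul_eq_of_integrable hf hg.comp_neg
  rw [← integral_neg_eq_self, Real.fourierInv_eq_fourier_comp_neg g, ← h]
  simp only [Real.fourierInv_eq_fourier_neg, neg_neg]

theorem continuous_fourier_of_integrable {f : V → ℂ} (hf : Integrable f) : Continuous (𝓕 f) :=
  VectorFourier.fourierIntegral_continuous Real.continuous_fourierChar continuous_inner hf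

theorem continuous_fourierInv_of_integrable {f : V → ℂ} (hf : Integrable f) :
    Continuous (𝓕⁻ f) := by
  rw [Real.fourierInv_eq_fourier_comp_neg]
  exact continuous_fourier_of_integrable hf.comp_neg

theorem ae_eq_of_integral_schwartz_smul_eq {f g : V → ℂ} (hf : LocallyIntegrable f)
    (hg : LocallyIntegrable g) (h : ∀ s : SchwartzMap V ℂ, ∫ x, s x • f x = ∫ x, s x • g x) :
    f =ᵐ[volume] g := by
  refine ae_eq_of_integral_contDiff_smul_eq hf hg fun φ hφ hc => ?_
  have hc' : HasCompactSupport fun x => (φ x : ℂ) := hc.comp_left ofReal_zero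
  exact h (hc'.toSchwartzMap (ofRealCLM.contDiff.comp hφ))

theorem coeFn_lp_fourier {f : Lp ℂ 2 (volume : Measure V)} (hf : Integrable f) :
    (𝓕 f : Lp ℂ 2 (volume : Measure V)) =ᵐ[volume] 𝓕 (f : V → ℂ) := by
  refine ae_eq_of_integral_schwartz_smul_eq ((Lp.memLp _).locallyIntegrable one_le_two)
    (continuous_fourier_of_integrable hf).locallyIntegrable fun s => ?_
  have h := congrArg (fun d => d s) (Lp.fourier_toTemperedDistribution_eq f)
  rw [TemperedDistribution.fourier_apply, Lp.toTemperedDistribution_apply,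
    Lp.toTemperedDistribution_apply] at h
  rw [← h, ← integral_fourier_smul_eq_of_integrable s.integrable hf, SchwartzMap.fourier_coe]

theorem coeFn_lp_fourierInv {f : Lp ℂ 2 (volume : Measure V)} (hf : Integrable f) :
    (𝓕⁻ f : Lp ℂ 2 (volume : Measure V)) =ᵐ[volume] 𝓕⁻ (f : V → ℂ) := by
  refine ae_eq_of_integral_schwartz_smul_eq ((Lp.memLp _).locallyIntegrable one_le_two)
    (continuous_fourierInv_of_integrable hf).locallyIntegrable fun s => ?_
  have h := congrArg (fun d => d s) (Lp.fourierInv_toTemperedDistribution_eq f)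
  rw [TemperedDistribution.fourierInv_apply, Lp.toTemperedDistribution_apply,
    Lp.toTemperedDistribution_apply] at h
  rw [← h, ← integral_fourierInv_smul_eq_of_integrable s.integrable hf, SchwartzMap.fourierInv_coe]

end FourierL2

theorem coeFn_fourierInvL2 {f : L2} (hf : Integrable f) :
    fourierInvL2 f =ᵐ[volume] 𝓕⁻ (f : ℝ → ℂ) :=
  coeFn_lp_fourierInv hf

theorem coeFn_fourierInvL2_symm {f : L2} (hf : Integrable f) :
    fourierInvL2.symm f =ᵐ[volume] 𝓕 (f : ℝ → ℂ) :=
  coeFn_lp_fourier hf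

/-! ### Calculus in `H²(ℝ ∖ {0})` -/

theorem intervalIntegrable_of_memLp_two {f : ℝ → ℂ} (hf : MemLp f 2 volume) (a b : ℝ) :
    IntervalIntegrable f volume a b :=
  ((hf.locallyIntegrable one_le_two).integrableOn_isCompact isCompact_uIcc).intervalIntegrable

theorem intervalIntegral_congr_ae_eq {f g : ℝ → ℂ} (h : f =ᵐ[volume] g) (a b : ℝ) :
    ∫ y in a..b, f y = ∫ y in a..b, g y :=
  intervalIntegral.integral_congr_ae (h.mono fun _ hx _ => hx)

theorem intervalIntegral_comp_neg_zero_left (f : ℝ → ℂ) (x : ℝ) :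
    ∫ y in (0 : ℝ)..x, f (-y) = -∫ y in (0 : ℝ)..(-x), f y := by
  rw [intervalIntegral.integral_comp_neg, neg_zero, intervalIntegral.integral_symm]

theorem intervalIntegral_indicator_Ioi_of_pos (f : ℝ → ℂ) {x : ℝ} (hx : 0 < x) :
    ∫ y in (0 : ℝ)..x, (Set.Ioi (0 : ℝ)).indicator f y = ∫ y in (0 : ℝ)..x, f y := by
  refine intervalIntegral.integral_congr_ae (.of_forall fun y hy => ?_)
  rw [Set.uIoc_of_le hx.le] at hy
  exact Set.indicator_of_mem (Set.mem_Ioi.2 hy.1) _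

theorem intervalIntegral_indicator_Ioi_of_neg (f : ℝ → ℂ) {x : ℝ} (hx : x < 0) :
    ∫ y in (0 : ℝ)..x, (Set.Ioi (0 : ℝ)).indicator f y = 0 := by
  refine intervalIntegral.integral_zero_ae (.of_forall fun y hy => ?_)
  rw [Set.uIoc_of_ge hx.le] at hy
  exact Set.indicator_of_notMem (not_lt.2 hy.2) _

namespace HasSecondDeriv

variable {ψ w ψ' w' : L2} {up um vp vm up' um' vp' vm' : ℂ}

theorem add (h : HasSecondDeriv ψ w up um vp vm) (h' : HasSecondDeriv ψ' w' up' um' vp' vm') :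
    HasSecondDeriv (ψ + ψ') (w + w') (up + up') (um + um') (vp + vp') (vm + vm') := by
  obtain ⟨u, v, hu, hv, hup, hum, hvp, hvm⟩ := h
  obtain ⟨u', v', hu', hv', hup', hum', hvp', hvm'⟩ := h'
  have ev (x : ℝ) : ∫ y in (0 : ℝ)..x, (v + v') y
      = (∫ y in (0 : ℝ)..x, v y) + ∫ y in (0 : ℝ)..x, v' y :=
    intervalIntegral.integral_add (intervalIntegrable_of_memLp_two hv _ _)
      (intervalIntegrable_of_memLp_two hv' _ _)
  have ew (x : ℝ) : ∫ y in (0 : ℝ)..x, (w + w' : L2) y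
      = (∫ y in (0 : ℝ)..x, w y) + ∫ y in (0 : ℝ)..x, w' y := by
    rw [intervalIntegral_congr_ae_eq (Lp.coeFn_add w w')]
    exact intervalIntegral.integral_add (intervalIntegrable_of_memLp_two (Lp.memLp w) _ _)
      (intervalIntegrable_of_memLp_two (Lp.memLp w') _ _)
  refine ⟨u + u', v + v', (Lp.coeFn_add ψ ψ').trans (hu.add hu'), hv.add hv', ?_, ?_, ?_, ?_⟩ <;>
    intro x hx
  · rw [ev, Pi.add_apply, hup x hx, hup' x hx, add_add_add_comm]
  · rw [ev, Pi.add_apply, hum x hx, hum' x hx, add_add_add_comm]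
  · rw [ew, Pi.add_apply, hvp x hx, hvp' x hx, add_add_add_comm]
  · rw [ew, Pi.add_apply, hvm x hx, hvm' x hx, add_add_add_comm]

theorem smul (c : ℂ) (h : HasSecondDeriv ψ w up um vp vm) :
    HasSecondDeriv (c • ψ) (c • w) (c * up) (c * um) (c * vp) (c * vm) := by
  obtain ⟨u, v, hu, hv, hup, hum, hvp, hvm⟩ := h
  have ev (x : ℝ) : ∫ y in (0 : ℝ)..x, (c • v) y = c * ∫ y in (0 : ℝ)..x, v y :=
    intervalIntegral.integral_const_mul _ _
  have ew (x : ℝ) : ∫ y in (0 : ℝ)..x, (c • w : L2) y = c * ∫ y in (0 : ℝ)..x, w y := by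
    rw [intervalIntegral_congr_ae_eq (Lp.coeFn_smul c w)]
    exact intervalIntegral.integral_const_mul _ _
  refine ⟨c • u, c • v, (Lp.coeFn_smul c ψ).trans (hu.const_smul c), hv.const_smul c,
    ?_, ?_, ?_, ?_⟩ <;> intro x hx
  · rw [ev, Pi.smul_apply, smul_eq_mul, hup x hx, mul_add]
  · rw [ev, Pi.smul_apply, smul_eq_mul, hum x hx, mul_add]
  · rw [ew, Pi.smul_apply, smul_eq_mul, hvp x hx, mul_add]
  · rw [ew, Pi.smul_apply, smul_eq_mul, hvm x hx, mul_add]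

theorem comp_parity (h : HasSecondDeriv ψ w up um vp vm) :
    HasSecondDeriv (parity ψ) (parity w) um up (-vm) (-vp) := by
  obtain ⟨u, v, hu, hv, hup, hum, hvp, hvm⟩ := h
  have ev (x : ℝ) : ∫ y in (0 : ℝ)..x, -v (-y) = ∫ y in (0 : ℝ)..(-x), v y := by
    rw [intervalIntegral.integral_neg, intervalIntegral_comp_neg_zero_left, neg_neg]
  have ew (x : ℝ) : ∫ y in (0 : ℝ)..x, (parity w) y = -∫ y in (0 : ℝ)..(-x), w y := by
    rw [intervalIntegral_congr_ae_eq (coeFn_parity w), intervalIntegral_comp_neg_zero_left]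
  refine ⟨fun x => u (-x), fun x => -v (-x), (coeFn_parity ψ).trans (ae_comp_neg hu),
    (hv.comp_measurePreserving (Measure.measurePreserving_neg volume)).neg, ?_, ?_, ?_, ?_⟩ <;>
    intro x hx <;> beta_reduce
  · rw [hum _ (neg_neg_of_pos hx), ev]
  · rw [hup _ (neg_pos_of_neg hx), ev]
  · rw [hvm _ (neg_neg_of_pos hx), ew, neg_add]
  · rw [hvp _ (neg_pos_of_neg hx), ew, neg_add]

theorem cutPos (h : HasSecondDeriv ψ w up um vp vm) :
    HasSecondDeriv (cutPos ψ) (cutPos w) up 0 vp 0 := by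
  obtain ⟨u, v, hu, hv, hup, _, hvp, _⟩ := h
  have mem {x : ℝ} (hx : 0 < x) : x ∈ Set.Ioi (0 : ℝ) := hx
  have notMem {x : ℝ} (hx : x < 0) : x ∉ Set.Ioi (0 : ℝ) := not_lt.2 hx.le
  have ew (x : ℝ) : ∫ y in (0 : ℝ)..x, DeltaPrime.cutPos w y
      = ∫ y in (0 : ℝ)..x, (Set.Ioi (0 : ℝ)).indicator w y :=
    intervalIntegral_congr_ae_eq (coeFn_cutPos w) _ _
  refine ⟨(Set.Ioi 0).indicator u, (Set.Ioi 0).indicator v,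
    (coeFn_cutPos ψ).trans (hu.mono fun x hx => by by_cases h : 0 < x <;> simp [h, hx]),
    hv.indicator measurableSet_Ioi, ?_, ?_, ?_, ?_⟩ <;> intro x hx
  · rw [intervalIntegral_indicator_Ioi_of_pos v hx, Set.indicator_of_mem (mem hx), hup x hx]
  · rw [intervalIntegral_indicator_Ioi_of_neg v hx, Set.indicator_of_notMem (notMem hx), zero_add]
  · rw [ew, intervalIntegral_indicator_Ioi_of_pos w hx, Set.indicator_of_mem (mem hx), hvp x hx]
  · rw [ew, intervalIntegral_indicator_Ioi_of_neg w hx, Set.indicator_of_notMem (notMem hx),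
      zero_add]

theorem cutNeg (h : HasSecondDeriv ψ w up um vp vm) :
    HasSecondDeriv (cutNeg ψ) (cutNeg w) 0 um 0 vm := by
  simpa [cutPos_parity] using h.comp_parity.cutPos.comp_parity

end HasSecondDeriv

theorem absolutelyContinuousOnInterval_primitive {f : ℝ → ℂ}
    (hf : ∀ a b, IntervalIntegrable f volume a b) (A : ℂ) (a b : ℝ) :
    AbsolutelyContinuousOnInterval (fun x => A + ∫ y in a..x, f y) a b := by
  have const (z : ℂ) : AbsolutelyContinuousOnInterval (fun _ : ℝ => z) a b :=
    ((LipschitzWith.const z).lipschitzOnWith (s := Set.uIcc a b)).absolutelyContinuousOnInterval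
  have re : IntervalIntegrable (fun x => (f x).re) volume a b := ⟨(hf a b).1.re, (hf a b).2.re⟩
  have im : IntervalIntegrable (fun x => (f x).im) volume a b := ⟨(hf a b).1.im, (hf a b).2.im⟩
  have hre := re.absolutelyContinuousOnInterval_intervalIntegral (c := a) Set.left_mem_uIcc
  have him := im.absolutelyContinuousOnInterval_intervalIntegral (c := a) Set.left_mem_uIcc
  suffices e : (fun x => A + ∫ y in a..x, f y) = (fun _ => A) +
      ((fun x => ∫ y in a..x, (f y).re) • (fun _ => 1) +
        (fun x => ∫ y in a..x, (f y).im) • fun _ => I) by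
    rw [e]
    exact (const A).add ((hre.smul (const 1)).add (him.smul (const I)))
  funext x
  have re_eq := reCLM.intervalIntegral_comp_comm (hf a x)
  have im_eq := imCLM.intervalIntegral_comp_comm (hf a x)
  simp only [reCLM_apply, imCLM_apply] at re_eq im_eq
  simp only [Pi.add_apply, Pi.smul_apply', real_smul, mul_one, re_eq, im_eq, re_add_im]

theorem integral_mul_add_mul_of_primitive {f g : ℝ → ℂ}
    (hf : ∀ a b, IntervalIntegrable f volume a b) (hg : ∀ a b, IntervalIntegrable g volume a b)
    (A B : ℂ) (a b : ℝ) :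
    ∫ x in a..b, (f x * (B + ∫ y in a..x, g y) + (A + ∫ y in a..x, f y) * g x)
      = (A + ∫ y in a..b, f y) * (B + ∫ y in a..b, g y) - A * B := by
  set F : ℝ → ℂ := fun x => A + ∫ y in a..x, f y
  set G : ℝ → ℂ := fun x => B + ∫ y in a..x, g y
  have contF : Continuous F := continuous_const.add (intervalIntegral.continuous_primitive hf a)
  have contG : Continuous G := continuous_const.add (intervalIntegral.continuous_primitive hg a)
  have int (c d : ℝ) : IntervalIntegrable (fun x => f x * G x + F x * g x) volume c d :=
    ((hf c d).mul_continuousOn contG.continuousOn).add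
      ((hg c d).continuousOn_mul contF.continuousOn)
  set H : ℝ → ℂ := fun x => F x * G x - (0 + ∫ y in a..x, (f y * G y + F y * g y))
  have acH : AbsolutelyContinuousOnInterval H a b :=
    ((absolutelyContinuousOnInterval_primitive hf A a b).smul
      (absolutelyContinuousOnInterval_primitive hg B a b)).sub
        (absolutelyContinuousOnInterval_primitive int 0 a b)
  have hderiv : ∀ᵐ x, x ∈ Set.uIcc a b → HasDerivAt H 0 x := by
    filter_upwards [(hf a b).ae_hasDerivAt_integral, (hg a b).ae_hasDerivAt_integral,
      (int a b).ae_hasDerivAt_integral] with x hfx hgx hx hmem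
    have hF : HasDerivAt F (f x) x := (hfx hmem a Set.left_mem_uIcc).const_add A
    have hG : HasDerivAt G (g x) x := (hgx hmem a Set.left_mem_uIcc).const_add B
    exact ((hF.fun_mul hG).fun_sub
      ((hx hmem a Set.left_mem_uIcc).const_add 0)).congr_deriv (sub_self _)
  obtain ⟨C, hC⟩ := acH.const_of_ae_hasDerivAt_zero hderiv
  have ha := hC a Set.left_mem_uIcc
  have hb := hC b Set.right_mem_uIcc
  simp only [H, F, G, intervalIntegral.integral_same, zero_add, add_zero, sub_zero] at ha hb
  rw [ha, ← hb, sub_sub_cancel]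

theorem integrable_conj_mul {f g : ℝ → ℂ} (hf : MemLp f 2 volume) (hg : MemLp g 2 volume) :
    Integrable fun x => starRingEnd ℂ (f x) * g x :=
  hf.star.integrable_mul hg

theorem integral_Ioi_green_identity {u v w : ℝ → ℂ} {a b : ℂ} (hu : MemLp u 2 volume)
    (hv : MemLp v 2 volume) (hw : MemLp w 2 volume)
    (hu' : ∀ x : ℝ, 0 < x → u x = a + ∫ y in (0 : ℝ)..x, v y)
    (hv' : ∀ x : ℝ, 0 < x → v x = b + ∫ y in (0 : ℝ)..x, w y) :
    ∫ x in Set.Ioi (0 : ℝ), (starRingEnd ℂ (v x) * v x + starRingEnd ℂ (u x) * w x)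
      = -(starRingEnd ℂ a * b) := by
  have conj_u (x : ℝ) (hx : 0 < x) : starRingEnd ℂ (u x)
      = starRingEnd ℂ a + ∫ y in (0 : ℝ)..x, starRingEnd ℂ (v y) := by
    rw [hu' x hx, map_add, intervalIntegral.intervalIntegral_conj]
  have key (X : ℝ) (hX : 0 < X) :
      (∫ x in (0 : ℝ)..X, (starRingEnd ℂ (v x) * v x + starRingEnd ℂ (u x) * w x))
        + starRingEnd ℂ a * b = starRingEnd ℂ (u X) * v X := by
    rw [← eq_sub_iff_add_eq, conj_u X hX, hv' X hX, ← integral_mul_add_mul_of_primitive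
      (f := fun y => starRingEnd ℂ (v y)) (intervalIntegrable_of_memLp_two hv.star)
      (intervalIntegrable_of_memLp_two hw)]
    refine intervalIntegral.integral_congr_ae (.of_forall fun x hx => ?_)
    rw [Set.uIoc_of_le hX.le] at hx
    rw [conj_u x hx.1, hv' x hx.1]
  have lim : Tendsto (fun X => starRingEnd ℂ (u X) * v X) atTop (𝓝 ((∫ x in Set.Ioi (0 : ℝ),
      (starRingEnd ℂ (v x) * v x + starRingEnd ℂ (u x) * w x)) + starRingEnd ℂ a * b)) :=
    ((intervalIntegral_tendsto_integral_Ioi 0 ((integrable_conj_mul hv hv).add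
      (integrable_conj_mul hu hw)).integrableOn tendsto_id).add_const _).congr'
        ((eventually_gt_atTop 0).mono key)
  refine eq_neg_of_add_eq_zero_left (IntegrableAtFilter.eq_zero_of_tendsto (μ := volume)
    ((integrable_conj_mul hu hv).integrableAtFilter _) (fun s hs => ?_) lim)
  obtain ⟨c, hc⟩ := mem_atTop_sets.1 hs
  exact measure_mono_top (fun x hx => hc x hx) (Real.volume_Ici (a := c))

namespace HasSecondDeriv

variable {ψ w : L2} {up um vp vm : ℂ}

theorem im_integral_Ioi_conj_mul (h : HasSecondDeriv ψ w up um vp vm) :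
    (∫ x in Set.Ioi (0 : ℝ), starRingEnd ℂ (ψ x) * w x).im = -(starRingEnd ℂ up * vp).im := by
  obtain ⟨u, v, hu, hv, hup, _, hvp, _⟩ := h
  have memLp_u : MemLp u 2 volume := (memLp_congr_ae hu).1 (Lp.memLp ψ)
  have green := integral_Ioi_green_identity memLp_u hv (Lp.memLp w) hup hvp
  rw [integral_add (integrable_conj_mul hv hv).integrableOn
    (integrable_conj_mul memLp_u (Lp.memLp w)).integrableOn] at green
  have norm_v (x : ℝ) : starRingEnd ℂ (v x) * v x = ((‖v x‖ ^ 2 : ℝ) : ℂ) := by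
    rw [conj_mul', ofReal_pow]
  simp only [norm_v, integral_complex_ofReal] at green
  rw [← neg_im, ← green, add_im, ofReal_im, zero_add]
  congr 1
  refine integral_congr_ae (ae_restrict_of_ae (hu.mono fun x hx => ?_))
  beta_reduce
  rw [hx]

theorem im_inner (h : HasSecondDeriv ψ w up um vp vm) :
    (inner ℂ ψ w).im = (starRingEnd ℂ um * vm).im - (starRingEnd ℂ up * vp).im := by
  have int : Integrable fun x => starRingEnd ℂ (ψ x) * w x :=
    integrable_conj_mul (Lp.memLp ψ) (Lp.memLp w)
  have inner_eq : inner ℂ ψ w = (∫ x in Set.Iic (0 : ℝ), starRingEnd ℂ (ψ x) * w x)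
      + ∫ x in Set.Ioi (0 : ℝ), starRingEnd ℂ (ψ x) * w x := by
    rw [intervalIntegral.integral_Iic_add_Ioi int.integrableOn int.integrableOn, L2.inner_def]
    simp only [RCLike.inner_apply, mul_comm]
  have reflect : ∫ x in Set.Ioi (0 : ℝ), starRingEnd ℂ (parity ψ x) * parity w x
      = ∫ x in Set.Iic (0 : ℝ), starRingEnd ℂ (ψ x) * w x := by
    rw [← neg_zero, ← integral_comp_neg_Ioi, neg_zero]
    refine integral_congr_ae (ae_restrict_of_ae ?_)
    filter_upwards [coeFn_parity ψ, coeFn_parity w] with x hψ hw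
    rw [hψ, hw]
  rw [inner_eq, add_im, ← reflect, h.im_integral_Ioi_conj_mul,
    h.comp_parity.im_integral_Ioi_conj_mul, mul_neg, neg_im, neg_neg, sub_eq_add_neg]

end HasSecondDeriv

theorem ae_eq_zero_of_primitive {f : ℝ → ℂ} (hf : LocallyIntegrable f) {c : ℂ}
    (h : ∀ᵐ x : ℝ, 0 < x → c + ∫ y in (0 : ℝ)..x, f y = 0) : ∀ᵐ x : ℝ, 0 < x → f x = 0 := by
  set F : ℝ → ℂ := fun x => c + ∫ y in (0 : ℝ)..x, f y
  have hF : Continuous F := continuous_const.add (intervalIntegral.continuous_primitive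
    (fun a b => (hf.integrableOn_isCompact isCompact_uIcc).intervalIntegrable) 0)
  have F_eq_zero : Set.EqOn F (fun _ => 0) (Set.Ioi 0) :=
    Measure.eqOn_open_of_ae_eq (μ := volume) ((ae_restrict_iff' measurableSet_Ioi).2 h) isOpen_Ioi
      hF.continuousOn continuousOn_const
  filter_upwards [LocallyIntegrable.ae_hasDerivAt_integral hf] with x hx hpos
  refine ((hx 0).const_add c).unique ((hasDerivAt_const x (0 : ℂ)).congr_of_eventuallyEq ?_)
  filter_upwards [Ioi_mem_nhds hpos] with y hy using F_eq_zero hy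

namespace HasSecondDeriv

variable {w : L2} {up um vp vm : ℂ}

theorem cutPos_eq_zero (h : HasSecondDeriv 0 w up um vp vm) : DeltaPrime.cutPos w = 0 := by
  obtain ⟨u, v, hu, hv, hup, _, hvp, _⟩ := h
  have v_eq_zero : ∀ᵐ x : ℝ, 0 < x → v x = 0 := by
    refine ae_eq_zero_of_primitive (hv.locallyIntegrable one_le_two) (c := up) ?_
    filter_upwards [hu, Lp.coeFn_zero ℂ 2 (volume : Measure ℝ)] with x hux h0 hpos
    rw [← hup x hpos, ← hux, h0, Pi.zero_apply]
  have w_eq_zero : ∀ᵐ x : ℝ, 0 < x → w x = 0 := by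
    refine ae_eq_zero_of_primitive ((Lp.memLp w).locallyIntegrable one_le_two) (c := vp) ?_
    filter_upwards [v_eq_zero] with x hvx hpos
    rw [← hvp x hpos, hvx hpos]
  apply Lp.ext
  filter_upwards [coeFn_cutPos w, w_eq_zero, Lp.coeFn_zero ℂ 2 (volume : Measure ℝ)]
    with x hcut hw h0
  rw [hcut, h0]
  exact Set.indicator_apply_eq_zero.2 hw

theorem eq_zero (h : HasSecondDeriv 0 w up um vp vm) : w = 0 := by
  have reflected : DeltaPrime.cutPos (parity w) = 0 :=
    HasSecondDeriv.cutPos_eq_zero (by simpa only [map_zero] using h.comp_parity)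
  rw [cutPos_parity, LinearIsometryEquiv.map_eq_zero_iff] at reflected
  rw [← cutPos_add_cutNeg w, h.cutPos_eq_zero, reflected, add_zero]

end HasSecondDeriv

/-! ### `H²` functions with prescribed Fourier transform -/

theorem fourierInv_eq_integral_cexp (f : ℝ → ℂ) (x : ℝ) :
    𝓕⁻ f x = ∫ k : ℝ, cexp (2 * Real.pi * k * I * x) * f k := by
  rw [Real.fourierInv_eq']
  refine integral_congr_ae (.of_forall fun k => ?_)
  simp only [RCLike.inner_apply, conj_trivial, smul_eq_mul]
  congr 2
  push_cast
  ring

theorem fourierInv_zero (f : ℝ → ℂ) : 𝓕⁻ f 0 = ∫ k, f k := by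
  simp only [fourierInv_eq_integral_cexp, ofReal_zero, mul_zero, Complex.exp_zero, one_mul]

theorem integrable_cexp_mul {f : ℝ → ℂ} (hf : Integrable f) (x : ℝ) :
    Integrable fun k : ℝ => cexp (2 * Real.pi * k * I * x) * f k := by
  refine hf.bdd_mul (c := 1) (by fun_prop) (.of_forall fun k => ?_)
  rw [show (2 * Real.pi * k * I * x : ℂ) = ((2 * Real.pi * k * x : ℝ) : ℂ) * I by push_cast; ring,
    norm_exp_ofReal_mul_I]

theorem integral_cexp_mul_mul_self (c : ℂ) (a b : ℝ) :
    (∫ y : ℝ in a..b, cexp (c * y)) * c = cexp (c * b) - cexp (c * a) := by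
  rcases eq_or_ne c 0 with rfl | hc
  · simp
  · rw [integral_exp_mul_complex hc, div_mul_cancel₀ _ hc]

theorem coeFn_fourierInvL2_symm_indicator {a b : ℝ} (hab : a ≤ b) :
    fourierInvL2.symm (indicatorConstLp 2 (measurableSet_Ioc (a := a) (b := b))
      measure_Ioc_lt_top.ne 1) =ᵐ[volume]
      fun k : ℝ => ∫ y : ℝ in a..b, cexp (-(2 * Real.pi * k * I) * y) := by
  set f : L2 := indicatorConstLp 2 (measurableSet_Ioc (a := a) (b := b)) measure_Ioc_lt_top.ne 1
  have coeFn_f : f =ᵐ[volume] (Set.Ioc a b).indicator fun _ => 1 := indicatorConstLp_coeFn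
  have integrable_f : Integrable f :=
    ((integrable_indicator_iff measurableSet_Ioc).2
      (integrableOn_const measure_Ioc_lt_top.ne)).congr coeFn_f.symm
  refine (coeFn_fourierInvL2_symm integrable_f).trans (.of_forall fun k => ?_)
  beta_reduce
  rw [Real.fourier_real_eq_integral_exp_smul, intervalIntegral.integral_of_le hab,
    ← integral_indicator measurableSet_Ioc]
  refine integral_congr_ae (coeFn_f.mono fun y hy => ?_)
  beta_reduce
  rw [hy]
  by_cases h : y ∈ Set.Ioc a b
  · rw [Set.indicator_of_mem h, Set.indicator_of_mem h, smul_eq_mul, mul_one]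
    congr 1
    push_cast
    ring
  · rw [Set.indicator_of_notMem h, Set.indicator_of_notMem h, smul_zero]

theorem integral_fourierInvL2_of_le {f g : L2} (hf : Integrable f)
    (hg : g =ᵐ[volume] fun k : ℝ => 2 * Real.pi * k * I * f k) {a b : ℝ} (hab : a ≤ b) :
    ∫ y in a..b, fourierInvL2 g y = 𝓕⁻ (f : ℝ → ℂ) b - 𝓕⁻ (f : ℝ → ℂ) a := by
  rw [intervalIntegral.integral_of_le hab,
    ← L2.inner_indicatorConstLp_one (𝕜 := ℂ) measurableSet_Ioc measure_Ioc_lt_top.ne,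
    ← LinearIsometryEquiv.inner_map_map fourierInvL2.symm,
    LinearIsometryEquiv.symm_apply_apply, L2.inner_def, fourierInv_eq_integral_cexp,
    fourierInv_eq_integral_cexp, ← integral_sub (integrable_cexp_mul hf b)
      (integrable_cexp_mul hf a)]
  refine integral_congr_ae ?_
  filter_upwards [coeFn_fourierInvL2_symm_indicator hab, hg] with k hk hgk
  have conj_kernel (y : ℝ) : starRingEnd ℂ (cexp (-(2 * Real.pi * k * I) * y))
      = cexp (2 * Real.pi * k * I * y) := by
    rw [← exp_conj]
    simp only [map_mul, map_neg, map_ofNat, conj_I, conj_ofReal, mul_neg, neg_neg]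
  rw [hk, hgk, RCLike.inner_apply, ← intervalIntegral.intervalIntegral_conj]
  simp only [conj_kernel]
  rw [← sub_mul, ← integral_cexp_mul_mul_self]
  ring

theorem fourierInv_eq_add_integral {f g : L2} (hf : Integrable f)
    (hg : g =ᵐ[volume] fun k : ℝ => 2 * Real.pi * k * I * f k) (x : ℝ) :
    𝓕⁻ (f : ℝ → ℂ) x = (∫ k, f k) + ∫ y in (0 : ℝ)..x, fourierInvL2 g y := by
  rw [← fourierInv_zero]
  rcases le_total 0 x with h | h
  · rw [integral_fourierInvL2_of_le hf hg h, add_sub_cancel]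
  · rw [intervalIntegral.integral_symm, integral_fourierInvL2_of_le hf hg h, neg_sub,
      add_sub_cancel]

theorem one_add_sq_ne_zero (k : ℝ) : (1 + (2 * Real.pi * k) ^ 2 : ℂ) ≠ 0 := by
  exact_mod_cast (by positivity : 0 < 1 + (2 * Real.pi * k) ^ 2).ne'

theorem norm_one_add_sq (k : ℝ) :
    ‖(1 + (2 * Real.pi * k) ^ 2 : ℂ)‖ = 1 + (2 * Real.pi * k) ^ 2 := by
  rw [← ofReal_one, ← ofReal_ofNat, ← ofReal_mul, ← ofReal_mul, ← ofReal_pow, ← ofReal_add,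
    norm_real, Real.norm_of_nonneg (by positivity)]

theorem inv_one_add_two_pi_mul_sq_le (k : ℝ) :
    (1 + (2 * Real.pi * k) ^ 2)⁻¹ ≤ (1 + k ^ 2)⁻¹ := by
  have : k ^ 2 ≤ (2 * Real.pi * k) ^ 2 := by
    rw [mul_pow]
    exact le_mul_of_one_le_left (sq_nonneg k) (by nlinarith [Real.pi_gt_three])
  gcongr

theorem memLp_two_of_sq_norm_le {f : ℝ → ℂ} (hf : Continuous f)
    (h : ∀ k, ‖f k‖ ^ 2 ≤ (1 + (2 * Real.pi * k) ^ 2)⁻¹) : MemLp f 2 volume := by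
  rw [memLp_two_iff_integrable_sq_norm hf.aestronglyMeasurable]
  refine integrable_inv_one_add_sq.mono' (hf.norm.pow 2).aestronglyMeasurable
    (.of_forall fun k => ?_)
  rw [Real.norm_of_nonneg (by positivity)]
  exact (h k).trans (inv_one_add_two_pi_mul_sq_le k)

theorem memLp_two_inv_one_add_sq :
    MemLp (fun k : ℝ => (1 / (1 + (2 * Real.pi * k) ^ 2) : ℂ)) 2 volume := by
  refine memLp_two_of_sq_norm_le
    (continuous_const.div (by fun_prop) one_add_sq_ne_zero) fun k => ?_
  rw [norm_div, norm_one_add_sq, norm_one, one_div]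
  exact pow_le_of_le_one (by positivity)
    (inv_le_one_of_one_le₀ (le_add_of_nonneg_right (sq_nonneg _))) two_ne_zero

theorem sq_norm_two_pi_mul_div_one_add_sq_le (k : ℝ) :
    ‖(2 * Real.pi * k * I / (1 + (2 * Real.pi * k) ^ 2) : ℂ)‖ ^ 2
      ≤ (1 + (2 * Real.pi * k) ^ 2)⁻¹ := by
  have norm_num : ‖(2 * Real.pi * k * I : ℂ)‖ ^ 2 = (2 * Real.pi * k) ^ 2 := by
    rw [norm_mul, norm_I, mul_one, ← ofReal_ofNat, ← ofReal_mul, ← ofReal_mul, norm_real,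
      Real.norm_eq_abs, sq_abs]
  rw [norm_div, norm_one_add_sq, div_pow, norm_num]
  calc (2 * Real.pi * k) ^ 2 / (1 + (2 * Real.pi * k) ^ 2) ^ 2
      ≤ (1 + (2 * Real.pi * k) ^ 2) / (1 + (2 * Real.pi * k) ^ 2) ^ 2 := by
        gcongr
        exact le_add_of_nonneg_left zero_le_one
    _ = (1 + (2 * Real.pi * k) ^ 2)⁻¹ := by field_simp

theorem continuous_two_pi_mul_div_one_add_sq :
    Continuous fun k : ℝ => (2 * Real.pi * k * I / (1 + (2 * Real.pi * k) ^ 2) : ℂ) :=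
  Continuous.div (by fun_prop) (by fun_prop) one_add_sq_ne_zero

theorem memLp_two_two_pi_mul_div_one_add_sq :
    MemLp (fun k : ℝ => (2 * Real.pi * k * I / (1 + (2 * Real.pi * k) ^ 2) : ℂ)) 2 volume :=
  memLp_two_of_sq_norm_le continuous_two_pi_mul_div_one_add_sq
    sq_norm_two_pi_mul_div_one_add_sq_le

theorem memLp_top_two_pi_mul_div_one_add_sq :
    MemLp (fun k : ℝ => (2 * Real.pi * k * I / (1 + (2 * Real.pi * k) ^ 2) : ℂ)) ⊤ volume := by
  refine memLp_top_of_bound continuous_two_pi_mul_div_one_add_sq.aestronglyMeasurable 1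
    (.of_forall fun k => (sq_le_one_iff₀ (norm_nonneg _)).1 ?_)
  exact (sq_norm_two_pi_mul_div_one_add_sq_le k).trans
    (inv_le_one_of_one_le₀ (le_add_of_nonneg_right (sq_nonneg _)))

section SquareIntegrableSecondMoment

variable {f g : L2} (hg : g =ᵐ[volume] fun k : ℝ => -(2 * Real.pi * k : ℂ) ^ 2 * f k)

include hg

theorem div_one_add_sq_mul_sub_ae_eq (c : ℝ → ℂ) :
    (fun k : ℝ => c k / (1 + (2 * Real.pi * k) ^ 2) * (f - g : L2) k)
      =ᵐ[volume] fun k => c k * f k := by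
  filter_upwards [hg, Lp.coeFn_sub f g] with k hgk hsub
  rw [hsub, Pi.sub_apply, hgk, div_mul_eq_mul_div, div_eq_iff (one_add_sq_ne_zero k)]
  ring

theorem integrable_of_ae_eq_neg_sq_mul : Integrable f := by
  refine (memLp_two_inv_one_add_sq.integrable_mul (Lp.memLp (f - g))).congr ?_
  filter_upwards [div_one_add_sq_mul_sub_ae_eq hg 1] with k hk
  simpa only [Pi.mul_apply, Pi.one_apply, one_mul] using hk

theorem integrable_mul_of_ae_eq_neg_sq_mul : Integrable fun k : ℝ => 2 * Real.pi * k * I * f k :=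
  (memLp_two_two_pi_mul_div_one_add_sq.integrable_mul (Lp.memLp (f - g))).congr
    (div_one_add_sq_mul_sub_ae_eq hg _)

theorem memLp_mul_of_ae_eq_neg_sq_mul :
    MemLp (fun k : ℝ => 2 * Real.pi * k * I * f k) 2 volume :=
  (memLp_congr_ae (div_one_add_sq_mul_sub_ae_eq hg _)).1
    ((Lp.memLp (f - g)).mul' memLp_top_two_pi_mul_div_one_add_sq)

theorem hasSecondDeriv_fourierInvL2 :
    HasSecondDeriv (fourierInvL2 f) (fourierInvL2 g) (∫ k, f k) (∫ k, f k)
      (∫ k : ℝ, 2 * Real.pi * k * I * f k) (∫ k : ℝ, 2 * Real.pi * k * I * f k) := by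
  have integrable_f := integrable_of_ae_eq_neg_sq_mul hg
  set f' : L2 := (memLp_mul_of_ae_eq_neg_sq_mul hg).toLp _
  have coeFn_f' : f' =ᵐ[volume] fun k : ℝ => 2 * Real.pi * k * I * f k := MemLp.coeFn_toLp _
  have integrable_f' : Integrable f' :=
    (integrable_mul_of_ae_eq_neg_sq_mul hg).congr coeFn_f'.symm
  have coeFn_g : g =ᵐ[volume] fun k : ℝ => 2 * Real.pi * k * I * f' k := by
    filter_upwards [hg, coeFn_f'] with k hgk hfk
    rw [hgk, hfk]
    linear_combination (-(2 * Real.pi * k : ℂ) ^ 2 * f k) * I_sq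
  have coeFn_v := coeFn_fourierInvL2 integrable_f'
  have hu (x : ℝ) : 𝓕⁻ (f : ℝ → ℂ) x
      = (∫ k, f k) + ∫ y in (0 : ℝ)..x, 𝓕⁻ (f' : ℝ → ℂ) y := by
    rw [fourierInv_eq_add_integral integrable_f coeFn_f', intervalIntegral_congr_ae_eq coeFn_v]
  have hv (x : ℝ) : 𝓕⁻ (f' : ℝ → ℂ) x
      = (∫ k : ℝ, 2 * Real.pi * k * I * f k) + ∫ y in (0 : ℝ)..x, fourierInvL2 g y := by
    rw [fourierInv_eq_add_integral integrable_f' coeFn_g, integral_congr_ae coeFn_f']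
  exact ⟨𝓕⁻ (f : ℝ → ℂ), 𝓕⁻ (f' : ℝ → ℂ), coeFn_fourierInvL2 integrable_f,
    (memLp_congr_ae coeFn_v).1 (Lp.memLp _), fun x _ => hu x, fun x _ => hu x, fun x _ => hv x,
    fun x _ => hv x⟩

end SquareIntegrableSecondMoment

/-! ### Self-adjointness of the Hamiltonian -/

section Exponential

variable {κ : ℂ} (hκ : 0 < κ.re)

include hκ

theorem memLp_indicator_exp :
    MemLp ((Set.Ioi (0 : ℝ)).indicator fun x : ℝ => cexp (-κ * x)) 2 volume := by
  have hc : Continuous fun x : ℝ => cexp (-κ * x) := by fun_prop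
  rw [memLp_indicator_iff_restrict measurableSet_Ioi,
    memLp_two_iff_integrable_sq_norm hc.aestronglyMeasurable]
  refine (exp_neg_integrableOn_Ioi 0 (mul_pos two_pos hκ)).congr (.of_forall fun x => ?_)
  beta_reduce
  rw [norm_exp, ← Real.exp_nat_mul, re_mul_ofReal, neg_re]
  push_cast
  ring_nf

/-- The function `e^{-κx}` on the positive half-line, extended by zero. -/
def expPos : L2 := (memLp_indicator_exp hκ).toLp _

omit hκ in
theorem intervalIntegral_mul_indicator_exp_of_pos (a : ℂ) {x : ℝ} (hx : 0 < x) :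
    ∫ y in (0 : ℝ)..x, κ * (a * (Set.Ioi (0 : ℝ)).indicator (fun y : ℝ => cexp (-κ * y)) y)
      = a * (1 - cexp (-κ * x)) := by
  have prim := integral_cexp_mul_mul_self (-κ) 0 x
  rw [ofReal_zero, mul_zero, Complex.exp_zero] at prim
  rw [intervalIntegral.integral_const_mul, intervalIntegral.integral_const_mul,
    intervalIntegral_indicator_Ioi_of_pos _ hx]
  linear_combination -a * prim

omit hκ in
theorem intervalIntegral_mul_indicator_exp_of_neg (a : ℂ) {x : ℝ} (hx : x < 0) :
    ∫ y in (0 : ℝ)..x, κ * (a * (Set.Ioi (0 : ℝ)).indicator (fun y : ℝ => cexp (-κ * y)) y)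
      = 0 := by
  rw [intervalIntegral.integral_const_mul, intervalIntegral.integral_const_mul,
    intervalIntegral_indicator_Ioi_of_neg _ hx, mul_zero, mul_zero]

theorem hasSecondDeriv_expPos : HasSecondDeriv (expPos hκ) (κ ^ 2 • expPos hκ) 1 0 (-κ) 0 := by
  have coeFn : expPos hκ =ᵐ[volume] (Set.Ioi (0 : ℝ)).indicator fun x : ℝ => cexp (-κ * x) :=
    (memLp_indicator_exp hκ).coeFn_toLp
  have coeFn_smul : (κ ^ 2 • expPos hκ : L2) =ᵐ[volume]
      fun y => κ * (κ * (Set.Ioi (0 : ℝ)).indicator (fun x : ℝ => cexp (-κ * x)) y) := by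
    filter_upwards [Lp.coeFn_smul (κ ^ 2) (expPos hκ), coeFn] with x h1 h2
    rw [h1, Pi.smul_apply, h2, smul_eq_mul, sq, mul_assoc]
  have of_pos {x : ℝ} (hx : 0 < x) :
      (Set.Ioi (0 : ℝ)).indicator (fun x : ℝ => cexp (-κ * x)) x = cexp (-κ * x) :=
    Set.indicator_of_mem hx _
  have of_neg {x : ℝ} (hx : x < 0) :
      (Set.Ioi (0 : ℝ)).indicator (fun x : ℝ => cexp (-κ * x)) x = 0 :=
    Set.indicator_of_notMem hx.not_gt _
  refine ⟨_, fun y => κ * (-1 * (Set.Ioi (0 : ℝ)).indicator (fun x : ℝ => cexp (-κ * x)) y), coeFn,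
    ((memLp_indicator_exp hκ).const_mul (-1)).const_mul κ, fun x hx => ?_, fun x hx => ?_,
    fun x hx => ?_, fun x hx => ?_⟩
  · rw [intervalIntegral_mul_indicator_exp_of_pos _ hx, of_pos hx]
    ring
  · rw [intervalIntegral_mul_indicator_exp_of_neg _ hx, of_neg hx, add_zero]
  · beta_reduce
    rw [intervalIntegral_congr_ae_eq coeFn_smul, intervalIntegral_mul_indicator_exp_of_pos _ hx,
      of_pos hx]
    ring
  · beta_reduce
    rw [intervalIntegral_congr_ae_eq coeFn_smul, intervalIntegral_mul_indicator_exp_of_neg _ hx,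
      of_neg hx]
    ring

/-- The function `sgn(x) e^{-κ|x|}`. -/
def expOdd : L2 := expPos hκ - parity (expPos hκ)

theorem hasSecondDeriv_expOdd :
    HasSecondDeriv (expOdd hκ) (κ ^ 2 • expOdd hκ) 1 (-1) (-κ) (-κ) := by
  have h := hasSecondDeriv_expPos hκ
  convert h.add (h.comp_parity.smul (-1)) using 1
  · rw [expOdd, neg_one_smul, sub_eq_add_neg]
  · rw [expOdd, _root_.map_smul, neg_one_smul, smul_sub, sub_eq_add_neg]
  all_goals ring

end Exponential

theorem exists_sq_eq_I_mul {r : ℝ} (hr : r ≠ 0) :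
    ∃ κ : ℂ, κ ^ 2 = I * r ∧ 0 < κ.re ∧ κ.im ≠ 0 := by
  have hs : 0 < √(|r| / 2) := by positivity
  have hsq : √(|r| / 2) ^ 2 = |r| / 2 := Real.sq_sqrt (by positivity)
  set s := √(|r| / 2)
  rcases lt_or_gt_of_ne hr with h | h
  · rw [abs_of_neg h] at hsq
    refine ⟨⟨s, -s⟩, Complex.ext ?_ ?_, hs, neg_ne_zero.2 hs.ne'⟩ <;>
      (simp [sq]; try linarith)
  · rw [abs_of_pos h] at hsq
    refine ⟨⟨s, s⟩, Complex.ext ?_ ?_, hs, hs.ne'⟩ <;>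
      (simp [sq]; try linarith)

section FreeResolvent

variable {c ν : ℝ}

theorem abs_le_norm_symbol_add (k : ℝ) : |ν| ≤ ‖(c * (2 * Real.pi * k) ^ 2 + I * ν : ℂ)‖ := by
  convert abs_im_le_norm _ using 2
  have : (c * (2 * Real.pi * k) ^ 2 : ℂ) = (c * (2 * Real.pi * k) ^ 2 : ℝ) := by push_cast; rfl
  rw [this, add_im, ofReal_im, mul_comm I, im_ofReal_mul, I_im, mul_one, zero_add]

theorem mul_sq_le_norm_symbol_add (k : ℝ) :
    c * (2 * Real.pi * k) ^ 2 ≤ ‖(c * (2 * Real.pi * k) ^ 2 + I * ν : ℂ)‖ := by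
  convert re_le_norm _ using 1
  have : (c * (2 * Real.pi * k) ^ 2 : ℂ) = (c * (2 * Real.pi * k) ^ 2 : ℝ) := by push_cast; rfl
  rw [this, add_re, ofReal_re, mul_comm I, re_ofReal_mul, I_re, mul_zero, add_zero]

theorem symbol_add_ne_zero (hν : ν ≠ 0) (k : ℝ) :
    (c * (2 * Real.pi * k) ^ 2 + I * ν : ℂ) ≠ 0 :=
  norm_pos_iff.1 ((abs_pos.2 hν).trans_le (abs_le_norm_symbol_add k))

theorem memLp_top_one_div_symbol_add (hν : ν ≠ 0) :
    MemLp (fun k : ℝ => 1 / (c * (2 * Real.pi * k) ^ 2 + I * ν : ℂ)) ⊤ volume := by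
  refine memLp_top_of_bound (Measurable.aestronglyMeasurable (by fun_prop)) (1 / |ν|)
    (.of_forall fun k => ?_)
  rw [norm_div, norm_one]
  exact one_div_le_one_div_of_le (abs_pos.2 hν) (abs_le_norm_symbol_add k)

theorem memLp_top_neg_sq_div_symbol_add (hc : 0 < c) (hν : ν ≠ 0) :
    MemLp (fun k : ℝ => -(2 * Real.pi * k : ℂ) ^ 2 / (c * (2 * Real.pi * k) ^ 2 + I * ν : ℂ)) ⊤
      volume := by
  refine memLp_top_of_bound (Measurable.aestronglyMeasurable (by fun_prop)) (1 / c)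
    (.of_forall fun k => ?_)
  have norm_num : ‖-(2 * Real.pi * k : ℂ) ^ 2‖ = (2 * Real.pi * k) ^ 2 := by
    rw [norm_neg, norm_pow, ← ofReal_ofNat, ← ofReal_mul, ← ofReal_mul, norm_real,
      Real.norm_eq_abs, sq_abs]
  rw [norm_div, norm_num, div_le_div_iff₀ (norm_pos_iff.2 (symbol_add_ne_zero hν k)) hc, one_mul,
    mul_comm]
  exact mul_sq_le_norm_symbol_add k

theorem exists_hasSecondDeriv_smul_add_smul_eq (hc : 0 < c) (hν : ν ≠ 0) (F : L2) :
    ∃ (ψ w : L2) (u v : ℂ), HasSecondDeriv ψ w u u v v ∧ (-(c : ℂ)) • w + (I * ν) • ψ = F := by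
  set F' := fourierInvL2.symm F
  set f := mulCLM (memLp_top_one_div_symbol_add (c := c) hν) F'
  set g := mulCLM (memLp_top_neg_sq_div_symbol_add hc hν) F'
  have coeFn_f := coeFn_mulCLM (memLp_top_one_div_symbol_add (c := c) hν) F'
  have coeFn_g := coeFn_mulCLM (memLp_top_neg_sq_div_symbol_add hc hν) F'
  have g_eq : g =ᵐ[volume] fun k : ℝ => -(2 * Real.pi * k : ℂ) ^ 2 * f k := by
    filter_upwards [coeFn_f, coeFn_g] with k hf hg
    rw [hf, hg]
    ring
  refine ⟨_, _, _, _, hasSecondDeriv_fourierInvL2 g_eq, ?_⟩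
  rw [← LinearIsometryEquiv.map_smul, ← LinearIsometryEquiv.map_smul, ← map_add,
    ← LinearIsometryEquiv.eq_symm_apply]
  apply Lp.ext
  filter_upwards [coeFn_f, coeFn_g, Lp.coeFn_add ((-(c : ℂ)) • g) ((I * ν : ℂ) • f),
    Lp.coeFn_smul (-(c : ℂ)) g, Lp.coeFn_smul (I * ν : ℂ) f] with k hf hg hadd hsmul_g hsmul_f
  rw [hadd, Pi.add_apply, hsmul_g, hsmul_f, Pi.smul_apply, Pi.smul_apply, hf, hg, smul_eq_mul,
    smul_eq_mul]
  linear_combination F' k * mul_inv_cancel₀ (symbol_add_ne_zero (c := c) hν k)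

end FreeResolvent

namespace BoundaryCondition

variable {ħ m : ℝ} {β : OnePoint ℝ} {up um vp vm up' um' vp' vm' : ℂ}

theorem add (h : BoundaryCondition ħ m β up um vp vm)
    (h' : BoundaryCondition ħ m β up' um' vp' vm') :
    BoundaryCondition ħ m β (up + up') (um + um') (vp + vp') (vm + vm') := by
  obtain ⟨rfl, hβ⟩ := h
  obtain ⟨rfl, hβ'⟩ := h'
  refine ⟨rfl, ?_⟩
  induction β using OnePoint.rec with
  | infty =>
    change vp = 0 at hβ
    change vp' = 0 at hβ'
    change vp + vp' = 0
    rw [hβ, hβ', add_zero]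
  | coe b =>
    change up - um = _ * vp at hβ
    change up' - um' = _ * vp' at hβ'
    change up + up' - (um + um') = _ * (vp + vp')
    linear_combination hβ + hβ'

theorem smul (h : BoundaryCondition ħ m β up um vp vm) (c : ℂ) :
    BoundaryCondition ħ m β (c * up) (c * um) (c * vp) (c * vm) := by
  obtain ⟨rfl, hβ⟩ := h
  refine ⟨rfl, ?_⟩
  induction β using OnePoint.rec with
  | infty =>
    change vp = 0 at hβ
    change c * vp = 0
    rw [hβ, mul_zero]
  | coe b =>
    change up - um = _ * vp at hβ
    change c * up - c * um = _ * (c * vp)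
    linear_combination c * hβ

theorem im_conj_mul_eq (h : BoundaryCondition ħ m β up um vp vm) :
    (starRingEnd ℂ um * vm).im = (starRingEnd ℂ up * vp).im := by
  obtain ⟨rfl, hβ⟩ := h
  induction β using OnePoint.rec with
  | infty =>
    change vp = 0 at hβ
    rw [hβ, mul_zero, mul_zero]
  | coe b =>
    change up - um = ((2 * m * b / ħ ^ 2 : ℝ) : ℂ) * vp at hβ
    have jump_im : (starRingEnd ℂ (((2 * m * b / ħ ^ 2 : ℝ) : ℂ) * vp) * vp).im = 0 := by
      rw [map_mul, conj_ofReal, mul_assoc, im_ofReal_mul, ← normSq_eq_conj_mul_self, ofReal_im,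
        mul_zero]
    rw [← sub_eq_zero, ← neg_eq_zero, neg_sub, ← sub_im, ← sub_mul, ← map_sub, hβ, jump_im]

end BoundaryCondition

theorem exists_boundaryCondition {ħ m : ℝ} (β : OnePoint ℝ) {κ : ℂ} (hre : 0 < κ.re)
    (him : κ.im ≠ 0) (u v : ℂ) :
    ∃ α : ℂ, BoundaryCondition ħ m β (u + α * 1) (u + α * (-1)) (v + α * (-κ)) (v + α * (-κ)) := by
  induction β using OnePoint.rec with
  | infty =>
    have hκ : κ ≠ 0 := fun h => hre.ne' (h ▸ zero_re)
    refine ⟨v / κ, rfl, ?_⟩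
    change v + v / κ * -κ = 0
    field_simp
    ring
  | coe b =>
    set d : ℝ := 2 * m * b / ħ ^ 2
    have hκ : (2 + d * κ : ℂ) ≠ 0 := fun h => by
      have im_eq : d * κ.im = 0 := by simpa using congrArg im h
      have hd0 : d = 0 := (mul_eq_zero.1 im_eq).resolve_right him
      simp [hd0] at h
    refine ⟨d * v / (2 + d * κ), rfl, ?_⟩
    change _ - _ = (d : ℂ) * _
    field_simp
    ring

namespace Hamiltonian

variable {ħ m : ℝ} {β : OnePoint ℝ} {ψ χ ψ' χ' : L2}

theorem add (h : Hamiltonian ħ m β ψ χ) (h' : Hamiltonian ħ m β ψ' χ') :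
    Hamiltonian ħ m β (ψ + ψ') (χ + χ') := by
  obtain ⟨w, up, um, vp, vm, hw, hb, rfl⟩ := h
  obtain ⟨w', up', um', vp', vm', hw', hb', rfl⟩ := h'
  exact ⟨_, _, _, _, _, hw.add hw', hb.add hb', (smul_add _ _ _).symm⟩

theorem smul (h : Hamiltonian ħ m β ψ χ) (c : ℂ) : Hamiltonian ħ m β (c • ψ) (c • χ) := by
  obtain ⟨w, up, um, vp, vm, hw, hb, rfl⟩ := h
  exact ⟨_, _, _, _, _, hw.smul c, hb.smul c, smul_comm _ _ _⟩

theorem im_inner (h : Hamiltonian ħ m β ψ χ) : (inner ℂ ψ χ).im = 0 := by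
  obtain ⟨w, up, um, vp, vm, hw, hb, rfl⟩ := h
  rw [inner_smul_right, im_ofReal_mul, hw.im_inner, hb.im_conj_mul_eq, sub_self, mul_zero]

theorem eq_zero (h : Hamiltonian ħ m β 0 χ) : χ = 0 := by
  obtain ⟨w, up, um, vp, vm, hw, -, rfl⟩ := h
  rw [hw.eq_zero, smul_zero]

/-- Solve the equation in `H²(ℝ)` first, then restore the boundary condition with a multiple of the
homogeneous solution `sgn(x) e^{-κ|x|}`. -/
theorem exists_add_smul_eq (hħ : 0 < ħ) (hm : 0 < m) (β : OnePoint ℝ) {ν : ℝ} (hν : ν ≠ 0)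
    (F : L2) : ∃ ψ χ, Hamiltonian ħ m β ψ χ ∧ χ + (I * ν) • ψ = F := by
  set c := ħ ^ 2 / (2 * m) with c_def
  have hc : 0 < c := by positivity
  obtain ⟨ψ, w, u, v, hw, hF⟩ := exists_hasSecondDeriv_smul_add_smul_eq hc hν F
  obtain ⟨κ, hκ, hre, him⟩ := exists_sq_eq_I_mul (div_ne_zero hν hc.ne')
  obtain ⟨α, hα⟩ := exists_boundaryCondition (ħ := ħ) (m := m) β hre him u v
  refine ⟨ψ + α • expOdd hre, _,
    ⟨_, _, _, _, _, hw.add ((hasSecondDeriv_expOdd hre).smul α), hα, rfl⟩, ?_⟩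
  have hc' : (c : ℂ) ≠ 0 := ofReal_ne_zero.2 hc.ne'
  rw [← hF, hκ, ← c_def]
  push_cast
  match_scalars <;> field_simp
  ring

end Hamiltonian

theorem isSelfAdjointGraph_hamiltonian {ħ m : ℝ} (hħ : 0 < ħ) (hm : 0 < m) (β : OnePoint ℝ) :
    IsSelfAdjointGraph fun ψ χ => Hamiltonian ħ m β ψ ((ħ : ℂ) • χ) where
  add h h' := by simpa only [smul_add] using h.add h'
  smul c _ _ h := by
    rw [smul_comm]
    exact h.smul c
  im_inner h := by
    have := h.im_inner
    rw [inner_smul_right, im_ofReal_mul] at this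
    exact (mul_eq_zero.1 this).resolve_left hħ.ne'
  eq_zero h := (smul_eq_zero.1 h.eq_zero).resolve_left (ofReal_ne_zero.2 hħ.ne')
  surj μ hμ f := by
    have hħ' : (ħ : ℂ) ≠ 0 := ofReal_ne_zero.2 hħ.ne'
    obtain ⟨ψ, χ, h, hf⟩ :=
      Hamiltonian.exists_add_smul_eq hħ hm β (mul_ne_zero hħ.ne' hμ) ((ħ : ℂ) • f)
    refine ⟨ψ, (ħ : ℂ)⁻¹ • χ, by rwa [smul_inv_smul₀ hħ'], ?_⟩
    rw [← inv_smul_smul₀ hħ' f, ← hf]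
    push_cast
    match_scalars <;> field_simp

namespace IsUnitaryGroupOf

variable {ħ : ℝ} {H : L2 → L2 → Prop} {U : ℝ → L2 ≃ₗᵢ[ℂ] L2} (hU : IsUnitaryGroupOf ħ H U)

include hU

theorem hasDerivAt {ψ χ : L2} (h : H ψ χ) (t : ℝ) :
    HasDerivAt (fun t => U t ψ) (-(I / (ħ : ℂ)) • U t χ) t := by
  have deriv_shift : HasDerivAt (fun s => U (s - t) ψ) (-(I / (ħ : ℂ)) • χ) t :=
    HasDerivAt.comp_sub_const t t <| by
      rw [sub_self]
      exact (hU.generator ψ χ).1 h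
  have := ((U t).toContinuousLinearEquiv.toContinuousLinearMap.restrictScalars
    ℝ).hasFDerivAt.comp_hasDerivAt t deriv_shift
  rw [← LinearIsometryEquiv.map_smul]
  refine this.congr_of_eventuallyEq (.of_forall fun s => ?_)
  change U s ψ = U t (U (s - t) ψ)
  rw [← hU.map_add, add_sub_cancel]

theorem graph_apply {ψ χ : L2} (h : H ψ χ) (t : ℝ) : H (U t ψ) (U t χ) := by
  have : HasDerivAt (fun s => U (s + t) ψ) (-(I / (ħ : ℂ)) • U t χ) 0 :=
    HasDerivAt.comp_add_const 0 t <| by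
      rw [zero_add]
      exact hU.hasDerivAt h t
  rw [hU.generator]
  simpa only [hU.map_add] using this

theorem graph_sub {ψ χ ψ' χ' : L2} (h : H ψ χ) (h' : H ψ' χ') : H (ψ - ψ') (χ - χ') := by
  rw [hU.generator] at *
  simpa only [map_sub, smul_sub] using h.fun_sub h'

theorem inner_neg_I_smul_eq_zero {ψ χ : L2} (h : H ψ χ) :
    inner ℝ ψ (-(I / (ħ : ℂ)) • χ) = 0 := by
  have deriv_norm_sq := ((hU.generator ψ χ).1 h).norm_sq
  simp only [LinearIsometryEquiv.norm_map, hU.map_zero] at deriv_norm_sq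
  simpa using deriv_norm_sq.unique (hasDerivAt_const 0 _)

theorem apply_eq_of_hasDerivAt {φ χ : ℝ → L2} (hH : ∀ t, H (φ t) (χ t))
    (hφ : ∀ t, HasDerivAt φ (-(I / (ħ : ℂ)) • χ t) t) (t : ℝ) : U t (φ 0) = φ t := by
  have deriv_norm_sq (s : ℝ) : HasDerivAt (fun s => ‖U s (φ 0) - φ s‖ ^ 2) 0 s := by
    have := ((hU.hasDerivAt (hH 0) s).sub (hφ s)).norm_sq
    rwa [← smul_sub, Pi.sub_apply,
      hU.inner_neg_I_smul_eq_zero (hU.graph_sub (hU.graph_apply (hH 0) s) (hH s)),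
      mul_zero] at this
  have norm_sq_eq := is_const_of_deriv_eq_zero (fun s => (deriv_norm_sq s).differentiableAt)
    (fun s => (deriv_norm_sq s).deriv) t 0
  rw [hU.map_zero, sub_self, norm_zero, zero_pow two_ne_zero] at norm_sq_eq
  exact sub_eq_zero.1 (norm_eq_zero.1 (pow_eq_zero_iff two_ne_zero |>.1 norm_sq_eq))

theorem eq_of_dense {V : ℝ → L2 ≃ₗᵢ[ℂ] L2} (hV : IsUnitaryGroupOf ħ H V)
    (hd : Dense {ψ | ∃ χ, H ψ χ}) : U = V := by
  have coe_eq (t : ℝ) : (U t : L2 → L2) = V t := by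
    refine Continuous.ext_on hd (U t).continuous (V t).continuous ?_
    rintro ψ ⟨χ, hψ⟩
    have := hU.apply_eq_of_hasDerivAt (φ := fun t => V t ψ) (fun t => hV.graph_apply hψ t)
      (fun t => hV.hasDerivAt hψ t) t
    rwa [hV.map_zero] at this
  exact funext fun t => LinearIsometryEquiv.ext (congrFun (coe_eq t))

end IsUnitaryGroupOf

theorem exists_isUnitaryGroupOf {ħ m : ℝ} (hħ : 0 < ħ) (hm : 0 < m) (β : OnePoint ℝ) :
    ∃ U : ℝ → L2 ≃ₗᵢ[ℂ] L2, IsUnitaryGroupOf ħ (Hamiltonian ħ m β) U := by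
  have hsa := isSelfAdjointGraph_hamiltonian hħ hm β
  refine ⟨hsa.unitaryGroup, hsa.unitaryGroup_zero, hsa.unitaryGroup_add,
    hsa.continuous_unitaryGroup, fun ψ χ => ?_⟩
  have := hsa.graph_iff_hasDerivAt_unitaryGroup (ψ := ψ) (χ := (ħ : ℂ)⁻¹ • χ)
  rwa [smul_inv_smul₀ (ofReal_ne_zero.2 hħ.ne'), smul_smul, neg_mul, ← div_eq_mul_inv] at this

theorem dense_domain_hamiltonian {ħ m : ℝ} (hħ : 0 < ħ) (hm : 0 < m) (β : OnePoint ℝ) :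
    Dense {ψ | ∃ χ, Hamiltonian ħ m β ψ χ} :=
  (isSelfAdjointGraph_hamiltonian hħ hm β).dense_domain.mono <| by
    rintro ψ ⟨χ, hχ⟩
    exact ⟨(ħ : ℂ) • χ, hχ⟩

theorem existsUnique_isUnitaryGroupOf {ħ m : ℝ} (hħ : 0 < ħ) (hm : 0 < m) (β : OnePoint ℝ) :
    ∃! U : ℝ → L2 ≃ₗᵢ[ℂ] L2, IsUnitaryGroupOf ħ (Hamiltonian ħ m β) U := by
  obtain ⟨U, hU⟩ := exists_isUnitaryGroupOf hħ hm β
  exact ⟨U, hU, fun V hV => hV.eq_of_dense hU (dense_domain_hamiltonian hħ hm β)⟩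

/-! ### Scattering states -/

/-- The transmission amplitude at wave number `2πk`, for waves incoming from the right if `k < 0`,
and its analytic continuation for `k > 0`. -/
def transmission (ħ m : ℝ) (β : OnePoint ℝ) (k : ℝ) : ℂ :=
  β.elim 0 fun b => 1 / (1 + ((m * b / ħ ^ 2 * (2 * Real.pi * k) : ℝ) : ℂ) * I)

theorem one_le_norm_one_add_mul_I (x : ℝ) : 1 ≤ ‖1 + (x : ℂ) * I‖ := by
  convert re_le_norm (1 + (x : ℂ) * I)
  simp

theorem abs_le_norm_one_add_mul_I (x : ℝ) : |x| ≤ ‖1 + (x : ℂ) * I‖ := by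
  convert abs_im_le_norm (1 + (x : ℂ) * I)
  simp

theorem one_add_mul_I_ne_zero (x : ℝ) : 1 + (x : ℂ) * I ≠ 0 :=
  norm_pos_iff.1 (one_pos.trans_le (one_le_norm_one_add_mul_I x))

theorem one_sub_transmission_coe (ħ m b k : ℝ) :
    1 - transmission ħ m b k
      = ((m * b / ħ ^ 2 : ℝ) : ℂ) * (2 * Real.pi * k * I * transmission ħ m b k) := by
  change 1 - 1 / (1 + ((m * b / ħ ^ 2 * (2 * Real.pi * k) : ℝ) : ℂ) * I)
    = ((m * b / ħ ^ 2 : ℝ) : ℂ) * (2 * Real.pi * k * I *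
      (1 / (1 + ((m * b / ħ ^ 2 * (2 * Real.pi * k) : ℝ) : ℂ) * I)))
  have cancel := one_div_mul_cancel (one_add_mul_I_ne_zero (m * b / ħ ^ 2 * (2 * Real.pi * k)))
  push_cast at cancel ⊢
  linear_combination -cancel

theorem norm_transmission_le (ħ m : ℝ) (β : OnePoint ℝ) (k : ℝ) : ‖transmission ħ m β k‖ ≤ 1 := by
  induction β using OnePoint.rec with
  | infty =>
    change ‖(0 : ℂ)‖ ≤ 1
    rw [norm_zero]
    exact zero_le_one
  | coe b =>
    change ‖1 / (1 + ((m * b / ħ ^ 2 * (2 * Real.pi * k) : ℝ) : ℂ) * I)‖ ≤ 1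
    rw [norm_div, norm_one]
    exact div_le_one_of_le₀ (one_le_norm_one_add_mul_I _) (norm_nonneg _)

theorem measurable_transmission (ħ m : ℝ) (β : OnePoint ℝ) : Measurable (transmission ħ m β) := by
  induction β using OnePoint.rec with
  | infty => exact measurable_const
  | coe b =>
    change Measurable fun k : ℝ => 1 / (1 + ((m * b / ħ ^ 2 * (2 * Real.pi * k) : ℝ) : ℂ) * I)
    fun_prop

theorem memLp_top_transmission (ħ m : ℝ) (β : OnePoint ℝ) :
    MemLp (transmission ħ m β) ⊤ volume :=
  memLp_top_of_bound (measurable_transmission ħ m β).aestronglyMeasurable 1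
    (.of_forall (norm_transmission_le ħ m β))

/-- The Fourier multiplier of the transmission amplitude. -/
def transmit (ħ m : ℝ) (β : OnePoint ℝ) : L2 →L[ℂ] L2 := mulCLM (memLp_top_transmission ħ m β)

theorem coeFn_transmit (ħ m : ℝ) (β : OnePoint ℝ) (f : L2) :
    transmit ħ m β f =ᵐ[volume] fun k => transmission ħ m β k * f k :=
  coeFn_mulCLM _ f

/-- The superposition with amplitude `f k` of the scattering states that equal
`e^{2πikx} + (1 - T(k)) e^{-2πikx}` for `0 < x` and `T(k) e^{2πikx}` for `x < 0`, where `T` is the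
transmission amplitude. -/
def scatter (ħ m : ℝ) (β : OnePoint ℝ) : L2 →L[ℂ] L2 :=
  let F : L2 →L[ℂ] L2 := fourierInvL2.toContinuousLinearEquiv.toContinuousLinearMap
  let P : L2 →L[ℂ] L2 := parity.toContinuousLinearEquiv.toContinuousLinearMap
  cutPos ∘L (F + P ∘L F ∘L (1 - transmit ħ m β)) + cutNeg ∘L F ∘L transmit ħ m β

theorem scatter_apply (ħ m : ℝ) (β : OnePoint ℝ) (f : L2) :
    scatter ħ m β f = cutPos (fourierInvL2 f)
      + cutPos (parity (fourierInvL2 (f - transmit ħ m β f)))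
      + cutNeg (fourierInvL2 (transmit ħ m β f)) := by
  change cutPos (fourierInvL2 f + parity (fourierInvL2 (f - transmit ħ m β f)))
    + cutNeg (fourierInvL2 (transmit ħ m β f)) = _
  rw [map_add]

section ScatteringBoundaryCondition

variable {ħ m : ℝ} {β : OnePoint ℝ} {f g : L2}
  (hg : g =ᵐ[volume] fun k : ℝ => -(2 * Real.pi * k : ℂ) ^ 2 * f k)

include hg

theorem transmit_ae_eq_neg_sq_mul :
    transmit ħ m β g =ᵐ[volume] fun k : ℝ => -(2 * Real.pi * k : ℂ) ^ 2 * transmit ħ m β f k := by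
  filter_upwards [hg, coeFn_transmit ħ m β f, coeFn_transmit ħ m β g] with k hgk hTf hTg
  rw [hTg, hTf, hgk]
  ring

theorem sub_transmit_ae_eq_neg_sq_mul :
    (g - transmit ħ m β g : L2) =ᵐ[volume]
      fun k : ℝ => -(2 * Real.pi * k : ℂ) ^ 2 * (f - transmit ħ m β f : L2) k := by
  filter_upwards [hg, transmit_ae_eq_neg_sq_mul hg, Lp.coeFn_sub g (transmit ħ m β g),
    Lp.coeFn_sub f (transmit ħ m β f)] with k hgk hTk hsub_g hsub_f
  rw [hsub_g, hsub_f, Pi.sub_apply, Pi.sub_apply, hgk, hTk]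
  ring

theorem integral_sub_transmit :
    ∫ k, (f - transmit ħ m β f : L2) k = (∫ k, f k) - ∫ k, transmit ħ m β f k := by
  rw [← integral_sub (integrable_of_ae_eq_neg_sq_mul hg)
    (integrable_of_ae_eq_neg_sq_mul (transmit_ae_eq_neg_sq_mul hg))]
  exact integral_congr_ae (Lp.coeFn_sub f _)

theorem integral_mul_sub_transmit :
    ∫ k : ℝ, 2 * Real.pi * k * I * (f - transmit ħ m β f : L2) k
      = (∫ k : ℝ, 2 * Real.pi * k * I * f k)
        - ∫ k : ℝ, 2 * Real.pi * k * I * transmit ħ m β f k := by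
  rw [← integral_sub (integrable_mul_of_ae_eq_neg_sq_mul hg)
    (integrable_mul_of_ae_eq_neg_sq_mul (transmit_ae_eq_neg_sq_mul hg))]
  refine integral_congr_ae ?_
  filter_upwards [Lp.coeFn_sub f (transmit ħ m β f)] with k hk
  rw [hk, Pi.sub_apply, mul_sub]

omit hg in
theorem integral_mul_transmit_infty :
    ∫ k : ℝ, 2 * Real.pi * k * I * transmit ħ m ∞ f k = 0 := by
  refine integral_eq_zero_of_ae ?_
  filter_upwards [coeFn_transmit ħ m ∞ f] with k hk
  rw [hk]
  change _ * (0 * f k) = 0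
  rw [zero_mul, mul_zero]

theorem integral_sub_integral_transmit_coe (b : ℝ) :
    (∫ k, f k) - ∫ k, transmit ħ m b f k
      = ((m * b / ħ ^ 2 : ℝ) : ℂ) * ∫ k : ℝ, 2 * Real.pi * k * I * transmit ħ m b f k := by
  rw [← integral_sub_transmit hg, ← integral_const_mul]
  refine integral_congr_ae ?_
  filter_upwards [coeFn_transmit ħ m b f, Lp.coeFn_sub f (transmit ħ m b f)] with k hk hsub
  rw [hsub, Pi.sub_apply, hk]
  linear_combination f k * one_sub_transmission_coe ħ m b k

theorem boundaryCondition_transmit :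
    BoundaryCondition ħ m β ((∫ k, f k) + ((∫ k, f k) - ∫ k, transmit ħ m β f k))
      (∫ k, transmit ħ m β f k) (∫ k : ℝ, 2 * Real.pi * k * I * transmit ħ m β f k)
      (∫ k : ℝ, 2 * Real.pi * k * I * transmit ħ m β f k) := by
  refine ⟨rfl, ?_⟩
  induction β using OnePoint.rec with
  | infty => exact integral_mul_transmit_infty
  | coe b =>
    change _ - _ = ((2 * m * b / ħ ^ 2 : ℝ) : ℂ) * _
    have := integral_sub_integral_transmit_coe (ħ := ħ) (m := m) hg b
    push_cast at this ⊢
    linear_combination 2 * this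

theorem hamiltonian_scatter :
    Hamiltonian ħ m β (scatter ħ m β f)
      (((-(ħ ^ 2 / (2 * m)) : ℝ) : ℂ) • scatter ħ m β g) := by
  have incoming := (hasSecondDeriv_fourierInvL2 hg).cutPos
  have reflected := (hasSecondDeriv_fourierInvL2
    (sub_transmit_ae_eq_neg_sq_mul (ħ := ħ) (m := m) (β := β) hg)).comp_parity.cutPos
  have transmitted := (hasSecondDeriv_fourierInvL2
    (transmit_ae_eq_neg_sq_mul (ħ := ħ) (m := m) (β := β) hg)).cutNeg
  have sum := (incoming.add reflected).add transmitted
  rw [← scatter_apply, ← scatter_apply, integral_sub_transmit hg, integral_mul_sub_transmit hg]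
    at sum
  refine ⟨_, _, _, _, _, sum, ?_, rfl⟩
  convert boundaryCondition_transmit hg using 1 <;> ring

end ScatteringBoundaryCondition

theorem norm_cexp_neg_I_mul_sub_sub_le (θ s t : ℝ) :
    ‖cexp (-(I * (θ * s : ℝ))) - cexp (-(I * (θ * t : ℝ)))
      - (s - t : ℝ) * (-(I * θ) * cexp (-(I * (θ * t : ℝ))))‖ ≤ 3 * (s - t) ^ 2 * θ ^ 2 := by
  have norm_phase : ‖cexp (-(I * (θ * t : ℝ)))‖ = 1 := by
    rw [mul_comm, ← neg_mul, ← ofReal_neg, norm_exp_ofReal_mul_I]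
  have add_phase : cexp (-(I * (θ * s : ℝ)))
      = cexp (-(I * (θ * (s - t) : ℝ))) * cexp (-(I * (θ * t : ℝ))) := by
    rw [← Complex.exp_add]
    push_cast
    ring_nf
  calc _ = ‖(cexp (-(I * (θ * (s - t) : ℝ))) - 1 + I * (θ * (s - t) : ℝ))
        * cexp (-(I * (θ * t : ℝ)))‖ := by
        rw [add_phase]
        push_cast
        ring_nf
    _ ≤ 3 * (θ * (s - t)) ^ 2 := by
        rw [norm_mul, norm_phase, mul_one]
        exact norm_cexp_neg_I_mul_sub_one_add_le _
    _ = 3 * (s - t) ^ 2 * θ ^ 2 := by ring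

theorem hasDerivAt_of_phase {θ : ℝ → ℝ} {G D : ℝ → L2} {N : L2}
    (hG : ∀ t : ℝ, G t =ᵐ[volume] fun k => cexp (-(I * (θ k * t : ℝ))) * G 0 k)
    (hD : ∀ t : ℝ, D t =ᵐ[volume] fun k => -(I * θ k) * G t k)
    (hN : N =ᵐ[volume] fun k => (θ k : ℂ) ^ 2 * G 0 k) (t : ℝ) : HasDerivAt G (D t) t := by
  have remainder (s : ℝ) : ‖G s - G t - (s - t) • D t‖ ≤ 3 * ‖N‖ * ‖‖s - t‖ ^ 2‖ := by
    rw [norm_pow, norm_norm, Real.norm_eq_abs, sq_abs, mul_right_comm]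
    refine Lp.norm_le_mul_norm_of_ae_le_mul ?_
    filter_upwards [hG s, hG t, hD t, hN, Lp.coeFn_sub (G s - G t) ((s - t) • D t),
      Lp.coeFn_sub (G s) (G t), Lp.coeFn_smul (s - t) (D t)] with k hs ht hDk hNk h1 h2 h3
    rw [h1, Pi.sub_apply, h2, Pi.sub_apply, h3, Pi.smul_apply, hDk, hs, ht, hNk, real_smul,
      ← mul_assoc, ← mul_assoc, ← sub_mul, ← sub_mul, norm_mul, norm_mul, norm_pow, norm_real,
      Real.norm_eq_abs, sq_abs, ← mul_assoc, mul_assoc (_ : ℂ)]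
    exact mul_le_mul_of_nonneg_right (norm_cexp_neg_I_mul_sub_sub_le _ _ _) (norm_nonneg _)
  rw [hasDerivAt_iff_isLittleO]
  exact (Asymptotics.IsBigO.of_bound _ (.of_forall remainder)).trans_isLittleO
    (Asymptotics.isLittleO_pow_sub_sub t one_lt_two)

/-! ### Gaussian wave packets -/

theorem integrable_pow_mul_exp_neg_mul_sq {b : ℝ} (hb : 0 < b) (n : ℕ) :
    Integrable fun x : ℝ => x ^ n * Real.exp (-b * x ^ 2) := by
  simpa only [Real.rpow_natCast] using
    integrable_rpow_mul_exp_neg_mul_sq hb (s := n) (by linarith [n.cast_nonneg (α := ℝ)])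

theorem integral_affine_pow_mul_exp_neg_sq {a s : ℝ} (ha : 0 < a) (hs : 0 < s) (b : ℝ) (n : ℕ) :
    ∫ k : ℝ, (a * k - b) ^ n * Real.exp (-2 * (s * (a * k - b)) ^ 2)
      = (∫ x : ℝ, x ^ n * Real.exp (-2 * x ^ 2)) / (a * s ^ (n + 1)) := by
  let g (x : ℝ) : ℝ := x ^ n * Real.exp (-2 * x ^ 2)
  calc ∫ k : ℝ, (a * k - b) ^ n * Real.exp (-2 * (s * (a * k - b)) ^ 2)
      = ∫ k : ℝ, (s ^ n)⁻¹ * g (s * (a * k - b)) := by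
        congr with k
        change _ = (s ^ n)⁻¹ * ((s * (a * k - b)) ^ n * _)
        rw [mul_pow s (a * k - b) n, mul_assoc (s ^ n), inv_mul_cancel_left₀ (by positivity)]
    _ = (s ^ n)⁻¹ * (a⁻¹ * (s⁻¹ * ∫ x, g x)) := by
        rw [integral_const_mul, Measure.integral_comp_mul_left (fun y => g (s * (y - b))),
          integral_sub_right_eq_self (fun y => g (s * y)), Measure.integral_comp_mul_left g,
          abs_of_pos (inv_pos.2 ha), abs_of_pos (inv_pos.2 hs), smul_eq_mul, smul_eq_mul]
    _ = (∫ x, g x) / (a * s ^ (n + 1)) := by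
        field_simp
        ring

/-- The `L²` norm of `xⁿ` with respect to the Gaussian probability measure of variance `1/4`. -/
def momentConst (n : ℕ) : ℝ :=
  √(√(2 / Real.pi) * ∫ x : ℝ, x ^ (2 * n) * Real.exp (-2 * x ^ 2))

theorem momentConst_nonneg (n : ℕ) : 0 ≤ momentConst n := Real.sqrt_nonneg _

theorem momentConst_zero : momentConst 0 = 1 := by
  have sqrt_mul_integral : √(2 / Real.pi) * ∫ x : ℝ, x ^ (2 * 0) * Real.exp (-2 * x ^ 2) = 1 := by
    simp only [mul_zero, pow_zero, one_mul]
    rw [integral_gaussian, ← Real.sqrt_mul (by positivity), div_mul_div_cancel₀ Real.pi_ne_zero,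
      div_self two_ne_zero, Real.sqrt_one]
  rw [momentConst, sqrt_mul_integral, Real.sqrt_one]

/-- The normalization constant of the Fourier transform of a coherent state. -/
def packetConst (ħ σ₀ : ℝ) : ℝ :=
  2 * Real.pi / (2 * Real.pi * ħ) ^ (1 / 4 : ℝ) * √(ħ * σ₀ / Real.pi)

/-- The Fourier transform, in the variable `k` of the convention `𝓕 f k = ∫ e^{-2πikx} f x dx`, of
a coherent state evolved freely up to time `t`. -/
def packetFourier (ħ m σ₀ q p t : ℝ) (k : ℝ) : ℂ :=
  packetConst ħ σ₀ * cexp (-((ħ * σ₀ ^ 2 * (2 * Real.pi * k - p / ħ) ^ 2 : ℝ) : ℂ)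
    - ((2 * Real.pi * k * q + ħ * (2 * Real.pi * k) ^ 2 / (2 * m) * t : ℝ) : ℂ) * I)

theorem continuous_packetFourier (ħ m σ₀ q p t : ℝ) : Continuous (packetFourier ħ m σ₀ q p t) := by
  unfold packetFourier
  fun_prop

theorem packetFourier_eq_phase_mul (ħ m σ₀ q p t k : ℝ) :
    packetFourier ħ m σ₀ q p t k
      = cexp (-(I * (ħ * (2 * Real.pi * k) ^ 2 / (2 * m) * t : ℝ)))
        * packetFourier ħ m σ₀ q p 0 k := by
  rw [packetFourier, packetFourier, mul_left_comm, ← Complex.exp_add]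
  congr 2
  push_cast
  ring

theorem sigmaAt_re (m σ₀ t : ℝ) : (sigmaAt m σ₀ t).re = σ₀ := by
  rw [sigmaAt, show I * t / (2 * m * σ₀) = ((t / (2 * m * σ₀) : ℝ) : ℂ) * I by push_cast; ring,
    add_re, ofReal_re, re_ofReal_mul, I_re, mul_zero, add_zero]

theorem sigmaAt_im (m σ₀ t : ℝ) : (sigmaAt m σ₀ t).im = t / (2 * m * σ₀) := by
  rw [sigmaAt, show I * t / (2 * m * σ₀) = ((t / (2 * m * σ₀) : ℝ) : ℂ) * I by push_cast; ring,
    add_im, ofReal_im, im_ofReal_mul, I_im, mul_one, zero_add]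

theorem mul_sigmaAt {m σ₀ : ℝ} (hm : m ≠ 0) (hσ₀ : σ₀ ≠ 0) (t : ℝ) :
    σ₀ * sigmaAt m σ₀ t = σ₀ ^ 2 + I * t / (2 * m) := by
  have : (σ₀ : ℂ) ≠ 0 := ofReal_ne_zero.2 hσ₀
  have : (m : ℂ) ≠ 0 := ofReal_ne_zero.2 hm
  rw [sigmaAt]
  field_simp

section Packet

variable {ħ σ₀ : ℝ} (hħ : 0 < ħ) (hσ₀ : 0 < σ₀)

include hħ hσ₀

theorem packetConst_pos : 0 < packetConst ħ σ₀ := by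
  have := Real.pi_pos
  unfold packetConst
  positivity

theorem packetConst_sq : packetConst ħ σ₀ ^ 2 = 2 * Real.pi * √(2 / Real.pi) * (√ħ * σ₀) := by
  have sq_fourth_root : ((2 * Real.pi * ħ) ^ (1 / 4 : ℝ)) ^ 2 = √2 * √Real.pi * √ħ := by
    rw [← Real.rpow_natCast, ← Real.rpow_mul (by positivity), ← Real.sqrt_mul (by positivity),
      ← Real.sqrt_mul (by positivity), Real.sqrt_eq_rpow]
    norm_num
  rw [packetConst, mul_pow, div_pow, sq_fourth_root, Real.sq_sqrt (by positivity),
    Real.sqrt_div zero_le_two]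
  field_simp
  rw [Real.sq_sqrt zero_le_two, Real.sq_sqrt hħ.le]

theorem norm_packetFourier (m q p t k : ℝ) :
    ‖packetFourier ħ m σ₀ q p t k‖
      = packetConst ħ σ₀ * Real.exp (-(ħ * σ₀ ^ 2 * (2 * Real.pi * k - p / ħ) ^ 2)) := by
  rw [packetFourier, norm_mul, norm_real, Real.norm_of_nonneg (packetConst_pos hħ hσ₀).le, norm_exp,
    sub_re, neg_re, ofReal_re, re_ofReal_mul, I_re, mul_zero, sub_zero]

theorem norm_sq_shift_pow_mul_packetFourier (m q p t : ℝ) (n : ℕ) (k : ℝ) :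
    ‖((2 * Real.pi * k - p / ħ : ℝ) : ℂ) ^ n * packetFourier ħ m σ₀ q p t k‖ ^ 2
      = packetConst ħ σ₀ ^ 2 * ((2 * Real.pi * k - p / ħ) ^ (2 * n)
        * Real.exp (-2 * (√ħ * σ₀ * (2 * Real.pi * k - p / ħ)) ^ 2)) := by
  rw [norm_mul, norm_packetFourier hħ hσ₀, norm_pow, norm_real, Real.norm_eq_abs, mul_pow, mul_pow,
    ← pow_mul, mul_comm n 2, pow_mul |_|, sq_abs, ← pow_mul, ← Real.exp_nat_mul, mul_pow (_ * _),
    mul_pow (√ħ), Real.sq_sqrt hħ.le, mul_left_comm, Nat.cast_ofNat, mul_neg, neg_mul]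

theorem memLp_shift_pow_mul_packetFourier (m q p t : ℝ) (n : ℕ) :
    MemLp (fun k : ℝ => ((2 * Real.pi * k - p / ħ : ℝ) : ℂ) ^ n * packetFourier ħ m σ₀ q p t k)
      2 volume := by
  have continuous_product : Continuous fun k : ℝ =>
      ((2 * Real.pi * k - p / ħ : ℝ) : ℂ) ^ n * packetFourier ħ m σ₀ q p t k :=
    Continuous.mul (by fun_prop) (continuous_packetFourier ħ m σ₀ q p t)
  rw [memLp_two_iff_integrable_sq_norm continuous_product.aestronglyMeasurable]
  have gaussian := ((integrable_pow_mul_exp_neg_mul_sq (b := 2 * (√ħ * σ₀) ^ 2) (by positivity)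
    (2 * n)).comp_sub_right (p / ħ)).comp_mul_left' (R := 2 * Real.pi) (by positivity)
  refine (gaussian.const_mul (packetConst ħ σ₀ ^ 2)).congr (.of_forall fun k => ?_)
  beta_reduce
  rw [norm_sq_shift_pow_mul_packetFourier hħ hσ₀, neg_mul, neg_mul,
    mul_assoc 2 ((√ħ * σ₀) ^ 2), ← mul_pow]

theorem norm_shift_pow_mul_packetFourier (m q p t : ℝ) (n : ℕ) :
    ‖(memLp_shift_pow_mul_packetFourier hħ hσ₀ m q p t n).toLp‖
      = momentConst n / (√ħ * σ₀) ^ n := by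
  have width_pos : 0 < √ħ * σ₀ := by positivity
  have norm_sq_eq : ‖(memLp_shift_pow_mul_packetFourier hħ hσ₀ m q p t n).toLp‖ ^ 2
      = (momentConst n / (√ħ * σ₀) ^ n) ^ 2 := by
    have moment_nonneg : 0 ≤ ∫ x : ℝ, x ^ (2 * n) * Real.exp (-2 * x ^ 2) :=
      integral_nonneg fun x => mul_nonneg ((even_two_mul n).pow_nonneg x) (Real.exp_nonneg _)
    rw [Lp.norm_toLp, MemLp.eLpNorm_eq_integral_rpow_norm two_ne_zero ENNReal.ofNat_ne_top
      (memLp_shift_pow_mul_packetFourier hħ hσ₀ m q p t n), ENNReal.toReal_ofReal (by positivity),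
      ENNReal.toReal_ofNat, ← one_div, ← Real.sqrt_eq_rpow, Real.sq_sqrt (by positivity)]
    simp only [Real.rpow_ofNat, norm_sq_shift_pow_mul_packetFourier hħ hσ₀]
    rw [integral_const_mul,
      integral_affine_pow_mul_exp_neg_sq Real.two_pi_pos width_pos, packetConst_sq hħ hσ₀,
      div_pow, momentConst, Real.sq_sqrt (mul_nonneg (Real.sqrt_nonneg _) moment_nonneg)]
    field_simp
    ring
  exact (sq_eq_sq₀ (norm_nonneg _) (div_nonneg (momentConst_nonneg n) (by positivity))).1 norm_sq_eq

theorem memLp_pow_mul_packetFourier (m q p t : ℝ) (n : ℕ) :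
    MemLp (fun k : ℝ => ((2 * Real.pi * k : ℝ) : ℂ) ^ n * packetFourier ħ m σ₀ q p t k)
      2 volume := by
  have binomial (k : ℝ) : ((2 * Real.pi * k : ℝ) : ℂ) ^ n * packetFourier ħ m σ₀ q p t k
      = ∑ i ∈ Finset.range (n + 1), ((p / ħ : ℝ) : ℂ) ^ (n - i) * (n.choose i : ℂ) *
        (((2 * Real.pi * k - p / ħ : ℝ) : ℂ) ^ i * packetFourier ħ m σ₀ q p t k) := by
    rw [← sub_add_cancel (2 * Real.pi * k) (p / ħ), ofReal_add, add_pow, Finset.sum_mul,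
      sub_add_cancel]
    exact Finset.sum_congr rfl fun i _ => by ring
  simp only [binomial]
  exact memLp_finsetSum _ fun i _ =>
    (memLp_shift_pow_mul_packetFourier hħ hσ₀ m q p t i).const_mul _

theorem memLp_packetFourier (m q p t : ℝ) : MemLp (packetFourier ħ m σ₀ q p t) 2 volume := by
  simpa only [pow_zero, one_mul] using memLp_pow_mul_packetFourier hħ hσ₀ m q p t 0

/-- The Fourier transform of the freely evolved wave packet, as an element of `L²(ℝ)`. -/
def packet (m q p t : ℝ) : L2 := (memLp_packetFourier hħ hσ₀ m q p t).toLp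

theorem coeFn_packet (m q p t : ℝ) :
    packet hħ hσ₀ m q p t =ᵐ[volume] packetFourier ħ m σ₀ q p t :=
  (memLp_packetFourier hħ hσ₀ m q p t).coeFn_toLp

theorem norm_packet (m q p t : ℝ) : ‖packet hħ hσ₀ m q p t‖ = 1 := by
  simpa only [packet, pow_zero, one_mul, div_one, momentConst_zero]
    using norm_shift_pow_mul_packetFourier hħ hσ₀ m q p t 0

/-- The Fourier transform `-(2πk)² f k` of the second derivative of the freely evolved wave
packet. -/
def packetSq (m q p t : ℝ) : L2 := -(memLp_pow_mul_packetFourier hħ hσ₀ m q p t 2).toLp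

theorem coeFn_packetSq (m q p t : ℝ) :
    packetSq hħ hσ₀ m q p t =ᵐ[volume]
      fun k : ℝ => -(2 * Real.pi * k : ℂ) ^ 2 * packet hħ hσ₀ m q p t k := by
  have hL2 := memLp_pow_mul_packetFourier hħ hσ₀ m q p t 2
  filter_upwards [Lp.coeFn_neg hL2.toLp, hL2.coeFn_toLp, coeFn_packet hħ hσ₀ m q p t]
    with k hneg hsq hk
  rw [packetSq, hneg, Pi.neg_apply, hsq, hk, neg_mul]
  push_cast
  rfl

theorem hasDerivAt_packet (m q p t : ℝ) :
    HasDerivAt (packet hħ hσ₀ m q p)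
      (-(I / (ħ : ℂ)) • ((-(ħ ^ 2 / (2 * m)) : ℝ) : ℂ) • packetSq hħ hσ₀ m q p t) t := by
  have ħ_ne : (ħ : ℂ) ≠ 0 := ofReal_ne_zero.2 hħ.ne'
  have hL2 := memLp_pow_mul_packetFourier hħ hσ₀ m q p 0 4
  refine hasDerivAt_of_phase (θ := fun k => ħ * (2 * Real.pi * k) ^ 2 / (2 * m))
    (D := fun t => -(I / (ħ : ℂ)) • ((-(ħ ^ 2 / (2 * m)) : ℝ) : ℂ) • packetSq hħ hσ₀ m q p t)
    (N := ((ħ / (2 * m) : ℝ) : ℂ) ^ 2 • hL2.toLp) (fun t => ?_) (fun t => ?_) ?_ t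
  · filter_upwards [coeFn_packet hħ hσ₀ m q p t, coeFn_packet hħ hσ₀ m q p 0] with k ht h0
    rw [ht, h0, packetFourier_eq_phase_mul]
  · filter_upwards [coeFn_packetSq hħ hσ₀ m q p t,
      Lp.coeFn_smul (-(I / (ħ : ℂ))) (((-(ħ ^ 2 / (2 * m)) : ℝ) : ℂ) • packetSq hħ hσ₀ m q p t),
      Lp.coeFn_smul ((-(ħ ^ 2 / (2 * m)) : ℝ) : ℂ) (packetSq hħ hσ₀ m q p t)] with k hsq h1 h2
    rw [h1, Pi.smul_apply, h2, Pi.smul_apply, hsq, smul_eq_mul, smul_eq_mul]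
    push_cast
    field_simp
  · filter_upwards [hL2.coeFn_toLp, coeFn_packet hħ hσ₀ m q p 0,
      Lp.coeFn_smul (((ħ / (2 * m) : ℝ) : ℂ) ^ 2) hL2.toLp] with k hpow h0 h1
    rw [h1, Pi.smul_apply, hpow, h0, smul_eq_mul]
    push_cast
    ring

theorem unitaryGroup_scatter_packet {m : ℝ} {β : OnePoint ℝ} {U : ℝ → L2 ≃ₗᵢ[ℂ] L2}
    (hU : IsUnitaryGroupOf ħ (Hamiltonian ħ m β) U) (q p t : ℝ) :
    U t (scatter ħ m β (packet hħ hσ₀ m q p 0)) = scatter ħ m β (packet hħ hσ₀ m q p t) := by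
  refine hU.apply_eq_of_hasDerivAt (φ := fun t => scatter ħ m β (packet hħ hσ₀ m q p t))
    (fun t => hamiltonian_scatter (coeFn_packetSq hħ hσ₀ m q p t)) (fun t => ?_) t
  have deriv := ((scatter ħ m β).restrictScalars ℝ).hasFDerivAt.comp_hasDerivAt t
    (hasDerivAt_packet hħ hσ₀ m q p t)
  rwa [ContinuousLinearMap.coe_restrictScalars', _root_.map_smul, _root_.map_smul] at deriv

theorem packetConst_mul_sqrt :
    packetConst ħ σ₀ * √(1 / (4 * Real.pi * ħ * σ₀)) = 1 / (2 * Real.pi * ħ) ^ (1 / 4 : ℝ) := by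
  have sq_eq : ħ * σ₀ / Real.pi * (1 / (4 * Real.pi * ħ * σ₀)) = (1 / (2 * Real.pi)) ^ 2 := by
    field_simp
    norm_num
  rw [packetConst, mul_assoc, ← Real.sqrt_mul (by positivity), sq_eq, Real.sqrt_sq (by positivity)]
  field_simp

omit hħ hσ₀ in
theorem ofReal_mul_inv_cpow_half {r : ℝ} (hr : 0 < r) {z : ℂ} (hz : 0 < z.re) :
    ((r : ℂ) * z⁻¹) ^ (1 / 2 : ℂ) = √r * (z ^ (1 / 2 : ℂ))⁻¹ := by
  have z_ne : z ≠ 0 := fun h => hz.ne' (congrArg re h)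
  have arg_ne : arg z ≠ Real.pi := fun h =>
    (le_abs_self _).not_gt (h ▸ (abs_arg_lt_pi_div_two_iff.2 (.inl hz)).trans
      (half_lt_self Real.pi_pos))
  rw [cpow_def_of_ne_zero (mul_ne_zero (ofReal_ne_zero.2 hr.ne') (inv_ne_zero z_ne)),
    log_ofReal_mul hr (inv_ne_zero z_ne), log_inv _ arg_ne, add_mul, Complex.exp_add,
    cpow_def_of_ne_zero z_ne, neg_mul, Complex.exp_neg, Real.sqrt_eq_rpow,
    Real.rpow_def_of_pos hr]
  push_cast
  rfl

theorem packetConst_mul_cpow {σ : ℂ} (hσ : 0 < σ.re) :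
    (packetConst ħ σ₀ : ℂ) * (Real.pi / (4 * Real.pi ^ 2 * ħ * σ₀ * σ)) ^ (1 / 2 : ℂ)
      = 1 / ((((2 * Real.pi * ħ) ^ (1 / 4 : ℝ) : ℝ) : ℂ) * σ ^ (1 / 2 : ℂ)) := by
  have base_eq : (Real.pi / (4 * Real.pi ^ 2 * ħ * σ₀ * σ) : ℂ)
      = ((1 / (4 * Real.pi * ħ * σ₀) : ℝ) : ℂ) * σ⁻¹ := by
    have : (Real.pi : ℂ) ≠ 0 := ofReal_ne_zero.2 Real.pi_ne_zero
    push_cast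
    field_simp
  rw [base_eq, ofReal_mul_inv_cpow_half (by positivity) hσ, ← mul_assoc, ← ofReal_mul,
    packetConst_mul_sqrt hħ hσ₀, ofReal_div, ofReal_one, one_div, one_div (_ * _), mul_inv]

omit hħ hσ₀ in
theorem fourierKernel_mul_packetFourier {m : ℝ} (hħ : ħ ≠ 0) (hm : m ≠ 0) (hσ₀ : σ₀ ≠ 0)
    (q p t x k : ℝ) :
    cexp (2 * Real.pi * k * I * x) * packetFourier ħ m σ₀ q p t k
      = packetConst ħ σ₀ * cexp (-(4 * Real.pi ^ 2 * ħ * σ₀ * sigmaAt m σ₀ t) * (k : ℂ) ^ 2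
        + (2 * Real.pi * I * (x - q) + 4 * Real.pi * σ₀ ^ 2 * p) * k
        + -(σ₀ ^ 2 * p ^ 2 / ħ)) := by
  have : (ħ : ℂ) ≠ 0 := ofReal_ne_zero.2 hħ
  have : (m : ℂ) ≠ 0 := ofReal_ne_zero.2 hm
  rw [packetFourier, mul_left_comm, ← Complex.exp_add, mul_assoc _ (σ₀ : ℂ), mul_sigmaAt hm hσ₀]
  congr 2
  push_cast
  field_simp
  ring

omit hħ hσ₀ in
theorem completeSquare_packetExponent {m : ℝ} (hħ : ħ ≠ 0) (hm : m ≠ 0) (hσ₀ : σ₀ ≠ 0)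
    (q p t x : ℝ) :
    (-(σ₀ ^ 2 * p ^ 2 / ħ) - (2 * Real.pi * I * (x - q) + 4 * Real.pi * σ₀ ^ 2 * p) ^ 2
        / (4 * -(4 * Real.pi ^ 2 * ħ * σ₀ * sigmaAt m σ₀ t)) : ℂ)
      = I / ħ * ((p ^ 2 * t / (2 * m) : ℝ) : ℂ)
        + (-(1 / (4 * ħ * σ₀ * sigmaAt m σ₀ t)) * ((x - (q + p / m * t) : ℝ) : ℂ) ^ 2
          + I / ħ * p * ((x - (q + p / m * t) : ℝ) : ℂ)) := by
  have : (Real.pi : ℂ) ≠ 0 := ofReal_ne_zero.2 Real.pi_ne_zero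
  have : (ħ : ℂ) ≠ 0 := ofReal_ne_zero.2 hħ
  have : (m : ℂ) ≠ 0 := ofReal_ne_zero.2 hm
  have width_ne : (σ₀ : ℂ) * sigmaAt m σ₀ t ≠ 0 := mul_ne_zero (ofReal_ne_zero.2 hσ₀) fun h =>
    hσ₀ (by rw [← sigmaAt_re m σ₀ t, h, zero_re])
  have sq_eq : (σ₀ : ℂ) ^ 2 = σ₀ * sigmaAt m σ₀ t - I * t / (2 * m) := by
    rw [mul_sigmaAt hm hσ₀, add_sub_cancel_right]
  rw [sq_eq, mul_assoc _ (σ₀ : ℂ), mul_assoc _ (σ₀ : ℂ)]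
  generalize (σ₀ : ℂ) * sigmaAt m σ₀ t = S at width_ne
  push_cast
  field_simp
  ring_nf
  simp only [I_sq]
  ring

theorem coeFn_fourierInvL2_packet {m : ℝ} (hm : m ≠ 0) (q p t : ℝ) :
    fourierInvL2 (packet hħ hσ₀ m q p t) =ᵐ[volume] fun x =>
      cexp (I / ħ * ((p ^ 2 * t / (2 * m) : ℝ) : ℂ)) *
        coherent ħ σ₀ (sigmaAt m σ₀ t) (q + p / m * t, p) x := by
  have integrable_packet : Integrable (packet hħ hσ₀ m q p t) :=
    integrable_of_ae_eq_neg_sq_mul (coeFn_packetSq hħ hσ₀ m q p t)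
  refine (coeFn_fourierInvL2 integrable_packet).trans (.of_forall fun x => ?_)
  have sigma_re_pos : 0 < (sigmaAt m σ₀ t).re := (sigmaAt_re m σ₀ t).symm ▸ hσ₀
  have quadratic_re_neg : (-(4 * Real.pi ^ 2 * ħ * σ₀ * sigmaAt m σ₀ t) : ℂ).re < 0 := by
    rw [show (4 * Real.pi ^ 2 * ħ * σ₀ * sigmaAt m σ₀ t : ℂ)
      = ((4 * Real.pi ^ 2 * ħ * σ₀ : ℝ) : ℂ) * sigmaAt m σ₀ t by push_cast; rfl, neg_re,
      re_ofReal_mul, neg_lt_zero]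
    exact mul_pos (by positivity) sigma_re_pos
  beta_reduce
  calc 𝓕⁻ (packet hħ hσ₀ m q p t : ℝ → ℂ) x
      = ∫ k : ℝ, (packetConst ħ σ₀ : ℂ) *
          cexp (-(4 * Real.pi ^ 2 * ħ * σ₀ * sigmaAt m σ₀ t) * (k : ℂ) ^ 2
            + (2 * Real.pi * I * (x - q) + 4 * Real.pi * σ₀ ^ 2 * p) * k
            + -(σ₀ ^ 2 * p ^ 2 / ħ)) := by
        rw [fourierInv_eq_integral_cexp]
        refine integral_congr_ae ((coeFn_packet hħ hσ₀ m q p t).mono fun k hk => ?_)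
        beta_reduce
        rw [hk, fourierKernel_mul_packetFourier hħ.ne' hm hσ₀.ne']
    _ = _ := by
        rw [integral_const_mul, integral_cexp_quadratic quadratic_re_neg, neg_neg, ← mul_assoc,
          packetConst_mul_cpow hħ hσ₀ sigma_re_pos,
          completeSquare_packetExponent hħ.ne' hm hσ₀.ne', Complex.exp_add, coherent,
          mul_left_comm]

omit hħ in
theorem norm_coherent (ħ m t q p x : ℝ) :
    ‖coherent ħ σ₀ (sigmaAt m σ₀ t) (q, p) x‖
      = ‖1 / ((((2 * Real.pi * ħ) ^ (1 / 4 : ℝ) : ℝ) : ℂ) * sigmaAt m σ₀ t ^ (1 / 2 : ℂ))‖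
        * Real.exp (-((x - q) ^ 2 / (4 * ħ * normSq (sigmaAt m σ₀ t)))) := by
  have quadratic_eq : (-(1 / (4 * ħ * σ₀ * sigmaAt m σ₀ t)) * ((x - q : ℝ) : ℂ) ^ 2 : ℂ)
      = ((-((x - q) ^ 2 / (4 * ħ * σ₀)) : ℝ) : ℂ) * (sigmaAt m σ₀ t)⁻¹ := by
    push_cast
    ring
  have linear_eq : (I / ħ * p * ((x - q : ℝ) : ℂ) : ℂ)
      = ((p * (x - q) / ħ : ℝ) : ℂ) * I := by
    push_cast
    ring
  rw [coherent, norm_mul, norm_exp, quadratic_eq, linear_eq, add_re, re_ofReal_mul, re_ofReal_mul,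
    I_re, mul_zero, add_zero, inv_re, sigmaAt_re]
  congr 2
  field_simp

theorem norm_indicatorCLM_packet_le {m : ℝ} (hm : m ≠ 0) (q p t : ℝ) {s : Set ℝ}
    (hs : MeasurableSet s) (hx : ∀ x ∈ s, x * (q + p / m * t) ≤ 0) :
    ‖indicatorCLM hs (fourierInvL2 (packet hħ hσ₀ m q p t))‖
      ≤ Real.exp (-((q + p / m * t) ^ 2 / (4 * ħ * normSq (sigmaAt m σ₀ t)))) := by
  set decay := Real.exp (-((q + p / m * t) ^ 2 / (4 * ħ * normSq (sigmaAt m σ₀ t))))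
  -- Compare with the packet translated so as to be centred at the origin.
  rw [← mul_one decay, ← norm_packet hħ hσ₀ m (-(p / m * t)) p t,
    ← fourierInvL2.norm_map (packet _ _ _ (-_) _ _)]
  apply Lp.norm_le_mul_norm_of_ae_le_mul
  filter_upwards [coeFn_indicatorCLM hs (fourierInvL2 (packet hħ hσ₀ m q p t)),
    coeFn_fourierInvL2_packet hħ hσ₀ hm q p t,
    coeFn_fourierInvL2_packet hħ hσ₀ hm (-(p / m * t)) p t] with x hind hpacket hcentred
  rw [hind]
  by_cases hxs : x ∈ s
  · have exp_le : Real.exp (-((x - (q + p / m * t)) ^ 2 / (4 * ħ * normSq (sigmaAt m σ₀ t))))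
        ≤ decay * Real.exp (-(x ^ 2 / (4 * ħ * normSq (sigmaAt m σ₀ t)))) := by
      rw [← Real.exp_add, Real.exp_le_exp, ← neg_add, neg_le_neg_iff, ← add_div]
      gcongr
      · exact mul_nonneg (by positivity) (normSq_nonneg _)
      · nlinarith [hx x hxs]
    rw [Set.indicator_of_mem hxs, hpacket, hcentred, norm_mul, norm_mul, norm_coherent hσ₀,
      norm_coherent hσ₀, neg_add_cancel, sub_zero, mul_left_comm decay, mul_left_comm decay]
    gcongr
  · rw [Set.indicator_of_notMem hxs, norm_zero]
    positivity

end Packet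

/-! ### The transmission amplitude on a wave packet -/

theorem norm_one_div_one_add_mul_I_sub_le {x x₀ : ℝ} (hx₀ : x₀ ≠ 0) :
    ‖1 / (1 + (x : ℂ) * I) - 1 / (1 + (x₀ : ℂ) * I)‖
      ≤ |x - x₀| / |x₀| * (1 / ‖1 + (x : ℂ) * I‖) := by
  have denom_pos : 0 < ‖1 + (x : ℂ) * I‖ := one_pos.trans_le (one_le_norm_one_add_mul_I x)
  have numerator : 1 * (1 + (x₀ : ℂ) * I) - (1 + (x : ℂ) * I) * 1 = ((x₀ - x : ℝ) : ℂ) * I := by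
    push_cast
    ring
  have : 0 < |x₀| := abs_pos.2 hx₀
  rw [div_sub_div _ _ (one_add_mul_I_ne_zero x) (one_add_mul_I_ne_zero x₀), numerator, norm_div,
    norm_mul, norm_mul, norm_I, mul_one, norm_real, Real.norm_eq_abs, abs_sub_comm]
  calc |x - x₀| / (‖1 + (x : ℂ) * I‖ * ‖1 + (x₀ : ℂ) * I‖)
      ≤ |x - x₀| / (‖1 + (x : ℂ) * I‖ * |x₀|) := by
        gcongr
        exact abs_le_norm_one_add_mul_I x₀
    _ = |x - x₀| / |x₀| * (1 / ‖1 + (x : ℂ) * I‖) := by field_simp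

theorem one_div_norm_one_add_mul_I_le {x x₀ : ℝ} (hx₀ : x₀ ≠ 0) :
    1 / ‖1 + (x : ℂ) * I‖ ≤ 2 * (1 / |x₀|) + 64 * (|x - x₀| / |x₀|) ^ 6 := by
  have abs_x₀_pos : 0 < |x₀| := abs_pos.2 hx₀
  rcases le_total (|x₀| / 2) |x| with near | far
  · have half_le : |x₀| / 2 ≤ ‖1 + (x : ℂ) * I‖ := near.trans (abs_le_norm_one_add_mul_I x)
    calc 1 / ‖1 + (x : ℂ) * I‖ ≤ 1 / (|x₀| / 2) := by gcongr
      _ = 2 * (1 / |x₀|) := by field_simp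
      _ ≤ _ := le_add_of_nonneg_right (by positivity)
  · have half_le : 1 / 2 ≤ |x - x₀| / |x₀| := by
      rw [le_div_iff₀ abs_x₀_pos, abs_sub_comm]
      linarith [abs_sub_abs_le_abs_sub x₀ x]
    calc 1 / ‖1 + (x : ℂ) * I‖ ≤ 64 * (1 / 2) ^ 6 := by
          norm_num
          exact inv_le_one_of_one_le₀ (one_le_norm_one_add_mul_I x)
      _ ≤ 64 * (|x - x₀| / |x₀|) ^ 6 := by gcongr
      _ ≤ _ := le_add_of_nonneg_left (by positivity)

theorem cube_div_rpow_third {ħ m b p : ℝ} (hħ : 0 < ħ) (hm : 0 < m) :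
    (ħ / (m * |b * p|) ^ (1 / 3 : ℝ)) ^ 3 = 1 / |m * b / ħ ^ 2 * (p / ħ)| := by
  rw [div_pow, ← Real.rpow_natCast ((m * |b * p|) ^ _), ← Real.rpow_mul (by positivity),
    div_mul_div_comm, abs_div, mul_assoc m, abs_mul m, abs_of_pos hm,
    abs_of_pos (by positivity : 0 < ħ ^ 2 * ħ), one_div_div, Nat.cast_ofNat,
    one_div_mul_cancel three_ne_zero, Real.rpow_one, pow_succ ħ]

theorem norm_transmission_sub_le {ħ m p h : ℝ} {β : OnePoint ℝ} (hħ : 0 < ħ) (hm : 0 < m)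
    (hp : p ≠ 0) (hβ : β ≠ ((0 : ℝ) : OnePoint ℝ)) (hh : 0 ≤ h)
    (hsmall : β.elim 0 (fun b => ħ / (m * |b * p|) ^ (1 / 3 : ℝ)) ≤ h) (k : ℝ) :
    ‖transmission ħ m β k - transmission ħ m β (p / (2 * Real.pi * ħ))‖
      ≤ |2 * Real.pi * k - p / ħ| / |p / ħ|
        * (2 * h ^ 3 + 64 * (|2 * Real.pi * k - p / ħ| / |p / ħ|) ^ 6) := by
  induction β using OnePoint.rec with
  | infty =>
    simp only [transmission, OnePoint.elim_infty, sub_self, norm_zero]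
    positivity
  | coe b =>
    change ħ / (m * |b * p|) ^ (1 / 3 : ℝ) ≤ h at hsmall
    change ‖1 / (1 + ((m * b / ħ ^ 2 * (2 * Real.pi * k) : ℝ) : ℂ) * I)
      - 1 / (1 + ((m * b / ħ ^ 2 * (2 * Real.pi * (p / (2 * Real.pi * ħ))) : ℝ) : ℂ) * I)‖ ≤ _
    have hb : b ≠ 0 := fun h => hβ (congrArg _ h)
    have a_ne : m * b / ħ ^ 2 ≠ 0 := by positivity
    have x₀_ne : m * b / ħ ^ 2 * (p / ħ) ≠ 0 := by positivity
    have wavenumber : 2 * Real.pi * (p / (2 * Real.pi * ħ)) = p / ħ := by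
      field_simp
    have ratio_eq : |m * b / ħ ^ 2 * (2 * Real.pi * k) - m * b / ħ ^ 2 * (p / ħ)|
        / |m * b / ħ ^ 2 * (p / ħ)| = |2 * Real.pi * k - p / ħ| / |p / ħ| := by
      rw [← mul_sub, abs_mul, abs_mul, mul_div_mul_left _ _ (abs_ne_zero.2 a_ne)]
    have one_div_le : 1 / |m * b / ħ ^ 2 * (p / ħ)| ≤ h ^ 3 := by
      rw [← cube_div_rpow_third hħ hm]
      gcongr
    rw [wavenumber, ← ratio_eq]
    refine (norm_one_div_one_add_mul_I_sub_le x₀_ne).trans ?_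
    gcongr
    exact (one_div_norm_one_add_mul_I_le x₀_ne).trans (by gcongr)

theorem norm_le_of_ae_le_mul_add_mul {α E F G : Type*} [MeasurableSpace α] {μ : Measure α}
    [NormedAddCommGroup E] [NormedAddCommGroup F] [NormedAddCommGroup G] {p : ENNReal}
    [Fact (1 ≤ p)] {f : Lp E p μ} {g : Lp F p μ} {h : Lp G p μ} {a b : ℝ} (ha : 0 ≤ a) (hb : 0 ≤ b)
    (hf : ∀ᵐ x ∂μ, ‖f x‖ ≤ a * ‖g x‖ + b * ‖h x‖) : ‖f‖ ≤ a * ‖g‖ + b * ‖h‖ := by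
  have hg := (Lp.memLp g).norm
  have hh := (Lp.memLp h).norm
  calc ‖f‖ ≤ ‖a • hg.toLp _ + b • hh.toLp _‖ := by
        apply Lp.norm_le_norm_of_ae_le
        filter_upwards [hf, hg.coeFn_toLp, hh.coeFn_toLp, Lp.coeFn_smul a (hg.toLp _),
          Lp.coeFn_smul b (hh.toLp _), Lp.coeFn_add (a • hg.toLp _) (b • hh.toLp _)]
          with x hfx hgx hhx hag hbh hsum
        rw [hsum, Pi.add_apply, hag, hbh, Pi.smul_apply, Pi.smul_apply, hgx, hhx]
        exact hfx.trans (le_abs_self _)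
    _ ≤ ‖a • hg.toLp _‖ + ‖b • hh.toLp _‖ := norm_add_le _ _
    _ = a * ‖g‖ + b * ‖h‖ := by
        rw [norm_smul, norm_smul, Lp.norm_toLp, Lp.norm_toLp, eLpNorm_norm, eLpNorm_norm,
          ← Lp.norm_def, ← Lp.norm_def, Real.norm_of_nonneg ha, Real.norm_of_nonneg hb]

theorem norm_transmit_packet_sub_le_moments {ħ m σ₀ p h : ℝ} {β : OnePoint ℝ} (hħ : 0 < ħ)
    (hm : 0 < m) (hσ₀ : 0 < σ₀) (hp : p ≠ 0) (hβ : β ≠ ((0 : ℝ) : OnePoint ℝ)) (hh : 0 ≤ h)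
    (hsmall : β.elim 0 (fun b => ħ / (m * |b * p|) ^ (1 / 3 : ℝ)) ≤ h) (q t : ℝ) :
    ‖transmit ħ m β (packet hħ hσ₀ m q p t)
      - transmission ħ m β (p / (2 * Real.pi * ħ)) • packet hħ hσ₀ m q p t‖
      ≤ 2 * h ^ 3 / |p / ħ| * (momentConst 1 / (√ħ * σ₀) ^ 1)
        + 64 / |p / ħ| ^ 7 * (momentConst 7 / (√ħ * σ₀) ^ 7) := by
  rw [← norm_shift_pow_mul_packetFourier hħ hσ₀ m q p t 1,
    ← norm_shift_pow_mul_packetFourier hħ hσ₀ m q p t 7]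
  have moment₁ := memLp_shift_pow_mul_packetFourier hħ hσ₀ m q p t 1
  have moment₇ := memLp_shift_pow_mul_packetFourier hħ hσ₀ m q p t 7
  set G := packet hħ hσ₀ m q p t
  set T₀ := transmission ħ m β (p / (2 * Real.pi * ħ))
  refine norm_le_of_ae_le_mul_add_mul (by positivity) (by positivity) ?_
  filter_upwards [moment₁.coeFn_toLp, moment₇.coeFn_toLp, coeFn_packet hħ hσ₀ m q p t,
    coeFn_transmit ħ m β G, Lp.coeFn_smul T₀ G, Lp.coeFn_sub (transmit ħ m β G) (T₀ • G)]
    with k h₁ h₇ hG hT hsmul hsub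
  rw [hsub, Pi.sub_apply, hT, hsmul, Pi.smul_apply, smul_eq_mul, ← sub_mul, norm_mul, h₁, h₇, hG,
    norm_mul, norm_mul, norm_pow, norm_pow, norm_real, Real.norm_eq_abs, pow_one, ← mul_assoc,
    ← mul_assoc, ← add_mul]
  gcongr
  refine (norm_transmission_sub_le hħ hm hp hβ hh hsmall k).trans_eq ?_
  ring

theorem norm_transmit_packet_sub_le {ħ m σ₀ p h : ℝ} {β : OnePoint ℝ} (hħ : 0 < ħ) (hm : 0 < m)
    (hσ₀ : 0 < σ₀) (hp : p ≠ 0) (hβ : β ≠ ((0 : ℝ) : OnePoint ℝ)) (hh : 0 < h)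
    (hsmall : β.elim 0 (fun b => ħ / (m * |b * p|) ^ (1 / 3 : ℝ)) ≤ h)
    (hmom : ħ / (σ₀ ^ 2 * p ^ 2) ≤ h) (q t : ℝ) :
    ‖transmit ħ m β (packet hħ hσ₀ m q p t)
      - transmission ħ m β (p / (2 * Real.pi * ħ)) • packet hħ hσ₀ m q p t‖
      ≤ (2 * momentConst 1 + 64 * momentConst 7) * h ^ (7 / 2 : ℝ) := by
  have := momentConst_nonneg 1
  have := momentConst_nonneg 7
  have rpow_eq : h ^ (7 / 2 : ℝ) = h ^ 3 * √h := by
    rw [Real.sqrt_eq_rpow, ← Real.rpow_natCast, ← Real.rpow_add hh]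
    norm_num
  set r := 1 / (|p / ħ| * (√ħ * σ₀)) with r_def
  have r_le : r ≤ √h := by
    refine Real.le_sqrt_of_sq_le (le_trans (le_of_eq ?_) hmom)
    rw [r_def, div_pow, mul_pow, mul_pow, sq_abs, Real.sq_sqrt hħ.le]
    field_simp
  have pow_seven_le : r ^ 7 ≤ h ^ 3 * √h := by
    calc r ^ 7 ≤ √h ^ 7 := by gcongr
      _ = (√h ^ 2) ^ 3 * √h := by ring
      _ = h ^ 3 * √h := by rw [Real.sq_sqrt hh.le]
  calc _ ≤ 2 * h ^ 3 / |p / ħ| * (momentConst 1 / (√ħ * σ₀) ^ 1)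
        + 64 / |p / ħ| ^ 7 * (momentConst 7 / (√ħ * σ₀) ^ 7) :=
        norm_transmit_packet_sub_le_moments hħ hm hσ₀ hp hβ hh.le hsmall q t
    _ = 2 * momentConst 1 * (h ^ 3 * r) + 64 * momentConst 7 * r ^ 7 := by
        rw [r_def]
        field_simp
    _ ≤ 2 * momentConst 1 * (h ^ 3 * √h) + 64 * momentConst 7 * (h ^ 3 * √h) := by gcongr
    _ = (2 * momentConst 1 + 64 * momentConst 7) * h ^ (7 / 2 : ℝ) := by rw [rpow_eq, add_mul]

section Scatter

variable {ħ m δ : ℝ} {β : OnePoint ℝ} {g : L2} {T : ℂ}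

theorem scatter_sub_fourierInvL2 (ħ m : ℝ) (β : OnePoint ℝ) (g : L2) :
    scatter ħ m β g - fourierInvL2 g
      = parity (cutNeg (fourierInvL2 (g - transmit ħ m β g)))
        - cutNeg (fourierInvL2 (g - transmit ħ m β g)) := by
  nth_rw 1 [← cutPos_add_cutNeg (fourierInvL2 g)]
  rw [scatter_apply, cutPos_parity, _root_.map_sub fourierInvL2, _root_.map_sub cutNeg]
  abel

theorem fourierInvL2_sub_transmit (ħ m : ℝ) (β : OnePoint ℝ) (g : L2) (T : ℂ) :
    fourierInvL2 (g - transmit ħ m β g)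
      = (1 - T) • fourierInvL2 g - fourierInvL2 (transmit ħ m β g - T • g) := by
  rw [_root_.map_sub, _root_.map_sub, LinearIsometryEquiv.map_smul]
  module

theorem norm_cutNeg_fourierInvL2_le (hδ : ‖g‖ ≤ δ) : ‖cutNeg (fourierInvL2 g)‖ ≤ δ :=
  (norm_cutNeg_le _).trans (hδ.trans' (fourierInvL2.norm_map g).le)

theorem norm_scatter_sub_le_of_incoming (hT : ‖1 - T‖ ≤ 2) (hδ : ‖transmit ħ m β g - T • g‖ ≤ δ) :
    ‖scatter ħ m β g - fourierInvL2 g‖ ≤ 4 * ‖cutNeg (fourierInvL2 g)‖ + 2 * δ := by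
  have reflected_le : ‖cutNeg (fourierInvL2 (g - transmit ħ m β g))‖
      ≤ 2 * ‖cutNeg (fourierInvL2 g)‖ + δ := by
    rw [fourierInvL2_sub_transmit ħ m β g T, _root_.map_sub, _root_.map_smul]
    refine (norm_sub_le _ _).trans (add_le_add ?_ (norm_cutNeg_fourierInvL2_le hδ))
    rw [norm_smul]
    gcongr
  rw [scatter_sub_fourierInvL2]
  refine (norm_sub_le _ _).trans ?_
  rw [LinearIsometryEquiv.norm_map]
  linarith

theorem norm_scatter_sub_le_of_outgoing (hT : ‖1 - T‖ ≤ 2) (hδ : ‖transmit ħ m β g - T • g‖ ≤ δ) :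
    ‖scatter ħ m β g - (fourierInvL2 g - (1 - T) • (fourierInvL2 g - parity (fourierInvL2 g)))‖
      ≤ 4 * ‖cutPos (fourierInvL2 g)‖ + 2 * δ := by
  set E := cutNeg (fourierInvL2 (transmit ħ m β g - T • g))
  have E_le : ‖E‖ ≤ δ := norm_cutNeg_fourierInvL2_le hδ
  have decomposition : scatter ħ m β g
        - (fourierInvL2 g - (1 - T) • (fourierInvL2 g - parity (fourierInvL2 g)))
      = (1 - T) • (cutPos (fourierInvL2 g) - parity (cutPos (fourierInvL2 g)))
        - (parity E - E) := by
    rw [← sub_add, scatter_sub_fourierInvL2, fourierInvL2_sub_transmit ħ m β g T, _root_.map_sub,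
      _root_.map_smul, _root_.map_sub, LinearIsometryEquiv.map_smul,
      eq_sub_of_add_eq (cutPos_add_cutNeg (fourierInvL2 g)), _root_.map_sub parity]
    module
  have reflected_le : ‖(1 - T) • (cutPos (fourierInvL2 g) - parity (cutPos (fourierInvL2 g)))‖
      ≤ 2 * (‖cutPos (fourierInvL2 g)‖ + ‖cutPos (fourierInvL2 g)‖) := by
    rw [norm_smul]
    gcongr
    exact (norm_sub_le _ _).trans_eq (by rw [LinearIsometryEquiv.norm_map])
  have error_le : ‖parity E - E‖ ≤ δ + δ :=
    (norm_sub_le _ _).trans (by rw [LinearIsometryEquiv.norm_map]; exact add_le_add E_le E_le)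
  rw [decomposition]
  linarith [norm_sub_le
    ((1 - T) • (cutPos (fourierInvL2 g) - parity (cutPos (fourierInvL2 g)))) (parity E - E)]

end Scatter

/-! ### Gaussian tails away from the collision time -/

theorem mul_abs_log_le {h : ℝ} (h0 : 0 < h) (h1 : h ≤ 1) : h * |Real.log h| ≤ 2 * √h := by
  have log_inv_le := Real.log_le_sub_one_of_pos (inv_pos.2 (Real.sqrt_pos.2 h0))
  rw [Real.log_inv, Real.log_sqrt h0.le] at log_inv_le
  have abs_log_le : |Real.log h| ≤ 2 * (√h)⁻¹ := by
    rw [abs_of_nonpos (Real.log_nonpos h0.le h1)]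
    linarith
  calc h * |Real.log h| ≤ h * (2 * (√h)⁻¹) := by gcongr
    _ = 2 * √h := by rw [mul_left_comm, ← div_eq_mul_inv, Real.div_sqrt]

theorem mul_mul_abs_log_le_one_div_sixteen {h N : ℝ} (h0 : 0 < h) (h1 : h < 1 / 20000)
    (hN : N ≤ 7 / 2) : N * h * |Real.log h| ≤ 1 / 16 := by
  have sqrt_le : √h ≤ 1 / 112 := by
    rw [Real.sqrt_le_left (by norm_num)]
    linarith
  have mul_log_le : h * |Real.log h| ≤ 2 * (1 / 112) :=
    (mul_abs_log_le h0 (by linarith)).trans (by gcongr)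
  calc N * h * |Real.log h| = N * (h * |Real.log h|) := mul_assoc _ _ _
    _ ≤ 7 / 2 * (2 * (1 / 112)) := by gcongr
    _ = 1 / 16 := by norm_num

theorem mul_normSq_sigmaAt_le {ħ m σ₀ q p h : ℝ} (hħ : 0 < ħ) (hm : m ≠ 0) (hσ₀ : σ₀ ≠ 0)
    (hq : q ≠ 0) (hp : p ≠ 0) (hpos : ħ * σ₀ ^ 2 / q ^ 2 ≤ h) (hmom : ħ / (σ₀ ^ 2 * p ^ 2) ≤ h)
    (t : ℝ) :
    ħ * normSq (sigmaAt m σ₀ t) ≤ h * (3 / 2 * q ^ 2 + 1 / 2 * (q + p / m * t) ^ 2) := by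
  set d := q + p / m * t with d_def
  have h_nonneg : 0 ≤ h := le_trans (by positivity) hpos
  have half_sq_le : (d - q) ^ 2 / 4 ≤ 1 / 2 * q ^ 2 + 1 / 2 * d ^ 2 := by
    linarith [sq_nonneg (d + q)]
  calc ħ * normSq (sigmaAt m σ₀ t)
      = ħ * σ₀ ^ 2 / q ^ 2 * q ^ 2 + ħ / (σ₀ ^ 2 * p ^ 2) * ((d - q) ^ 2 / 4) := by
        rw [normSq_apply, sigmaAt_re, sigmaAt_im, d_def]
        field_simp
        ring
    _ ≤ h * q ^ 2 + h * (1 / 2 * q ^ 2 + 1 / 2 * d ^ 2) := by gcongr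
    _ = h * (3 / 2 * q ^ 2 + 1 / 2 * d ^ 2) := by ring

theorem exp_neg_div_normSq_sigmaAt_le_rpow {ħ m σ₀ q p t h N : ℝ} (hħ : 0 < ħ) (hm : m ≠ 0)
    (hσ₀ : σ₀ ≠ 0) (hq : q ≠ 0) (hp : p ≠ 0) (h0 : 0 < h) (h1 : h ≤ 1) (hN : 0 ≤ N)
    (hpos : ħ * σ₀ ^ 2 / q ^ 2 ≤ h) (hmom : ħ / (σ₀ ^ 2 * p ^ 2) ≤ h)
    (hw : N * h * |Real.log h| ≤ 1 / 16)
    (hd : 16 * q ^ 2 * (N * h * |Real.log h|) ≤ (q + p / m * t) ^ 2) :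
    Real.exp (-((q + p / m * t) ^ 2 / (4 * ħ * normSq (sigmaAt m σ₀ t)))) ≤ h ^ N := by
  have normSq_pos : 0 < normSq (sigmaAt m σ₀ t) := normSq_pos.2 fun h =>
    hσ₀ (by rw [← sigmaAt_re m σ₀ t, h, zero_re])
  set d := q + p / m * t
  have exponent_ge : N * |Real.log h| ≤ d ^ 2 / (4 * ħ * normSq (sigmaAt m σ₀ t)) := by
    rw [le_div_iff₀ (by positivity)]
    calc N * |Real.log h| * (4 * ħ * normSq (sigmaAt m σ₀ t))
        = 4 * (N * |Real.log h|) * (ħ * normSq (sigmaAt m σ₀ t)) := by ring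
      _ ≤ 4 * (N * |Real.log h|) * (h * (3 / 2 * q ^ 2 + 1 / 2 * d ^ 2)) := by
          exact mul_le_mul_of_nonneg_left (mul_normSq_sigmaAt_le hħ hm hσ₀ hq hp hpos hmom t)
            (by positivity)
      _ = 6 / 16 * (16 * q ^ 2 * (N * h * |Real.log h|)) + 2 * (N * h * |Real.log h|) * d ^ 2 := by
          ring
      _ ≤ 6 / 16 * d ^ 2 + 2 * (1 / 16) * d ^ 2 := by gcongr
      _ ≤ d ^ 2 := by linarith [sq_nonneg d]
  rw [abs_of_nonpos (Real.log_nonpos h0.le h1)] at exponent_ge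
  rw [Real.rpow_def_of_pos h0, Real.exp_le_exp]
  linarith

theorem sq_le_of_le_abs_sub_collisionTime {m q p t w : ℝ} (hm : m ≠ 0) (hp : p ≠ 0) (hw : 0 ≤ w)
    (h : 4 * |collisionTime m (q, p)| * √w ≤ |t - collisionTime m (q, p)|) :
    16 * q ^ 2 * w ≤ (q + p / m * t) ^ 2 := by
  have position_eq : q + p / m * t = (t - collisionTime m (q, p)) * (p / m) := by
    rw [collisionTime]
    field_simp
    ring
  have start_eq : collisionTime m (q, p) * (p / m) = -q := by
    rw [collisionTime]
    field_simp
  calc 16 * q ^ 2 * w = (4 * |collisionTime m (q, p)| * √w) ^ 2 * (p / m) ^ 2 := by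
        rw [← neg_sq q, ← start_eq, mul_pow, mul_pow, mul_pow 4, Real.sq_sqrt hw, sq_abs]
        ring
    _ ≤ |t - collisionTime m (q, p)| ^ 2 * (p / m) ^ 2 := by gcongr
    _ = (q + p / m * t) ^ 2 := by rw [sq_abs, position_eq, mul_pow]

/-! ### The semiclassical approximation before and after the collision -/

theorem coherent_neg (ħ σ₀ : ℝ) (σ : ℂ) (ξ : ℝ × ℝ) (x : ℝ) :
    coherent ħ σ₀ σ (-ξ) x = coherent ħ σ₀ σ ξ (-x) := by
  simp only [coherent, Prod.fst_neg, Prod.snd_neg]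
  congr 2
  push_cast
  ring

theorem fourierInvL2_packet_zero {ħ m σ₀ : ℝ} (hħ : 0 < ħ) (hσ₀ : 0 < σ₀) (hm : m ≠ 0) (q p : ℝ) :
    fourierInvL2 (packet hħ hσ₀ m q p 0) = coherentVec hħ hσ₀ (q, p) := by
  apply Lp.ext
  filter_upwards [coeFn_fourierInvL2_packet hħ hσ₀ hm q p 0,
    (memLp_coherent hħ hσ₀ (q, p)).coeFn_toLp] with x hpacket hcoherent
  rw [coherentVec, hpacket, hcoherent]
  simp [sigmaAt]

theorem sign_mul_abs_of_mul_neg {p t : ℝ} (hpt : p * t < 0) : Real.sign t * |p| = -p := by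
  rcases mul_neg_iff.1 hpt with ⟨hp, ht⟩ | ⟨hp, ht⟩
  · rw [Real.sign_of_neg ht, abs_of_pos hp, neg_one_mul]
  · rw [Real.sign_of_pos ht, abs_of_neg hp, one_mul]

theorem one_div_one_sub_I_div {x : ℝ} (hx : x ≠ 0) :
    1 / (1 - I / x) = 1 - 1 / (1 + (x : ℂ) * I) := by
  have denom_ne := one_add_mul_I_ne_zero x
  have : (x : ℂ) ≠ 0 := ofReal_ne_zero.2 hx
  have mul_eq : (1 - I / x : ℂ) * (x * I) = 1 + x * I := by
    field_simp
    linear_combination (-1 : ℂ) * I_sq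
  have factor_ne : (1 - I / x : ℂ) ≠ 0 := fun h => denom_ne (by rw [← mul_eq, h, zero_mul])
  rw [one_sub_div denom_ne, div_eq_div_iff factor_ne denom_ne]
  linear_combination -mul_eq

theorem reflectionCoeff_eq_one_sub_transmission {ħ m p t : ℝ} {β : OnePoint ℝ} (hħ : ħ ≠ 0)
    (hm : m ≠ 0) (hβ : β ≠ ((0 : ℝ) : OnePoint ℝ)) (hpt : p * t < 0) :
    reflectionCoeff m (β.map fun b => -(2 * b / ħ ^ 3)) t p
      = 1 - transmission ħ m β (p / (2 * Real.pi * ħ)) := by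
  induction β using OnePoint.rec with
  | infty =>
    change (1 : ℂ) = 1 - 0
    rw [sub_zero]
  | coe b =>
    have hb : b ≠ 0 := fun h => hβ (congrArg _ h)
    have hp : p ≠ 0 := left_ne_zero_of_mul hpt.ne
    change 1 / (1 - (Real.sign t : ℂ) * (2 * I * |p| / (m * ((-(2 * b / ħ ^ 3) : ℝ) * p ^ 2))))
      = 1 - 1 / (1 + ((m * b / ħ ^ 2 * (2 * Real.pi * (p / (2 * Real.pi * ħ))) : ℝ) : ℂ) * I)
    have wave_eq : m * b / ħ ^ 2 * (2 * Real.pi * (p / (2 * Real.pi * ħ)))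
        = m * b * p / ħ ^ 3 := by
      field_simp
    have phase_eq : (Real.sign t : ℂ) * (2 * I * |p| / (m * ((-(2 * b / ħ ^ 3) : ℝ) * p ^ 2)))
        = I / ((m * b * p / ħ ^ 3 : ℝ) : ℂ) := by
      have : (ħ : ℂ) ≠ 0 := ofReal_ne_zero.2 hħ
      have : (m : ℂ) ≠ 0 := ofReal_ne_zero.2 hm
      have : (b : ℂ) ≠ 0 := ofReal_ne_zero.2 hb
      have : (p : ℂ) ≠ 0 := ofReal_ne_zero.2 hp
      rw [← mul_div_assoc, mul_left_comm, ← ofReal_mul, sign_mul_abs_of_mul_neg hpt]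
      push_cast
      field_simp
    rw [wave_eq, phase_eq, one_div_one_sub_I_div (by positivity)]

theorem classicalApprox_of_pos {m q p t : ℝ} (ħ σ₀ : ℝ) (β : OnePoint ℝ) (hq : 0 < q)
    (hx : 0 < q + p / m * t) (x : ℝ) :
    classicalApprox ħ m σ₀ β t (q, p) x = cexp (I / ħ * ((p ^ 2 * t / (2 * m) : ℝ) : ℂ)) *
      coherent ħ σ₀ (sigmaAt m σ₀ t) (q + p / m * t, p) x := by
  have not_collided : heaviside (-(t * q * p)) * heaviside (|p * t| / m - |q|) = 0 := by
    by_cases h : 0 < -(t * q * p)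
    · have hpt : p * t < 0 := by
        by_contra hc
        nlinarith [mul_nonneg hq.le (not_lt.1 hc)]
      have not_reached : ¬0 < |p * t| / m - |q| := by
        rw [abs_of_neg hpt, abs_of_pos hq, neg_div, mul_div_right_comm]
        linarith
      rw [heaviside, heaviside, if_neg not_reached, mul_zero]
    · rw [heaviside, if_neg h, zero_mul]
  simp only [classicalApprox, classicalGroup, not_collided, zero_mul, sub_zero, freeFlow]

theorem classicalApprox_of_neg {ħ m q p t : ℝ} {β : OnePoint ℝ} (hħ : ħ ≠ 0) (hm : 0 < m)
    (σ₀ : ℝ) (hβ : β ≠ ((0 : ℝ) : OnePoint ℝ)) (hq : 0 < q) (hx : q + p / m * t < 0) (x : ℝ) :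
    classicalApprox ħ m σ₀ β t (q, p) x = cexp (I / ħ * ((p ^ 2 * t / (2 * m) : ℝ) : ℂ)) *
      (coherent ħ σ₀ (sigmaAt m σ₀ t) (q + p / m * t, p) x
        - (1 - transmission ħ m β (p / (2 * Real.pi * ħ))) *
          (coherent ħ σ₀ (sigmaAt m σ₀ t) (q + p / m * t, p) x
            - coherent ħ σ₀ (sigmaAt m σ₀ t) (q + p / m * t, p) (-x))) := by
  rw [← mul_div_right_comm] at hx
  have hpt : p * t < 0 := by
    by_contra hc
    linarith [div_nonneg (not_lt.1 hc) hm.le]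
  have moves_to_origin : 0 < -(t * q * p) := by nlinarith
  have reached : 0 < |p * t| / m - |q| := by
    rw [abs_of_neg hpt, abs_of_pos hq, neg_div]
    linarith
  simp only [classicalApprox, classicalGroup, heaviside, if_pos moves_to_origin, if_pos reached,
    one_mul, freeFlow, oddPart, coherent_neg,
    reflectionCoeff_eq_one_sub_transmission hħ hm.ne' hβ hpt]

section Parity

variable {ħ m : ℝ} {β : OnePoint ℝ}

theorem hamiltonian_parity {ψ χ : L2} (h : Hamiltonian ħ m β ψ χ) :
    Hamiltonian ħ m β (parity ψ) (parity χ) := by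
  obtain ⟨w, up, um, vp, vm, hasSecondDeriv, ⟨deriv_eq, jump⟩, rfl⟩ := h
  refine ⟨parity w, um, up, -vm, -vp, hasSecondDeriv.comp_parity, ⟨by rw [deriv_eq], ?_⟩,
    _root_.map_smul _ _ _⟩
  rw [← deriv_eq]
  induction β using OnePoint.rec with
  | infty => exact neg_eq_zero.2 jump
  | coe b =>
    change up - um = _ * vp at jump
    change um - up = _ * -vp
    rw [mul_neg, ← jump, neg_sub]

theorem hamiltonian_parity_iff {ψ χ : L2} :
    Hamiltonian ħ m β (parity ψ) (parity χ) ↔ Hamiltonian ħ m β ψ χ :=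
  ⟨fun h => by simpa only [parity_parity] using hamiltonian_parity h, hamiltonian_parity⟩

theorem hasDerivAt_parity_iff {f : ℝ → L2} {f' : L2} {t : ℝ} :
    HasDerivAt (fun t => parity (f t)) (parity f') t ↔ HasDerivAt f f' t := by
  have comp_parity {g : ℝ → L2} {g' : L2} (hg : HasDerivAt g g' t) :
      HasDerivAt (fun t => parity (g t)) (parity g') t :=
    ((parity.toContinuousLinearEquiv.toContinuousLinearMap).restrictScalars
      ℝ).hasFDerivAt.comp_hasDerivAt t hg
  exact ⟨fun h => by simpa only [parity_parity] using comp_parity h, comp_parity⟩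

variable {U : ℝ → L2 ≃ₗᵢ[ℂ] L2} (hU : IsUnitaryGroupOf ħ (Hamiltonian ħ m β) U)

include hU

theorem IsUnitaryGroupOf.conj_parity :
    IsUnitaryGroupOf ħ (Hamiltonian ħ m β) fun t => (parity.trans (U t)).trans parity where
  map_zero ψ := by
    change parity (U 0 (parity ψ)) = ψ
    rw [hU.map_zero, parity_parity]
  map_add s t ψ := by
    change parity (U (s + t) (parity ψ)) = parity (U s (parity (parity (U t (parity ψ)))))
    rw [hU.map_add, parity_parity]
  continuous ψ := parity.continuous.comp (hU.continuous (parity ψ))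
  generator ψ χ := by
    rw [← hamiltonian_parity_iff, hU.generator, ← hasDerivAt_parity_iff,
      LinearIsometryEquiv.map_smul, parity_parity]
    rfl

theorem unitaryGroup_parity (hħ : 0 < ħ) (hm : 0 < m) (t : ℝ) (ψ : L2) :
    U t (parity ψ) = parity (U t ψ) := by
  have eq_conj := congrFun (hU.eq_of_dense hU.conj_parity (dense_domain_hamiltonian hħ hm β)) t
  have conj_eq : U t ψ = parity (U t (parity ψ)) := DFunLike.congr_fun eq_conj ψ
  rw [conj_eq, parity_parity]

end Parity

theorem parity_coherentVec {ħ σ₀ : ℝ} (hħ : 0 < ħ) (hσ₀ : 0 < σ₀) (ξ : ℝ × ℝ) :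
    parity (coherentVec hħ hσ₀ ξ) = coherentVec hħ hσ₀ (-ξ) := by
  apply Lp.ext
  filter_upwards [coeFn_parity (coherentVec hħ hσ₀ ξ),
    ae_comp_neg (memLp_coherent hħ hσ₀ ξ).coeFn_toLp,
    (memLp_coherent hħ hσ₀ (-ξ)).coeFn_toLp] with x hparity hneg hcoherent
  rw [hparity, coherentVec, hneg, coherentVec, hcoherent, coherent_neg]

theorem classicalApprox_neg (ħ m σ₀ : ℝ) (β : OnePoint ℝ) (t : ℝ) (ξ : ℝ × ℝ) (x : ℝ) :
    classicalApprox ħ m σ₀ β t (-ξ) x = classicalApprox ħ m σ₀ β t ξ (-x) := by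
  have reflectionCoeff_neg (b : OnePoint ℝ) :
      reflectionCoeff m b t (-ξ.2) = reflectionCoeff m b t ξ.2 := by
    simp only [reflectionCoeff, abs_neg, ofReal_neg, neg_sq]
  have flow_neg : (-ξ.1 + -ξ.2 / m * t, -ξ.2) = -(ξ.1 + ξ.2 / m * t, ξ.2) :=
    Prod.ext (by simp only [Prod.fst_neg]; ring) rfl
  simp only [classicalApprox, classicalGroup, freeFlow, oddPart, Prod.fst_neg, Prod.snd_neg, neg_sq,
    reflectionCoeff_neg, flow_neg, coherent_neg, neg_mul, abs_neg, mul_neg, neg_neg]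

theorem smallParam_neg (ħ m σ₀ : ℝ) (β : OnePoint ℝ) (ξ : ℝ × ℝ) :
    smallParam ħ m σ₀ β (-ξ) = smallParam ħ m σ₀ β ξ := by
  simp only [smallParam, Prod.fst_neg, Prod.snd_neg, neg_sq, mul_neg, abs_neg]

theorem collisionTime_neg (m : ℝ) (ξ : ℝ × ℝ) : collisionTime m (-ξ) = collisionTime m ξ := by
  simp only [collisionTime, Prod.fst_neg, Prod.snd_neg, mul_neg, neg_div_neg_eq]

/-! ### The error estimate -/

/-- Error constant of the approximation of a scattered wave packet by its incoming or outgoing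
part. -/
def errorConst : ℝ := 4 + 2 * (2 * momentConst 1 + 64 * momentConst 7)

theorem errorConst_pos : 0 < errorConst := by
  have := momentConst_nonneg 1
  have := momentConst_nonneg 7
  rw [errorConst]
  positivity

theorem smallParam_pos {ħ σ₀ q : ℝ} (hħ : 0 < ħ) (hσ₀ : σ₀ ≠ 0) (hq : q ≠ 0) (m : ℝ)
    (β : OnePoint ℝ) (p : ℝ) : 0 < smallParam ħ m σ₀ β (q, p) :=
  lt_max_of_lt_left (lt_max_of_lt_left (by positivity))

section WavePacket

variable {ħ m σ₀ q p t N : ℝ} {β : OnePoint ℝ}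

theorem norm_indicatorCLM_packet_le_rpow (hħ : 0 < ħ) (hm : m ≠ 0) (hσ₀ : 0 < σ₀) (hq : q ≠ 0)
    (hp : p ≠ 0) (hN0 : 0 ≤ N) (hN : N ≤ 7 / 2) (hs : smallParam ħ m σ₀ β (q, p) < 1 / 20000)
    (hd : 16 * q ^ 2 * (N * smallParam ħ m σ₀ β (q, p) * |Real.log (smallParam ħ m σ₀ β (q, p))|)
      ≤ (q + p / m * t) ^ 2)
    {s : Set ℝ} (measurableSet : MeasurableSet s) (hx : ∀ x ∈ s, x * (q + p / m * t) ≤ 0) :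
    ‖indicatorCLM measurableSet (fourierInvL2 (packet hħ hσ₀ m q p t))‖
      ≤ smallParam ħ m σ₀ β (q, p) ^ N := by
  have h0 := smallParam_pos hħ hσ₀.ne' hq m β p
  exact (norm_indicatorCLM_packet_le hħ hσ₀ hm q p t measurableSet hx).trans
    (exp_neg_div_normSq_sigmaAt_le_rpow hħ hm hσ₀.ne' hq hp h0 (by linarith) hN0
      ((le_max_left _ _).trans (le_max_left _ _)) ((le_max_right _ _).trans (le_max_left _ _))
      (mul_mul_abs_log_le_one_div_sixteen h0 hs hN) hd)

theorem norm_transmit_packet_sub_le_rpow (hħ : 0 < ħ) (hm : 0 < m) (hσ₀ : 0 < σ₀) (hq : q ≠ 0)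
    (hp : p ≠ 0) (hβ : β ≠ ((0 : ℝ) : OnePoint ℝ)) (hN : N ≤ 7 / 2)
    (hs : smallParam ħ m σ₀ β (q, p) ≤ 1) (t : ℝ) :
    ‖transmit ħ m β (packet hħ hσ₀ m q p t)
      - transmission ħ m β (p / (2 * Real.pi * ħ)) • packet hħ hσ₀ m q p t‖
      ≤ (2 * momentConst 1 + 64 * momentConst 7) * smallParam ħ m σ₀ β (q, p) ^ N := by
  have h0 := smallParam_pos hħ hσ₀.ne' hq m β p
  have := momentConst_nonneg 1
  have := momentConst_nonneg 7
  exact (norm_transmit_packet_sub_le hħ hm hσ₀ hp hβ h0 (le_max_right _ _)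
    ((le_max_right _ _).trans (le_max_left _ _)) q t).trans
    (mul_le_mul_of_nonneg_left (Real.rpow_le_rpow_of_exponent_ge h0 hs hN) (by positivity))

theorem norm_one_sub_transmission_le (ħ m : ℝ) (β : OnePoint ℝ) (k : ℝ) :
    ‖1 - transmission ħ m β k‖ ≤ 2 := by
  calc ‖1 - transmission ħ m β k‖ ≤ ‖(1 : ℂ)‖ + ‖transmission ħ m β k‖ := norm_sub_le _ _
    _ ≤ 1 + 1 := by
        rw [norm_one]
        gcongr
        exact norm_transmission_le ħ m β k
    _ = 2 := one_add_one_eq_two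

theorem norm_scatter_packet_sub_le_of_nonneg (hħ : 0 < ħ) (hm : 0 < m) (hσ₀ : 0 < σ₀) (hq : q ≠ 0)
    (hp : p ≠ 0) (hβ : β ≠ ((0 : ℝ) : OnePoint ℝ)) (hN0 : 0 ≤ N) (hN : N ≤ 7 / 2)
    (hs : smallParam ħ m σ₀ β (q, p) < 1 / 20000)
    (hd : 16 * q ^ 2 * (N * smallParam ħ m σ₀ β (q, p) * |Real.log (smallParam ħ m σ₀ β (q, p))|)
      ≤ (q + p / m * t) ^ 2)
    (hx : 0 ≤ q + p / m * t) :
    ‖scatter ħ m β (packet hħ hσ₀ m q p t) - fourierInvL2 (packet hħ hσ₀ m q p t)‖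
      ≤ errorConst * smallParam ħ m σ₀ β (q, p) ^ N := by
  have tail_le : ‖cutNeg (fourierInvL2 (packet hħ hσ₀ m q p t))‖ ≤ smallParam ħ m σ₀ β (q, p) ^ N :=
    norm_indicatorCLM_packet_le_rpow hħ hm.ne' hσ₀ hq hp hN0 hN hs hd measurableSet_Iio
      fun x hneg => mul_nonpos_of_nonpos_of_nonneg (le_of_lt hneg) hx
  have approx := norm_scatter_sub_le_of_incoming (norm_one_sub_transmission_le ħ m β _)
    (norm_transmit_packet_sub_le_rpow hħ hm hσ₀ hq hp hβ hN (by linarith) t)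
  rw [errorConst]
  linarith

theorem norm_scatter_packet_sub_le_of_nonpos (hħ : 0 < ħ) (hm : 0 < m) (hσ₀ : 0 < σ₀) (hq : q ≠ 0)
    (hp : p ≠ 0) (hβ : β ≠ ((0 : ℝ) : OnePoint ℝ)) (hN0 : 0 ≤ N) (hN : N ≤ 7 / 2)
    (hs : smallParam ħ m σ₀ β (q, p) < 1 / 20000)
    (hd : 16 * q ^ 2 * (N * smallParam ħ m σ₀ β (q, p) * |Real.log (smallParam ħ m σ₀ β (q, p))|)
      ≤ (q + p / m * t) ^ 2)
    (hx : q + p / m * t ≤ 0) :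
    ‖scatter ħ m β (packet hħ hσ₀ m q p t) - (fourierInvL2 (packet hħ hσ₀ m q p t)
        - (1 - transmission ħ m β (p / (2 * Real.pi * ħ))) •
          (fourierInvL2 (packet hħ hσ₀ m q p t) - parity (fourierInvL2 (packet hħ hσ₀ m q p t))))‖
      ≤ errorConst * smallParam ħ m σ₀ β (q, p) ^ N := by
  have tail_le : ‖cutPos (fourierInvL2 (packet hħ hσ₀ m q p t))‖ ≤ smallParam ħ m σ₀ β (q, p) ^ N :=
    norm_indicatorCLM_packet_le_rpow hħ hm.ne' hσ₀ hq hp hN0 hN hs hd measurableSet_Ioi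
      fun x hpos => mul_nonpos_of_nonneg_of_nonpos (le_of_lt hpos) hx
  have approx := norm_scatter_sub_le_of_outgoing (norm_one_sub_transmission_le ħ m β _)
    (norm_transmit_packet_sub_le_rpow hħ hm hσ₀ hq hp hβ hN (by linarith) t)
  rw [errorConst]
  linarith

theorem fourierInvL2_packet_ae_eq_classicalApprox (hħ : 0 < ħ) (hm : m ≠ 0) (hσ₀ : 0 < σ₀)
    (β : OnePoint ℝ) (hq : 0 < q) (hx : 0 < q + p / m * t) :
    fourierInvL2 (packet hħ hσ₀ m q p t) =ᵐ[volume] classicalApprox ħ m σ₀ β t (q, p) := by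
  filter_upwards [coeFn_fourierInvL2_packet hħ hσ₀ hm q p t] with x hpacket
  rw [hpacket, classicalApprox_of_pos ħ σ₀ β hq hx]

theorem sub_smul_sub_parity_ae_eq_classicalApprox (hħ : 0 < ħ) (hm : 0 < m) (hσ₀ : 0 < σ₀)
    (hβ : β ≠ ((0 : ℝ) : OnePoint ℝ)) (hq : 0 < q) (hx : q + p / m * t < 0) :
    ((fourierInvL2 (packet hħ hσ₀ m q p t)
        - (1 - transmission ħ m β (p / (2 * Real.pi * ħ))) •
          (fourierInvL2 (packet hħ hσ₀ m q p t)
            - parity (fourierInvL2 (packet hħ hσ₀ m q p t))) : L2) : ℝ → ℂ)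
      =ᵐ[volume] classicalApprox ħ m σ₀ β t (q, p) := by
  have packet_eq := coeFn_fourierInvL2_packet hħ hσ₀ hm.ne' q p t
  set G := fourierInvL2 (packet hħ hσ₀ m q p t)
  set T := transmission ħ m β (p / (2 * Real.pi * ħ)) with T_def
  filter_upwards [Lp.coeFn_sub G ((1 - T) • (G - parity G)), Lp.coeFn_smul (1 - T) (G - parity G),
    Lp.coeFn_sub G (parity G), coeFn_parity G, packet_eq, ae_comp_neg packet_eq]
    with x hsub hsmul hodd hparity hpos hneg
  rw [hsub, Pi.sub_apply, hsmul, Pi.smul_apply, hodd, Pi.sub_apply, hparity, hpos, hneg,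
    smul_eq_mul, classicalApprox_of_neg hħ.ne' hm σ₀ hβ hq hx, ← T_def]
  ring

variable {U : ℝ → L2 ≃ₗᵢ[ℂ] L2}

theorem norm_unitaryGroup_coherentVec_sub_le (hħ : 0 < ħ) (hm : m ≠ 0) (hσ₀ : 0 < σ₀)
    (hU : IsUnitaryGroupOf ħ (Hamiltonian ħ m β) U) (q p t : ℝ) (v : L2) :
    ‖U t (coherentVec hħ hσ₀ (q, p)) - v‖
      ≤ ‖scatter ħ m β (packet hħ hσ₀ m q p 0) - fourierInvL2 (packet hħ hσ₀ m q p 0)‖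
        + ‖scatter ħ m β (packet hħ hσ₀ m q p t) - v‖ := by
  rw [← fourierInvL2_packet_zero hħ hσ₀ hm, ← unitaryGroup_scatter_packet hħ hσ₀ hU q p t,
    norm_sub_rev (scatter ħ m β _) (fourierInvL2 _), ← (U t).norm_map (_ - scatter ħ m β _),
    _root_.map_sub]
  exact norm_sub_le_norm_sub_add_norm_sub _ _ _

theorem exists_norm_unitaryGroup_sub_le (hħ : 0 < ħ) (hm : 0 < m) (hσ₀ : 0 < σ₀)
    (hβ : β ≠ ((0 : ℝ) : OnePoint ℝ)) (hU : IsUnitaryGroupOf ħ (Hamiltonian ħ m β) U) (hq : 0 < q)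
    (hp : p ≠ 0) (hN0 : 0 < N) (hN : N ≤ 7 / 2) (hs : smallParam ħ m σ₀ β (q, p) < 1 / 20000)
    (ht : 4 * |collisionTime m (q, p)| * √(N * smallParam ħ m σ₀ β (q, p) *
      |Real.log (smallParam ħ m σ₀ β (q, p))|) ≤ |t - collisionTime m (q, p)|) :
    ∃ v : L2, v =ᵐ[volume] classicalApprox ħ m σ₀ β t (q, p) ∧
      ‖U t (coherentVec hħ hσ₀ (q, p)) - v‖
        ≤ 2 * errorConst * smallParam ħ m σ₀ β (q, p) ^ N := by
  have h0 := smallParam_pos hħ hσ₀.ne' hq.ne' m β p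
  have w_le := mul_mul_abs_log_le_one_div_sixteen h0 hs hN
  have abs_log_pos : 0 < |Real.log (smallParam ħ m σ₀ β (q, p))| :=
    abs_pos.2 (Real.log_neg h0 (by linarith)).ne
  have w_pos : 0 < N * smallParam ħ m σ₀ β (q, p) * |Real.log (smallParam ħ m σ₀ β (q, p))| := by
    positivity
  have far := sq_le_of_le_abs_sub_collisionTime hm.ne' hp w_pos.le ht
  have start_le := norm_scatter_packet_sub_le_of_nonneg (t := 0) hħ hm hσ₀ hq.ne' hp hβ hN0.le hN hs
    (by rw [mul_zero, add_zero]; nlinarith [sq_nonneg q]) (by rw [mul_zero, add_zero]; exact hq.le)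
  suffices ∃ v : L2, v =ᵐ[volume] classicalApprox ħ m σ₀ β t (q, p) ∧
      ‖scatter ħ m β (packet hħ hσ₀ m q p t) - v‖
        ≤ errorConst * smallParam ħ m σ₀ β (q, p) ^ N by
    obtain ⟨v, hv, end_le⟩ := this
    refine ⟨v, hv, (norm_unitaryGroup_coherentVec_sub_le hħ hm.ne' hσ₀ hU q p t v).trans ?_⟩
    linarith
  have sq_pos : 0 < (q + p / m * t) ^ 2 := lt_of_lt_of_le (by positivity) far
  rcases lt_or_gt_of_ne (pow_ne_zero_iff two_ne_zero |>.1 sq_pos.ne') with hx | hx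
  · exact ⟨_, sub_smul_sub_parity_ae_eq_classicalApprox hħ hm hσ₀ hβ hq hx,
      norm_scatter_packet_sub_le_of_nonpos hħ hm hσ₀ hq.ne' hp hβ hN0.le hN hs far hx.le⟩
  · exact ⟨_, fourierInvL2_packet_ae_eq_classicalApprox hħ hm.ne' hσ₀ β hq hx,
      norm_scatter_packet_sub_le_of_nonneg hħ hm hσ₀ hq.ne' hp hβ hN0.le hN hs far hx.le⟩

theorem eLpNorm_unitaryGroup_sub_le (hħ : 0 < ħ) (hσ₀ : 0 < σ₀) {ξ : ℝ × ℝ} {C : ℝ} {v : L2}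
    (hv : v =ᵐ[volume] classicalApprox ħ m σ₀ β t ξ)
    (hC : ‖U t (coherentVec hħ hσ₀ ξ) - v‖ ≤ C) :
    eLpNorm (fun x : ℝ => (U t (coherentVec hħ hσ₀ ξ) : ℝ → ℂ) x
      - classicalApprox ħ m σ₀ β t ξ x) 2 volume ≤ ENNReal.ofReal C := by
  have norm_eq : eLpNorm (fun x : ℝ => (U t (coherentVec hħ hσ₀ ξ) : ℝ → ℂ) x
      - classicalApprox ħ m σ₀ β t ξ x) 2 volume = ‖U t (coherentVec hħ hσ₀ ξ) - v‖ₑ := by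
    rw [Lp.enorm_def]
    refine eLpNorm_congr_ae ?_
    filter_upwards [hv, Lp.coeFn_sub (U t (coherentVec hħ hσ₀ ξ)) v] with x happrox hsub
    rw [hsub, Pi.sub_apply, happrox]
  rw [norm_eq, ← ofReal_norm]
  exact ENNReal.ofReal_le_ofReal hC

theorem exists_norm_unitaryGroup_sub_le_of_mul_ne_zero (hħ : 0 < ħ) (hm : 0 < m) (hσ₀ : 0 < σ₀)
    (hβ : β ≠ ((0 : ℝ) : OnePoint ℝ)) (hU : IsUnitaryGroupOf ħ (Hamiltonian ħ m β) U)
    (hqp : q * p ≠ 0) (hN0 : 0 < N) (hN : N ≤ 7 / 2)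
    (hs : smallParam ħ m σ₀ β (q, p) < 1 / 20000)
    (ht : 4 * |collisionTime m (q, p)| * √(N * smallParam ħ m σ₀ β (q, p) *
      |Real.log (smallParam ħ m σ₀ β (q, p))|) ≤ |t - collisionTime m (q, p)|) :
    ∃ v : L2, v =ᵐ[volume] classicalApprox ħ m σ₀ β t (q, p) ∧
      ‖U t (coherentVec hħ hσ₀ (q, p)) - v‖
        ≤ 2 * errorConst * smallParam ħ m σ₀ β (q, p) ^ N := by
  rcases lt_or_gt_of_ne (left_ne_zero_of_mul hqp) with hq | hq
  · have reflect : (q, p) = -(-q, -p) := Prod.ext (neg_neg q).symm (neg_neg p).symm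
    rw [reflect, smallParam_neg, collisionTime_neg] at ht
    rw [reflect, smallParam_neg] at hs
    obtain ⟨v, hv, v_le⟩ := exists_norm_unitaryGroup_sub_le hħ hm hσ₀ hβ hU (neg_pos.2 hq)
      (neg_ne_zero.2 (right_ne_zero_of_mul hqp)) hN0 hN hs ht
    refine ⟨parity v, ?_, ?_⟩
    · filter_upwards [coeFn_parity v, ae_comp_neg hv] with x hparity hneg
      rw [hparity, hneg, reflect, classicalApprox_neg]
    · rwa [reflect, smallParam_neg, ← parity_coherentVec, unitaryGroup_parity hU hħ hm,
        ← _root_.map_sub, LinearIsometryEquiv.norm_map]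
  · exact exists_norm_unitaryGroup_sub_le hħ hm hσ₀ hβ hU hq (right_ne_zero_of_mul hqp) hN0 hN hs ht

end WavePacket

end DeltaPrime

end

theorem corollary1p2_general :
    (∀ (ħ m : ℝ) (β : OnePoint ℝ), 0 < ħ → 0 < m →
      ∃! U : ℝ → L2 ≃ₗᵢ[ℂ] L2, IsUnitaryGroupOf ħ (Hamiltonian ħ m β) U) ∧
    ∃ hs C c₀ : ℝ, 0 < hs ∧ hs < 1 ∧ 0 < C ∧ 0 < c₀ ∧
      ∀ lam : ℝ, 0 ≤ lam → lam < 7 / 2 →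
        ∀ (ħ m σ₀ : ℝ) (hħ : 0 < ħ) (_ : 0 < m) (hσ₀ : 0 < σ₀)
          (β : OnePoint ℝ) (_ : β ≠ ((0 : ℝ) : OnePoint ℝ))
          (U : ℝ → L2 ≃ₗᵢ[ℂ] L2) (_ : IsUnitaryGroupOf ħ (Hamiltonian ħ m β) U)
          (q p t : ℝ), q * p ≠ 0 →
          smallParam ħ m σ₀ β (q, p) < hs →
          c₀ * |collisionTime m (q, p)| *
              Real.sqrt ((7 / 2 - lam) * smallParam ħ m σ₀ β (q, p) *
                |Real.log (smallParam ħ m σ₀ β (q, p))|)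
            ≤ |t - collisionTime m (q, p)| →
          eLpNorm (fun x : ℝ => (U t (coherentVec hħ hσ₀ (q, p)) : ℝ → ℂ) x
              - classicalApprox ħ m σ₀ β t (q, p) x) 2 volume
            ≤ ENNReal.ofReal (C * smallParam ħ m σ₀ β (q, p) ^ (7 / 2 - lam)) := by
  refine ⟨fun ħ m β hħ hm => existsUnique_isUnitaryGroupOf hħ hm β,
    1 / 20000, 2 * errorConst, 4, by norm_num, by norm_num, mul_pos two_pos errorConst_pos,
    by norm_num, ?_⟩
  intro lam hlam hlam' ħ m σ₀ hħ hm hσ₀ β hβ U hU q p t hqp hs ht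
  obtain ⟨v, hv, v_le⟩ := exists_norm_unitaryGroup_sub_le_of_mul_ne_zero hħ hm hσ₀ hβ hU hqp
    (sub_pos.2 hlam') (sub_le_self _ hlam) hs ht
  exact eLpNorm_unitaryGroup_sub_le hħ hσ₀ hv v_le

theorem corollary1p2 :
    (∀ (ħ m : ℝ) (β : OnePoint ℝ), 0 < ħ → 0 < m → β ≠ ((0 : ℝ) : OnePoint ℝ) →
      ∃! U : ℝ → L2 ≃ₗᵢ[ℂ] L2, IsUnitaryGroupOf ħ (Hamiltonian ħ m β) U) ∧
    ∀ lam : ℝ, 0 < lam → lam < 1 / 2 →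
      ∃ hs C c₀ : ℝ, 0 < hs ∧ hs < 1 ∧ 0 < C ∧ 0 < c₀ ∧
        ∀ (ħ m σ₀ : ℝ) (hħ : 0 < ħ) (_ : 0 < m) (hσ₀ : 0 < σ₀)
          (β : OnePoint ℝ) (_ : β ≠ ((0 : ℝ) : OnePoint ℝ))
          (U : ℝ → L2 ≃ₗᵢ[ℂ] L2) (_ : IsUnitaryGroupOf ħ (Hamiltonian ħ m β) U)
          (q p t : ℝ), q * p ≠ 0 →
          smallParam ħ m σ₀ β (q, p) < hs →
          c₀ * |collisionTime m (q, p)| *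
              Real.sqrt ((7 / 2 - lam) * smallParam ħ m σ₀ β (q, p) *
                |Real.log (smallParam ħ m σ₀ β (q, p))|)
            ≤ |t - collisionTime m (q, p)| →
          eLpNorm (fun x : ℝ => (U t (coherentVec hħ hσ₀ (q, p)) : ℝ → ℂ) x
              - classicalApprox ħ m σ₀ β t (q, p) x) 2 volume
            ≤ ENNReal.ofReal (C * smallParam ħ m σ₀ β (q, p) ^ (7 / 2 - lam)) := by
  obtain ⟨existsUnique_group, hs, C, c₀, hs_pos, hs_lt, C_pos, c₀_pos, estimate⟩ :=
    corollary1p2_general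
  exact ⟨fun ħ m β hħ hm _ => existsUnique_group ħ m β hħ hm, fun lam hlam hlam' =>
    ⟨hs, C, c₀, hs_pos, hs_lt, C_pos, c₀_pos, estimate lam hlam.le (by linarith)⟩⟩
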